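/- Let $d\in\{2,3\}$ and let $D\subset\mathbb R^d$ be a bounded domain. Let $A\in\mathbb R^{d\times d}$ be a constant symmetric positive definite matrix and $n>0$ a constant. Let $M\ge 0$, let $A_1,\dots,A_M\in\mathbb R^{d\times d}$ be constant symmetric positive definite matrices, let $B_1,\dots,B_M\subset\mathbb R^d$ be images of open balls centered at the origin under $C^\infty$ diffeomorphisms of $\mathbb R^d$, and let $z_1,\dots,z_M\in D$ satisfy $|z_i-z_j|\ge c_0$ for $i\ne j$ and $\operatorname{dist}(z_m,\partial D)\ge c_0$ for some $c_0>0$. For $\varepsilon>0$ small let $A_\varepsilon=A_m$ in $z_m+\varepsilon B_m$ $(m=1,\dots,M)$ and $A_\varepsilon=A$ elsewhere in $D$; let $A_0=A$ in $D$. For a symmetric matrix $S$ let $S_{\min}=\inf_{|\xi|=1}\overline\xi\cdot S\xi$ and $S_{\max}=\sup_{|\xi|=1}\overline\xi\cdot S\xi$. Assume that either $A_{\min}>1$ and $(A_m)_{\min}>1$ for all $m$, and put $\kappa=A_{\min}$; or $A_{\max}<1$ and $(A_m)_{\max}<1$ for all $m$, and put $\kappa=A_{\max}$. All functions are complex valued.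 Let $X(D)=\{(w,v)\in H^1(D)\times H^1(D): w-v\in H^1_0(D)\}$ with the inner product of $H^1(D)\times H^1(D)$, where $H^1_0(D)$ is the closure of $C_c^\infty(D)$ in $H^1(D)$. Let $\mathbf A_\varepsilon$ ($\varepsilon\ge0$), $\mathbf B_0$ and $\mathbf C$ be the bounded operators on $X(D)$ that represent, by the Riesz theorem, the sesquilinear forms $$\mathcal A_\varepsilon\big((w,v);(\varphi_1,\varphi_2)\big)=\int_D A_\varepsilon\nabla w\cdot\nabla\overline{\varphi}_1+\kappa\, w\overline{\varphi}_1\,dx-\int_D\nabla v\cdot\nabla\overline{\varphi}_2+v\overline{\varphi}_2\,dx,$$ $$\mathcal B_0\big((w,v);(\varphi_1,\varphi_2)\big)=\int_D n\,w\overline{\varphi}_1-v\overline{\varphi}_2\,dx,\qquad \mathcal C\big((w,v);(\varphi_1,\varphi_2)\big)=\int_D\kappa\, w\overline{\varphi}_1-v\overline{\varphi}_2\,dx .$$ Then $\mathbf A_0$ is invertible, and $\mathbf A_\varepsilon$ is invertible for all sufficiently small $\varepsilon>0$. For $\tau\in\mathbb C\setminus\{0\}$ put $\mathbf T_\varepsilon(\tau)=\mathbf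 A_\varepsilon^{-1}\mathbf B_0+\frac1\tau\mathbf A_\varepsilon^{-1}\mathbf C$, and let $\mathbf T_\varepsilon^*(\tau)$ be its Hilbert space adjoint in $X(D)$. Let $\tau\in\mathbb C\setminus\{0\}$ and let $(w_\tau,v_\tau)\in X(D)$ be a corresponding eigenfunction: $(w_\tau,v_\tau)\neq(0,0)$ and $\tau\,\mathbf T_0(\tau)(w_\tau,v_\tau)=(w_\tau,v_\tau)$, where $w_\tau$ and $v_\tau$ are $C^\infty$ in $D$. Then $$\big\|\mathbf T_\varepsilon^*(\tau)(w_\tau,v_\tau)-\mathbf T_0^*(\tau)(w_\tau,v_\tau)\big\|_{X(D)}=\mathcal O\big(\varepsilon^{d/2+1}\big)\qquad(\varepsilon\to0^+).$$ -/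

import Mathlib

open MeasureTheory Filter Topology Asymptotics
open scoped ENNReal ComplexConjugate ContDiff Pointwise

noncomputable section

namespace TransmissionEig

/-- `ℝ^d` with the Euclidean norm. -/
abbrev Pt (d : ℕ) : Type := EuclideanSpace ℝ (Fin d)

/-- `ℂ^d` with the Hermitian norm. -/
abbrev CVec (d : ℕ) : Type := EuclideanSpace ℂ (Fin d)

/-- Lebesgue measure on `D`. -/
abbrev leb {d : ℕ} (D : Set (Pt d)) : Measure (Pt d) := volume.restrict D

/-! ### Sobolev spaces -/

/-- The Hilbert space `L²(D; ℂ) × L²(D; ℂ^d)` of pairs `(u, g)`, with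
`‖(u, g)‖² = ‖u‖² + ‖g‖²`. The space `H¹(D)` is its subspace of the pairs in which `g` is the
weak gradient of `u`. -/
abbrev L2Pair {d : ℕ} (D : Set (Pt d)) : Type :=
  WithLp 2 (Lp ℂ 2 (leb D) × Lp (CVec d) 2 (leb D))

/-- Test functions: complex valued, `C^∞`, compactly supported in `D`. -/
def IsTest {d : ℕ} (D : Set (Pt d)) (η : Pt d → ℂ) : Prop :=
  ContDiff ℝ ∞ η ∧ HasCompactSupport η ∧ tsupport η ⊆ D

/-- The partial derivative `∂ η / ∂ x_i`. -/
def pderiv {d : ℕ} (i : Fin d) (η : Pt d → ℂ) (x : Pt d) : ℂ :=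
  fderiv ℝ η x (EuclideanSpace.single i 1)

/-- The gradient of a function `ℝ^d → ℂ`. -/
def grad {d : ℕ} (η : Pt d → ℂ) (x : Pt d) : CVec d :=
  WithLp.toLp 2 fun i => pderiv i η x

/-- `g` is the weak gradient of `u` in `D`. -/
def IsWeakGrad {d : ℕ} (D : Set (Pt d)) (u : Lp ℂ 2 (leb D)) (g : Lp (CVec d) 2 (leb D)) : Prop :=
  ∀ η : Pt d → ℂ, IsTest D η → ∀ i : Fin d,
    ∫ x in D, u x * pderiv i η x = - ∫ x in D, g x i * η x

theorem IsTest.memLp {d : ℕ} {D : Set (Pt d)} {η : Pt d → ℂ} (h : IsTest D η) :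
    MemLp η 2 (leb D) :=
  (h.1.continuous.memLp_of_hasCompactSupport h.2.1).restrict D

theorem continuous_pderiv {d : ℕ} {η : Pt d → ℂ} (h : ContDiff ℝ ∞ η) (i : Fin d) :
    Continuous (pderiv i η) :=
  (h.continuous_fderiv (by simp)).clm_apply continuous_const

theorem IsTest.memLp_pderiv {d : ℕ} {D : Set (Pt d)} {η : Pt d → ℂ} (h : IsTest D η) (i : Fin d) :
    MemLp (pderiv i η) 2 (leb D) := by
  refine ((continuous_pderiv h.1 i).memLp_of_hasCompactSupport ?_).restrict D
  have h1 : HasCompactSupport (fderiv ℝ η) := h.2.1.fderiv (𝕜 := ℝ)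
  exact h1.comp_left (g := fun L : Pt d →L[ℝ] ℂ => L (EuclideanSpace.single i 1)) (by simp)

theorem integral_mul_eq_inner {d : ℕ} {D : Set (Pt d)} {f : Pt d → ℂ} (hf : MemLp f 2 (leb D))
    (u : Lp ℂ 2 (leb D)) :
    ∫ x in D, u x * f x = inner ℂ (hf.star.toLp (star f)) u := by
  rw [L2.inner_def]
  refine integral_congr_ae ?_
  filter_upwards [hf.star.coeFn_toLp] with x hx
  rw [hx]
  simp [RCLike.inner_apply]

theorem integral_apply_mul_eq_inner {d : ℕ} {D : Set (Pt d)} {f : Pt d → ℂ}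
    (hf : MemLp f 2 (leb D)) (i : Fin d) :
    ∃ F : Lp (CVec d) 2 (leb D), ∀ g : Lp (CVec d) 2 (leb D),
      ∫ x in D, g x i * f x = inner ℂ F g := by
  have hF : MemLp (fun x => EuclideanSpace.single i (star (f x)) : Pt d → CVec d) 2 (leb D) := by
    refine hf.of_le_mul (c := 1) ?_ ?_
    · have hc : Continuous fun c : ℂ => (EuclideanSpace.single i (star c) : CVec d) := by
        refine (PiLp.continuous_toLp 2 _).comp ?_
        exact (continuous_single i).comp continuous_star
      exact hc.comp_aestronglyMeasurable hf.1
    · exact Eventually.of_forall fun x => by simp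
  refine ⟨hF.toLp _, fun g => ?_⟩
  rw [L2.inner_def]
  refine integral_congr_ae ?_
  filter_upwards [hF.coeFn_toLp] with x hx
  rw [hx]
  simp [EuclideanSpace.inner_single_left, mul_comm]

theorem isWeakGrad_iff {d : ℕ} {D : Set (Pt d)} :
    ∃ (ι : Type) (F : ι → L2Pair D), ∀ p : L2Pair D,
      IsWeakGrad D p.fst p.snd ↔ ∀ k, inner ℂ (F k) p = 0 := by
  choose G hG using fun (η : {η : Pt d → ℂ // IsTest D η}) (i : Fin d) =>
    integral_apply_mul_eq_inner η.2.memLp i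
  refine ⟨{η : Pt d → ℂ // IsTest D η} × Fin d, fun k =>
    WithLp.toLp 2 ((k.1.2.memLp_pderiv k.2).star.toLp _, G k.1 k.2), fun p => ?_⟩
  have key : ∀ (η : {η : Pt d → ℂ // IsTest D η}) (i : Fin d),
      (∫ x in D, p.fst x * pderiv i η.1 x = - ∫ x in D, p.snd x i * η.1 x) ↔
      inner ℂ (WithLp.toLp 2 ((η.2.memLp_pderiv i).star.toLp _, G η i) : L2Pair D) p = 0 := by
    intro η i
    rw [WithLp.prod_inner_apply, integral_mul_eq_inner (η.2.memLp_pderiv i), hG η i,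
      eq_neg_iff_add_eq_zero]
    exact Iff.rfl
  constructor
  · rintro h ⟨η, i⟩
    exact (key η i).1 (h η.1 η.2 i)
  · intro h η hη i
    exact (key ⟨η, hη⟩ i).2 (h (⟨η, hη⟩, i))

/-- The Sobolev space `H¹(D)`, with `‖u‖²_{H¹} = ‖u‖²_{L²} + ‖∇u‖²_{L²}`. -/
def H1 {d : ℕ} (D : Set (Pt d)) : Submodule ℂ (L2Pair D) where
  carrier := {p | IsWeakGrad D p.fst p.snd}
  zero_mem' := by
    obtain ⟨ι, F, hF⟩ := isWeakGrad_iff (D := D)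
    exact (hF 0).2 fun k => inner_zero_right _
  add_mem' := by
    intro p q hp hq
    obtain ⟨ι, F, hF⟩ := isWeakGrad_iff (D := D)
    refine (hF (p + q)).2 fun k => ?_
    rw [inner_add_right, (hF p).1 hp k, (hF q).1 hq k, add_zero]
  smul_mem' := by
    intro c p hp
    obtain ⟨ι, F, hF⟩ := isWeakGrad_iff (D := D)
    refine (hF (c • p)).2 fun k => ?_
    rw [inner_smul_right, (hF p).1 hp k, mul_zero]

theorem isClosed_H1 {d : ℕ} (D : Set (Pt d)) : IsClosed (H1 D : Set (L2Pair D)) := by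
  obtain ⟨ι, F, hF⟩ := isWeakGrad_iff (D := D)
  have : (H1 D : Set (L2Pair D)) = ⋂ k, {p | inner ℂ (F k) p = 0} := by
    ext p
    simp only [Set.mem_iInter, Set.mem_ofPred_eq]
    exact hF p
  rw [this]
  exact isClosed_iInter fun k =>
    isClosed_eq (continuous_const.inner continuous_id) continuous_const

/-- The test functions, together with their gradients, as a subspace of `H¹(D)`. -/
def testSubspace {d : ℕ} (D : Set (Pt d)) : Submodule ℂ (L2Pair D) :=
  Submodule.span ℂ {p | ∃ η : Pt d → ℂ, IsTest D η ∧ p.fst =ᵐ[leb D] η ∧ p.snd =ᵐ[leb D] grad η}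

/-- `H¹₀(D)`, the closure of the test functions in the `H¹` norm. -/
def H10 {d : ℕ} (D : Set (Pt d)) : Submodule ℂ (L2Pair D) :=
  (testSubspace D).topologicalClosure

/-- The variational space `X(D) = {(w, v) ∈ H¹(D) × H¹(D) : w - v ∈ H¹₀(D)}`. -/
def XSub {d : ℕ} (D : Set (Pt d)) : Submodule ℂ (WithLp 2 (L2Pair D × L2Pair D)) where
  carrier := {p | p.fst ∈ H1 D ∧ p.snd ∈ H1 D ∧ p.fst - p.snd ∈ H10 D}
  zero_mem' := ⟨(H1 D).zero_mem, (H1 D).zero_mem, by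
    simp⟩
  add_mem' := by
    rintro p q ⟨hp1, hp2, hp3⟩ ⟨hq1, hq2, hq3⟩
    refine ⟨(H1 D).add_mem hp1 hq1, (H1 D).add_mem hp2 hq2, ?_⟩
    have := (H10 D).add_mem hp3 hq3
    rwa [← add_sub_add_comm] at this
  smul_mem' := by
    rintro c p ⟨hp1, hp2, hp3⟩
    refine ⟨(H1 D).smul_mem c hp1, (H1 D).smul_mem c hp2, ?_⟩
    have := (H10 D).smul_mem c hp3
    rwa [smul_sub] at this

theorem isClosed_XSub {d : ℕ} (D : Set (Pt d)) :
    IsClosed (XSub D : Set (WithLp 2 (L2Pair D × L2Pair D))) := by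
  have h1 : Continuous fun p : WithLp 2 (L2Pair D × L2Pair D) => p.fst :=
    (WithLp.fstL 2 ℂ (L2Pair D) (L2Pair D)).continuous
  have h2 : Continuous fun p : WithLp 2 (L2Pair D × L2Pair D) => p.snd :=
    (WithLp.sndL 2 ℂ (L2Pair D) (L2Pair D)).continuous
  exact ((isClosed_H1 D).preimage h1).inter (((isClosed_H1 D).preimage h2).inter
    ((testSubspace D).isClosed_topologicalClosure.preimage (h1.sub h2)))

/-- `X(D)` with the inner product of `H¹(D) × H¹(D)`. -/
def X {d : ℕ} (D : Set (Pt d)) : Type := XSub D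

instance {d : ℕ} (D : Set (Pt d)) : NormedAddCommGroup (X D) :=
  inferInstanceAs (NormedAddCommGroup (XSub D))

instance {d : ℕ} (D : Set (Pt d)) : InnerProductSpace ℂ (X D) :=
  inferInstanceAs (InnerProductSpace ℂ (XSub D))

instance {d : ℕ} (D : Set (Pt d)) : CompleteSpace (X D) :=
  (isClosed_XSub D).completeSpace_coe

section components
variable {d : ℕ} {D : Set (Pt d)}

/-- The isometric inclusion of `X(D)` in the product of two spaces `L²(D; ℂ) × L²(D; ℂ^d)`. -/
def X.incl : X D →ₗᵢ[ℂ] WithLp 2 (L2Pair D × L2Pair D) := (XSub D).subtypeₗᵢ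

/-- The component `(w, v) ↦ w`. -/
def X.w : X D →L[ℂ] Lp ℂ 2 (leb D) :=
  WithLp.fstL 2 ℂ (Lp ℂ 2 (leb D)) (Lp (CVec d) 2 (leb D)) ∘L
    WithLp.fstL 2 ℂ (L2Pair D) (L2Pair D) ∘L X.incl.toContinuousLinearMap

/-- The component `(w, v) ↦ ∇w`. -/
def X.dw : X D →L[ℂ] Lp (CVec d) 2 (leb D) :=
  WithLp.sndL 2 ℂ (Lp ℂ 2 (leb D)) (Lp (CVec d) 2 (leb D)) ∘L
    WithLp.fstL 2 ℂ (L2Pair D) (L2Pair D) ∘L X.incl.toContinuousLinearMap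

/-- The component `(w, v) ↦ v`. -/
def X.v : X D →L[ℂ] Lp ℂ 2 (leb D) :=
  WithLp.fstL 2 ℂ (Lp ℂ 2 (leb D)) (Lp (CVec d) 2 (leb D)) ∘L
    WithLp.sndL 2 ℂ (L2Pair D) (L2Pair D) ∘L X.incl.toContinuousLinearMap

/-- The component `(w, v) ↦ ∇v`. -/
def X.dv : X D →L[ℂ] Lp (CVec d) 2 (leb D) :=
  WithLp.sndL 2 ℂ (Lp ℂ 2 (leb D)) (Lp (CVec d) 2 (leb D)) ∘L
    WithLp.sndL 2 ℂ (L2Pair D) (L2Pair D) ∘L X.incl.toContinuousLinearMap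

end components

/-! ### Sesquilinear forms and operators -/

/-- The product `M ξ` of a real matrix and a complex vector. -/
def matVec {d : ℕ} (M : Matrix (Fin d) (Fin d) ℝ) (ξ : CVec d) : CVec d :=
  WithLp.toLp 2 fun i => ∑ j, (M i j : ℂ) * ξ j

/-- The product `ξ · conj η`. -/
def dotConj {d : ℕ} (ξ η : CVec d) : ℂ := ∑ i, ξ i * conj (η i)

/-- `inf_{|ξ| = 1} conj ξ · M ξ`. -/
def lowerBd {d : ℕ} (M : Matrix (Fin d) (Fin d) ℝ) : ℝ :=
  ⨅ ξ : Metric.sphere (0 : CVec d) 1, (dotConj (matVec M ξ) ξ).re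

/-- `sup_{|ξ| = 1} conj ξ · M ξ`. -/
def upperBd {d : ℕ} (M : Matrix (Fin d) (Fin d) ℝ) : ℝ :=
  ⨆ ξ : Metric.sphere (0 : CVec d) 1, (dotConj (matVec M ξ) ξ).re

/-- `𝒜((w,v);(φ₁,φ₂)) = ∫_D a∇w·∇φ̄₁ + κ w φ̄₁ dx - ∫_D ∇v·∇φ̄₂ + v φ̄₂ dx`
for the matrix field `a`. -/
def formA {d : ℕ} (D : Set (Pt d)) (a : Pt d → Matrix (Fin d) (Fin d) ℝ) (κ : ℝ) (f φ : X D) : ℂ :=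
  (∫ x in D, dotConj (matVec (a x) (X.dw f x)) (X.dw φ x) + κ * X.w f x * conj (X.w φ x)) -
    ∫ x in D, dotConj (X.dv f x) (X.dv φ x) + X.v f x * conj (X.v φ x)

/-- `((w,v);(φ₁,φ₂)) ↦ ∫_D m w φ̄₁ - v φ̄₂ dx` for a constant `m`. For `m = n` this is the form
`ℬ₀`, and for `m = κ` it is the form `𝒞`. -/
def formL {d : ℕ} (D : Set (Pt d)) (m : ℝ) (f φ : X D) : ℂ :=
  ∫ x in D, m * X.w f x * conj (X.w φ x) - X.v f x * conj (X.v φ x)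

open Classical in
/-- The bounded operator `T` on `X(D)` with `(T f, φ)_{X(D)} = s(f; φ)` for all `f, φ` (inner
products are conjugate linear in their first argument in Mathlib). The value `0` is used only
if there is no such operator. -/
def rieszOp {d : ℕ} {D : Set (Pt d)} (s : X D → X D → ℂ) : X D →L[ℂ] X D :=
  if h : ∃ T : X D →L[ℂ] X D, ∀ f φ : X D, inner ℂ φ (T f) = s f φ then h.choose else 0

/-- The operator `𝐀` for the matrix field `a`. -/
def opA {d : ℕ} (D : Set (Pt d)) (a : Pt d → Matrix (Fin d) (Fin d) ℝ) (κ : ℝ) : X D →L[ℂ] X D :=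
  rieszOp (formA D a κ)

/-- The operator `𝐁₀`. -/
def opB {d : ℕ} (D : Set (Pt d)) (n : ℝ) : X D →L[ℂ] X D := rieszOp (formL D n)

/-- The operator `𝐂`. -/
def opC {d : ℕ} (D : Set (Pt d)) (κ : ℝ) : X D →L[ℂ] X D := rieszOp (formL D κ)

/-- The operator `𝐓(τ) = 𝐀⁻¹ 𝐁₀ + τ⁻¹ 𝐀⁻¹ 𝐂`. -/
def opT {d : ℕ} (D : Set (Pt d)) (a : Pt d → Matrix (Fin d) (Fin d) ℝ) (κ n : ℝ) (τ : ℂ) :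
    X D →L[ℂ] X D :=
  (opA D a κ).inverse ∘L opB D n + (1 / τ) • ((opA D a κ).inverse ∘L opC D κ)

/-! ### The perturbed medium -/

/-- `B` is a smooth deformation of a ball centered at the origin: the image of such a ball under
a `C^∞` diffeomorphism of `ℝ^d`. -/
def IsSmoothBall {d : ℕ} (B : Set (Pt d)) : Prop :=
  ∃ (Φ : Pt d ≃ₜ Pt d) (r : ℝ), ContDiff ℝ ∞ Φ ∧ ContDiff ℝ ∞ Φ.symm ∧ 0 < r ∧
    B = Φ '' Metric.ball 0 r

/-- The defective region `z + ε B`. -/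
def defect {d : ℕ} (z : Pt d) (B : Set (Pt d)) (ε : ℝ) : Set (Pt d) := (fun y => z + ε • y) '' B

/-- The coefficient `A_ε`: the matrix `A_m` in `z_m + ε B_m`, and `A` outside these regions. (It is
written as a sum of indicator functions; for small `ε` the regions are pairwise disjoint.) -/
def coeff {d M : ℕ} (A : Matrix (Fin d) (Fin d) ℝ) (Am : Fin M → Matrix (Fin d) (Fin d) ℝ)
    (z : Fin M → Pt d) (B : Fin M → Set (Pt d)) (ε : ℝ) (x : Pt d) : Matrix (Fin d) (Fin d) ℝ :=
  A + ∑ m, (defect (z m) (B m) ε).indicator (fun _ => Am m - A) x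

/-! ### The operators do represent the forms -/

theorem dotConj_eq_inner {d : ℕ} (ξ η : CVec d) : dotConj ξ η = inner ℂ η ξ := by
  simp [dotConj, PiLp.inner_apply, RCLike.inner_apply]

theorem norm_matVec_le {d : ℕ} {M : Matrix (Fin d) (Fin d) ℝ} {K : ℝ} (hK : 0 ≤ K)
    (hM : ∀ i j, |M i j| ≤ K) (ξ : CVec d) : ‖matVec M ξ‖ ≤ (d * (d * K)) * ‖ξ‖ := by
  have h1 : ∀ i, ‖matVec M ξ i‖ ≤ d * K * ‖ξ‖ := by
    intro i
    simp only [matVec]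
    refine (norm_sum_le _ _).trans ?_
    refine (Finset.sum_le_sum (g := fun _ => K * ‖ξ‖) fun j _ => ?_).trans ?_
    · rw [norm_mul, Complex.norm_real]
      exact mul_le_mul (hM i j) (PiLp.norm_apply_le ξ j) (norm_nonneg _) hK
    · simp [mul_assoc]
  have h2 : matVec M ξ = ∑ i, EuclideanSpace.single i (matVec M ξ i) := by
    ext k
    simp [Pi.single_apply]
  rw [h2]
  refine (norm_sum_le _ _).trans ?_
  refine (Finset.sum_le_sum (g := fun _ => d * K * ‖ξ‖) fun i _ => ?_).trans ?_
  · simpa using h1 i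
  · simp [mul_assoc]

theorem matVec_add {d : ℕ} (M : Matrix (Fin d) (Fin d) ℝ) (ξ η : CVec d) :
    matVec M (ξ + η) = matVec M ξ + matVec M η := by
  ext i
  simp [matVec, mul_add, Finset.sum_add_distrib]

theorem matVec_smul {d : ℕ} (M : Matrix (Fin d) (Fin d) ℝ) (c : ℂ) (ξ : CVec d) :
    matVec M (c • ξ) = c • matVec M ξ := by
  ext i
  simp only [matVec, PiLp.smul_apply, smul_eq_mul, Finset.mul_sum]
  exact Finset.sum_congr rfl fun j _ => by ring

/-- Multiplication by a bounded measurable matrix field is bounded on `L²(D; ℂ^d)`. -/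
theorem exists_mulField {d : ℕ} (D : Set (Pt d)) (a : Pt d → Matrix (Fin d) (Fin d) ℝ)
    (ha : ∀ i j, Measurable fun x => a x i j) {K : ℝ} (hK : ∀ x i j, |a x i j| ≤ K) :
    ∃ N : Lp (CVec d) 2 (leb D) →L[ℂ] Lp (CVec d) 2 (leb D),
      ∀ g, N g =ᵐ[leb D] fun x => matVec (a x) (g x) := by
  have hK' : ∀ x (ξ : CVec d), ‖matVec (a x) ξ‖ ≤ (d * (d * max K 0)) * ‖ξ‖ := fun x ξ =>
    norm_matVec_le (le_max_right _ _) (fun i j => (hK x i j).trans (le_max_left _ _)) ξ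
  have hm : ∀ g : Lp (CVec d) 2 (leb D), MemLp (fun x => matVec (a x) (g x)) 2 (leb D) := by
    intro g
    refine (Lp.memLp g).of_le_mul (c := d * (d * max K 0)) ?_
      (Eventually.of_forall fun x => hK' x _)
    have hg : Measurable (g : Pt d → CVec d) := (Lp.stronglyMeasurable g).measurable
    refine Measurable.aestronglyMeasurable ?_
    refine (PiLp.continuous_toLp 2 _).measurable.comp (measurable_pi_lambda _ fun i => ?_)
    refine Finset.measurable_sum _ fun j _ => ?_
    refine (Complex.measurable_ofReal.comp (ha i j)).mul ?_
    exact (PiLp.continuous_apply 2 _ j).measurable.comp hg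
  let L : Lp (CVec d) 2 (leb D) →ₗ[ℂ] Lp (CVec d) 2 (leb D) :=
    { toFun := fun g => (hm g).toLp _
      map_add' := by
        intro f g
        apply Lp.ext
        filter_upwards [(hm (f + g)).coeFn_toLp, Lp.coeFn_add f g, (hm f).coeFn_toLp,
          (hm g).coeFn_toLp, Lp.coeFn_add ((hm f).toLp _) ((hm g).toLp _)] with x h1 h2 h3 h4 h5
        rw [h1, h5, h2, Pi.add_apply, Pi.add_apply, h3, h4, matVec_add]
      map_smul' := by
        intro c f
        apply Lp.ext
        filter_upwards [(hm (c • f)).coeFn_toLp, Lp.coeFn_smul c f, (hm f).coeFn_toLp,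
          Lp.coeFn_smul c ((hm f).toLp _)] with x h1 h2 h3 h5
        simp only [RingHom.id_apply]
        rw [h1, h5, h2, Pi.smul_apply, Pi.smul_apply, h3, matVec_smul] }
  refine ⟨L.mkContinuous (d * (d * max K 0)) fun g => ?_, fun g => (hm g).coeFn_toLp⟩
  refine Lp.norm_le_mul_norm_of_ae_le_mul ?_
  filter_upwards [(hm g).coeFn_toLp] with x hx
  change ‖(hm g).toLp _ x‖ ≤ _
  rw [hx]
  exact hK' x _

theorem rieszOp_spec {d : ℕ} {D : Set (Pt d)} {s : X D → X D → ℂ}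
    (h : ∃ T : X D →L[ℂ] X D, ∀ f φ : X D, inner ℂ φ (T f) = s f φ) (f φ : X D) :
    inner ℂ φ (rieszOp s f) = s f φ := by
  classical
  rw [rieszOp, dif_pos h]
  exact h.choose_spec f φ

theorem inner_L2_eq {d : ℕ} {D : Set (Pt d)} (u p : Lp ℂ 2 (leb D)) :
    inner ℂ p u = ∫ x in D, u x * conj (p x) := by
  rw [L2.inner_def]
  simp [RCLike.inner_apply]

theorem inner_L2vec_eq {d : ℕ} {D : Set (Pt d)} (u p : Lp (CVec d) 2 (leb D)) :
    inner ℂ p u = ∫ x in D, dotConj (u x) (p x) := by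
  rw [L2.inner_def]
  simp [dotConj_eq_inner]

theorem integrable_L2 {d : ℕ} {D : Set (Pt d)} (u p : Lp ℂ 2 (leb D)) :
    Integrable (fun x => u x * conj (p x)) (leb D) := by
  simpa [RCLike.inner_apply] using L2.integrable_inner (𝕜 := ℂ) p u

theorem integrable_L2vec {d : ℕ} {D : Set (Pt d)} (u p : Lp (CVec d) 2 (leb D)) :
    Integrable (fun x => dotConj (u x) (p x)) (leb D) := by
  simpa [dotConj_eq_inner] using L2.integrable_inner (𝕜 := ℂ) p u

/-- For a bounded measurable matrix field, `𝐀` represents the form `𝒜`. -/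
theorem inner_opA {d : ℕ} (D : Set (Pt d)) (a : Pt d → Matrix (Fin d) (Fin d) ℝ) (κ : ℝ)
    (ha : ∀ i j, Measurable fun x => a x i j) {K : ℝ} (hK : ∀ x i j, |a x i j| ≤ K) (f φ : X D) :
    inner ℂ φ (opA D a κ f) = formA D a κ f φ := by
  refine rieszOp_spec ?_ f φ
  obtain ⟨N, hN⟩ := exists_mulField D a ha hK
  refine ⟨ContinuousLinearMap.adjoint X.dw ∘L N ∘L X.dw + (κ : ℂ) • (ContinuousLinearMap.adjoint X.w ∘L X.w)
    - (ContinuousLinearMap.adjoint X.dv ∘L X.dv + ContinuousLinearMap.adjoint X.v ∘L X.v), fun f φ => ?_⟩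
  have hN' : (fun x => dotConj (N (X.dw f) x) (X.dw φ x)) =ᵐ[leb D]
      fun x => dotConj (matVec (a x) (X.dw f x)) (X.dw φ x) := by
    filter_upwards [hN (X.dw f)] with x hx
    rw [hx]
  simp only [_root_.sub_apply, _root_.add_apply,
    _root_.smul_apply, ContinuousLinearMap.comp_apply, inner_sub_right,
    inner_add_right, inner_smul_right, ContinuousLinearMap.adjoint_inner_right]
  rw [inner_L2_eq, inner_L2_eq, inner_L2vec_eq, inner_L2vec_eq, formA,
    integral_add (integrable_L2vec _ _) (integrable_L2 _ _), integral_congr_ae hN']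
  congr 1
  simp_rw [mul_assoc]
  rw [integral_add ((integrable_L2vec _ _).congr hN') ((integrable_L2 _ _).const_mul _),
    integral_const_mul]

/-- `𝐁₀` and `𝐂` represent the forms `ℬ₀` and `𝒞`. -/
theorem inner_opL {d : ℕ} (D : Set (Pt d)) (m : ℝ) (f φ : X D) :
    inner ℂ φ (rieszOp (formL D m) f) = formL D m f φ := by
  refine rieszOp_spec ?_ f φ
  refine ⟨(m : ℂ) • (ContinuousLinearMap.adjoint X.w ∘L X.w) - ContinuousLinearMap.adjoint X.v ∘L X.v, fun f φ => ?_⟩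
  simp only [_root_.sub_apply,
    _root_.smul_apply, ContinuousLinearMap.comp_apply, inner_sub_right,
    inner_smul_right, ContinuousLinearMap.adjoint_inner_right]
  rw [inner_L2_eq, inner_L2_eq, formL]
  simp_rw [mul_assoc]
  rw [integral_sub ((integrable_L2 _ _).const_mul _) (integrable_L2 _ _), integral_const_mul]

theorem measurableSet_defect {d : ℕ} (z : Pt d) {B : Set (Pt d)} (hB : IsSmoothBall B) (ε : ℝ) :
    MeasurableSet (defect z B ε) := by
  obtain ⟨Φ, r, -, -, -, rfl⟩ := hB
  rcases eq_or_ne ε 0 with rfl | hε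
  · refine Set.Subsingleton.measurableSet ?_
    rintro _ ⟨y, -, rfl⟩ _ ⟨y', -, rfl⟩
    simp
  · have h : IsOpenMap fun y : Pt d => z + ε • y :=
      (isOpenMap_add_left z).comp (isOpenMap_smul₀ hε)
    exact (h _ (Φ.isOpenMap _ Metric.isOpen_ball)).measurableSet

/-- The coefficient `A_ε` is bounded and measurable, so that `𝐀_ε` represents its form. -/
theorem inner_opA_coeff {d M : ℕ} (D : Set (Pt d)) (A : Matrix (Fin d) (Fin d) ℝ)
    (Am : Fin M → Matrix (Fin d) (Fin d) ℝ) (z : Fin M → Pt d) (B : Fin M → Set (Pt d))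
    (hB : ∀ m, IsSmoothBall (B m)) (κ ε : ℝ) (f φ : X D) :
    inner ℂ φ (opA D (coeff A Am z B ε) κ f) = formA D (coeff A Am z B ε) κ f φ := by
  have hval : ∀ x i j, coeff A Am z B ε x i j =
      A i j + ∑ m, (defect (z m) (B m) ε).indicator (fun _ => Am m i j - A i j) x := by
    intro x i j
    simp only [coeff, Matrix.add_apply, Matrix.sum_apply]
    congr 1
    refine Finset.sum_congr rfl fun m _ => ?_
    by_cases hx : x ∈ defect (z m) (B m) ε <;> simp [hx]
  refine inner_opA D _ κ (fun i j => ?_)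
    (K := ∑ i, ∑ j, (|A i j| + ∑ m, |Am m i j - A i j|)) (fun x i j => ?_) f φ
  · simp_rw [hval]
    exact measurable_const.add (Finset.measurable_sum _ fun m _ =>
      measurable_const.indicator (measurableSet_defect (z m) (hB m) ε))
  · have hpos : ∀ i j, 0 ≤ |A i j| + ∑ m, |Am m i j - A i j| := fun i j =>
      add_nonneg (abs_nonneg _) (Finset.sum_nonneg fun m _ => abs_nonneg _)
    refine le_trans ?_ (Finset.single_le_sum (fun i _ => Finset.sum_nonneg fun j _ => hpos i j)
      (Finset.mem_univ i))
    refine le_trans ?_ (Finset.single_le_sum (fun j _ => hpos i j) (Finset.mem_univ j))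
    rw [hval]
    refine (abs_add_le _ _).trans (add_le_add_right ?_ _)
    refine (Finset.abs_sum_le_sum_abs _ _).trans (Finset.sum_le_sum fun m _ => ?_)
    by_cases hx : x ∈ defect (z m) (B m) ε <;> simp [hx]

end TransmissionEig

end

noncomputable section

namespace TransmissionEig

/-! ### Partial derivatives of smooth functions -/

/-! Write $T_\varepsilon = \mathbf A_\varepsilon^{-1}S$ with $S=\mathbf B_0+\tau^{-1}\mathbf C$
independent of $\varepsilon$. For $g\in X(D)$ put $h=\mathbf A_0^{-1}Sg$, $h'=\mathbf
A_\varepsilon^{-1}Sg$ and $u=\mathbf A_0^{-1}\varphi$, where $\varphi=(w_\tau,v_\tau)$. Since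
$\mathbf A_0$ is symmetric and $\mathbf A_0h=Sg=\mathbf A_\varepsilon h'$, the pairing of
$(T_\varepsilon^*-T_0^*)\varphi$ with $g$ is, up to conjugation, the pairing of $(\mathbf
A_0-\mathbf A_\varepsilon)h'$ with $u$. This is an integral of $\nabla w$-components over the
defects only, so Cauchy–Schwarz bounds it by the local energies of $h'$ and $u$ there. A uniform
lower bound for $\mathbf A_\varepsilon$ bounds the local energy of $h'$ by that of $h$
(`norm_inner_adjoint_sub_sq_le`).

Both $h$ and $u$ solve problems with the constant matrix $A$, so their gradients are bounded near
the centers $z_m$: for $h$ by a multiple of $\|g\|$ (`exists_ae_norm_dw_sq_le`), for $u$ because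
$w_\tau$ is smooth (`exists_ae_norm_dw_sq_le_of_smooth`). Each local energy is then at most a
constant times the volume of the defects, which is $O(\varepsilon^d)$. The choice
$g=(T_\varepsilon^*-T_0^*)\varphi$ gives a bound $O(\varepsilon^d)$ for the norm, and $d\ge d/2+1$
because $d\ge2$.

The gradient bounds rest on an $L^2$–$L^\infty$ interior estimate. Each $\partial_l w$ is a very
weak solution of $k G-\sum A_{ij}\partial_i\partial_jG=H$ with $H\in L^2$. For smooth compactly
supported functions, the Fourier transform bounds the supremum by the $L^2$ norm of the right-hand
side, because $(1+|\xi|^2)^{-1}\in L^2(\mathbb R^d)$ for $d\le3$ (`exists_norm_le_ellOp`). Cutoffs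
and a Caccioppoli inequality make this local, and mollification extends it to very weak solutions
(`exists_ae_norm_sq_le`).

The forms are indefinite, so invertibility comes from testing $\mathcal A$ against a modified pair:
$(w,2w-v)$ for coefficients above one and $(w-2v,-v)$ for coefficients below one. This gives
$\|f\|\le C\|\mathbf A f\|$ with $C$ depending only on the bounds of the coefficients, and a
symmetric operator bounded below is invertible. -/

theorem contDiff_pderiv {d : ℕ} {η : Pt d → ℂ} (h : ContDiff ℝ ∞ η) (i : Fin d) :
    ContDiff ℝ ∞ (pderiv i η) :=
  (h.fderiv_right (m := ∞) (by simp)).clm_apply contDiff_const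

theorem tsupport_pderiv_subset {d : ℕ} (i : Fin d) (η : Pt d → ℂ) :
    tsupport (pderiv i η) ⊆ tsupport η := by
  refine closure_minimal (fun x hx => ?_) (isClosed_tsupport η)
  by_contra hx'
  have : fderiv ℝ η x = 0 := by
    by_contra h
    exact hx' (support_fderiv_subset ℝ (f := η) h)
  exact hx (by simp [pderiv, this])

theorem IsTest.pderiv {d : ℕ} {D : Set (Pt d)} {η : Pt d → ℂ} (h : IsTest D η) (i : Fin d) :
    IsTest D (pderiv i η) :=
  ⟨contDiff_pderiv h.1 i, HasCompactSupport.of_support_subset_isCompact h.2.1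
    ((subset_tsupport _).trans (tsupport_pderiv_subset i η)),
    (tsupport_pderiv_subset i η).trans h.2.2⟩

theorem pderiv_mul {d : ℕ} {f g : Pt d → ℂ} (hf : ContDiff ℝ ∞ f) (hg : ContDiff ℝ ∞ g)
    (i : Fin d) (x : Pt d) :
    pderiv i (fun y => f y * g y) x = pderiv i f x * g x + f x * pderiv i g x := by
  have h1 := (hf.differentiable (by simp)) x
  have h2 := (hg.differentiable (by simp)) x
  simp only [pderiv, fderiv_fun_mul h1 h2]
  simp [mul_comm]
  ring

theorem pderiv_comm {d : ℕ} {f : Pt d → ℂ} (hf : ContDiff ℝ ∞ f) (i j : Fin d) (x : Pt d) :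
    pderiv i (pderiv j f) x = pderiv j (pderiv i f) x := by
  have h1 : DifferentiableAt ℝ (fderiv ℝ f) x :=
    (hf.fderiv_right (m := ∞) (by simp)).differentiable (by simp) x
  have h2 : ∀ u v : Pt d, fderiv ℝ (fun y => fderiv ℝ f y u) x v = fderiv ℝ (fderiv ℝ f) x v u := by
    intro u v
    rw [fderiv_clm_apply h1 (differentiableAt_const u)]
    simp
  have h3 : IsSymmSndFDerivAt ℝ f x :=
    hf.contDiffAt.isSymmSndFDerivAt
      (by simp only [minSmoothness_of_isRCLikeNormedField]; exact ENat.LEInfty.out)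
  change fderiv ℝ (fun y => fderiv ℝ f y _) x _ = fderiv ℝ (fun y => fderiv ℝ f y _) x _
  rw [h2, h2, h3]

theorem pderiv_conj {d : ℕ} {f : Pt d → ℂ} (hf : ContDiff ℝ ∞ f) (i : Fin d) (x : Pt d) :
    pderiv i (fun y => conj (f y)) x = conj (pderiv i f x) := by
  have h := ((Complex.conjCLE.toContinuousLinearMap.hasFDerivAt (x := f x)).comp x
    ((hf.differentiable (by simp)) x).hasFDerivAt).fderiv
  have h' : fderiv ℝ (fun y => conj (f y)) x =
      Complex.conjCLE.toContinuousLinearMap ∘L fderiv ℝ f x := h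
  simp [pderiv, h']

theorem integral_pderiv_eq_zero {d : ℕ} {F : Pt d → ℂ} (hF : ContDiff ℝ ∞ F)
    (hc : HasCompactSupport F) (i : Fin d) : ∫ x, pderiv i F x = 0 := by
  -- Integration by parts against the constant `1`; only its products with `F` and its derivative
  -- have to be integrable.
  have h := integral_mul_fderiv_eq_neg_fderiv_mul_of_integrable (μ := (volume : Measure (Pt d)))
    (f := fun _ => (1 : ℂ)) (g := F) (v := EuclideanSpace.single i 1)
    (by simp) ?_ ?_ (fun x _ => differentiableAt_const _)
    (fun x _ => (hF.differentiable (by simp)) x)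
  · simpa [pderiv] using h
  · have := (contDiff_pderiv hF i).continuous.integrable_of_hasCompactSupport
      (μ := (volume : Measure (Pt d)))
      (HasCompactSupport.of_support_subset_isCompact hc
        ((subset_tsupport _).trans (tsupport_pderiv_subset i F)))
    simp only [one_mul]
    exact this
  · simpa using hF.continuous.integrable_of_hasCompactSupport hc

theorem integral_mul_pderiv {d : ℕ} {f g : Pt d → ℂ} (hf : ContDiff ℝ ∞ f)
    (hg : ContDiff ℝ ∞ g) (hc : HasCompactSupport g) (i : Fin d) :
    ∫ x, f x * pderiv i g x = - ∫ x, pderiv i f x * g x := by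
  have hc' : HasCompactSupport (pderiv i g) := HasCompactSupport.of_support_subset_isCompact hc
        ((subset_tsupport _).trans (tsupport_pderiv_subset i g))
  refine integral_mul_fderiv_eq_neg_fderiv_mul_of_integrable ?_ ?_ ?_
    (fun x _ => (hf.differentiable (by simp)) x) (fun x _ => (hg.differentiable (by simp)) x)
  · exact ((contDiff_pderiv hf i).continuous.mul hg.continuous).integrable_of_hasCompactSupport
      hc.mul_left
  · exact (hf.continuous.mul (contDiff_pderiv hg i).continuous).integrable_of_hasCompactSupport
      hc'.mul_left
  · exact (hf.continuous.mul hg.continuous).integrable_of_hasCompactSupport hc.mul_left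

/-- The operator `k - ∑ A_ij ∂_i ∂_j`. -/
def ellOp {d : ℕ} (A : Matrix (Fin d) (Fin d) ℝ) (k : ℝ) (η : Pt d → ℂ) (x : Pt d) : ℂ :=
  k * η x - ∑ i, ∑ j, (A i j : ℂ) * pderiv i (pderiv j η) x

theorem contDiff_ellOp {d : ℕ} (A : Matrix (Fin d) (Fin d) ℝ) (k : ℝ) {η : Pt d → ℂ}
    (h : ContDiff ℝ ∞ η) : ContDiff ℝ ∞ (ellOp A k η) := by
  refine (contDiff_const.mul h).sub (ContDiff.sum fun i _ => ContDiff.sum fun j _ =>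
    contDiff_const.mul (contDiff_pderiv (contDiff_pderiv h j) i))

/-! ### A Sobolev estimate in dimension at most three -/

section fourier
open SchwartzMap LineDeriv FourierTransform

theorem fourier_lineDeriv_apply {d : ℕ} (f : 𝓢(Pt d, ℂ)) (m ξ : Pt d) :
    𝓕 (∂_{m} f) ξ = (2 * Real.pi * Complex.I) * (inner ℝ ξ m : ℝ) * 𝓕 f ξ := by
  rw [fourier_lineDerivOp_eq]
  have : (inner ℝ · m : Pt d → ℝ).HasTemperateGrowth := by fun_prop
  simp [smulLeftCLM_apply_apply this, mul_assoc]

/-- On the Fourier side `ellOp A k` is multiplication by $k+(2\pi)^2\,\xi\cdot A\xi\ge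
c(1+|\xi|^2)$. Fourier inversion, Cauchy–Schwarz and Plancherel then bound the supremum by
$\|(1+|\xi|^2)^{-1}\|_{L^2}$ times the $L^2$ norm of the image; the first factor is finite exactly
for $d<4$. -/
theorem exists_norm_le_ellOp {d : ℕ} (hd : d ≤ 3) (A : Matrix (Fin d) (Fin d) ℝ) {k a : ℝ}
    (hk : 0 < k) (ha : 0 < a) (hA : ∀ ξ : Pt d, a * ‖ξ‖ ^ 2 ≤ ∑ i, ∑ j, A i j * ξ i * ξ j) :
    ∃ C : ℝ, 0 ≤ C ∧ ∀ U : Pt d → ℂ, ContDiff ℝ ∞ U → HasCompactSupport U → ∀ x,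
      ‖U x‖ ^ 2 ≤ C * ∫ y, ‖ellOp A k U y‖ ^ 2 := by
  obtain ⟨c, hc, hcs⟩ : ∃ c : ℝ, 0 < c ∧ ∀ ξ : Pt d,
      c * (1 + ‖ξ‖ ^ 2) ≤ k + (2 * Real.pi) ^ 2 * ∑ i, ∑ j, A i j * ξ i * ξ j := by
    -- The factor $(2\pi)^2\ge1$ is discarded, so the smaller of the two ellipticity constants
    -- suffices.
    refine ⟨min k a, lt_min hk ha, fun ξ => ?_⟩
    have h1 : (1 : ℝ) ≤ (2 * Real.pi) ^ 2 := by nlinarith [Real.pi_gt_three]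
    have h2 := hA ξ
    have h3 : 0 ≤ a * ‖ξ‖ ^ 2 := by positivity
    have h4 : min k a * ‖ξ‖ ^ 2 ≤ a * ‖ξ‖ ^ 2 :=
      mul_le_mul_of_nonneg_right (min_le_right _ _) (by positivity)
    nlinarith [min_le_left k a]
  set q : Pt d → ℝ := fun ξ => (1 + ‖ξ‖ ^ 2)⁻¹ with hq
  have hq2 : Integrable (fun ξ : Pt d => q ξ ^ 2) := by
    -- Exponent `r = 4` in $(1+|\xi|^2)^{-r/2}$; integrability requires $r>d$.
    have := integrable_rpow_neg_one_add_norm_sq (E := Pt d) (μ := volume) (r := 4)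
      (by simp; exact_mod_cast Nat.lt_succ_of_le hd)
    refine this.congr (Eventually.of_forall fun ξ => ?_)
    have h0 : (0 : ℝ) ≤ 1 + ‖ξ‖ ^ 2 := by positivity
    simp only [hq]
    rw [show (-4 / 2 : ℝ) = -(2 : ℕ) by norm_num, Real.rpow_neg h0, Real.rpow_natCast, inv_pow]
  have hqm : Continuous q := by
    refine Continuous.inv₀ (by fun_prop) fun ξ => by positivity
  have hq0 : ∀ ξ, 0 ≤ q ξ := fun ξ => by positivity
  refine ⟨(c⁻¹) ^ 2 * ∫ ξ, q ξ ^ 2, mul_nonneg (by positivity)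
    (integral_nonneg fun ξ => by positivity), fun U hU hUc x => ?_⟩
  let f : 𝓢(Pt d, ℂ) := hUc.toSchwartzMap hU
  let e : Fin d → Pt d := fun i => EuclideanSpace.single i 1
  let g : 𝓢(Pt d, ℂ) := (k : ℂ) • f - ∑ i, ∑ j, (A i j : ℂ) • ∂_{e i} (∂_{e j} f)
  have hg : ∀ y, g y = ellOp A k U y := by
    intro y
    simp only [g, _root_.sub_apply, _root_.sum_apply, _root_.smul_apply, smul_eq_mul]
    rfl
  have hFg : ∀ ξ, 𝓕 g ξ =
      ((k + (2 * Real.pi) ^ 2 * ∑ i, ∑ j, A i j * ξ i * ξ j : ℝ) : ℂ) * 𝓕 f ξ := by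
    intro ξ
    have h1 : 𝓕 g = (k : ℂ) • 𝓕 f - ∑ i, ∑ j, (A i j : ℂ) • 𝓕 (∂_{e i} (∂_{e j} f)) := by
      simp only [g, ← fourierCLM_apply (R := ℂ), map_sub, map_smul, map_sum]
    have h2 : ∀ i j, 𝓕 (∂_{e i} (∂_{e j} f)) ξ =
        -((2 * Real.pi) ^ 2 * ξ i * ξ j : ℝ) * 𝓕 f ξ := by
      intro i j
      rw [fourier_lineDeriv_apply, fourier_lineDeriv_apply]
      simp only [e, EuclideanSpace.inner_single_right]
      simp only [one_mul, conj_trivial]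
      push_cast
      linear_combination (2 * Real.pi) ^ 2 * (ξ i : ℂ) * ξ j * 𝓕 f ξ * Complex.I_sq
    rw [h1]
    simp only [_root_.sub_apply, _root_.sum_apply, _root_.smul_apply, smul_eq_mul, h2]
    push_cast
    rw [add_mul, sub_eq_add_neg, ← Finset.sum_neg_distrib, Finset.mul_sum, Finset.sum_mul]
    congr 1
    refine Finset.sum_congr rfl fun i _ => ?_
    rw [← Finset.sum_neg_distrib, Finset.mul_sum, Finset.sum_mul]
    refine Finset.sum_congr rfl fun j _ => ?_
    ring
  have hbd : ∀ ξ, ‖𝓕 f ξ‖ ≤ c⁻¹ * (q ξ * ‖𝓕 g ξ‖) := by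
    intro ξ
    have hp : 0 < c * (1 + ‖ξ‖ ^ 2) := by positivity
    rw [hFg, norm_mul, Complex.norm_real, Real.norm_of_nonneg (hp.le.trans (hcs ξ))]
    have h2 := mul_le_mul_of_nonneg_right (hcs ξ) (norm_nonneg (𝓕 f ξ))
    rw [hq, ← mul_assoc, ← mul_inv, inv_mul_eq_div, le_div_iff₀ hp]
    linarith
  have hx : ‖U x‖ ≤ c⁻¹ * ∫ ξ, q ξ * ‖𝓕 g ξ‖ := by
    have h1 : U x = 𝓕⁻ (𝓕 f) x := by
      rw [fourierInv_fourier_eq]; rfl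
    have hI : Integrable (fun ξ => q ξ * ‖𝓕 g ξ‖) := by
      refine ((𝓕 g).integrable.norm).mono' (hqm.mul (𝓕 g).continuous.norm).aestronglyMeasurable
        (Eventually.of_forall fun ξ => ?_)
      rw [Real.norm_of_nonneg (mul_nonneg (hq0 ξ) (norm_nonneg _))]
      refine mul_le_of_le_one_left (norm_nonneg _) (inv_le_one_of_one_le₀ ?_)
      nlinarith [sq_nonneg ‖ξ‖]
    rw [h1, fourierInv_coe, Real.fourierInv_eq]
    refine (norm_integral_le_integral_norm _).trans ?_
    rw [← integral_const_mul]
    refine integral_mono_of_nonneg (Eventually.of_forall fun ξ => norm_nonneg _)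
      (hI.const_mul _) (Eventually.of_forall fun ξ => ?_)
    simpa using hbd ξ
  have hH : ∫ ξ, q ξ * ‖𝓕 g ξ‖ ≤
      (∫ ξ, q ξ ^ (2 : ℝ)) ^ (1 / (2 : ℝ)) * (∫ ξ, ‖𝓕 g ξ‖ ^ (2 : ℝ)) ^ (1 / (2 : ℝ)) := by
    refine integral_mul_le_Lp_mul_Lq_of_nonneg Real.HolderConjugate.two_two
      (Eventually.of_forall hq0) (Eventually.of_forall fun ξ => norm_nonneg _) ?_ ?_
    · simp only [ENNReal.ofReal_ofNat]
      exact (memLp_two_iff_integrable_sq hqm.aestronglyMeasurable).2 hq2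
    · simp only [ENNReal.ofReal_ofNat]
      exact ((𝓕 g).memLp 2).norm
  simp only [Real.rpow_ofNat, ← Real.sqrt_eq_rpow] at hH
  rw [integral_norm_sq_fourier] at hH
  simp only [hg] at hH
  have h0 : 0 ≤ ∫ ξ, q ξ ^ 2 := integral_nonneg fun ξ => by positivity
  have h1 : 0 ≤ ∫ y, ‖ellOp A k U y‖ ^ 2 := integral_nonneg fun ξ => by positivity
  calc ‖U x‖ ^ 2 ≤ (c⁻¹ * (√(∫ ξ, q ξ ^ 2) * √(∫ y, ‖ellOp A k U y‖ ^ 2))) ^ 2 := by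
        gcongr
        exact hx.trans (mul_le_mul_of_nonneg_left hH (by positivity))
    _ = _ := by
        rw [mul_pow, mul_pow, Real.sq_sqrt h0, Real.sq_sqrt h1]
        ring

end fourier

theorem pderiv_sum_const_mul {d : ℕ} {ι : Type*} [Fintype ι] (c : ι → ℂ) {f : ι → Pt d → ℂ}
    (hf : ∀ j, ContDiff ℝ ∞ (f j)) (i : Fin d) (x : Pt d) :
    pderiv i (fun y => ∑ j, c j * f j y) x = ∑ j, c j * pderiv i (f j) x := by
  have hd : ∀ j, DifferentiableAt ℝ (f j) x := fun j => (hf j).differentiable (by simp) x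
  have h := HasFDerivAt.fun_sum (u := Finset.univ) fun j _ => ((hd j).hasFDerivAt.const_mul (c j))
  rw [pderiv, h.fderiv]
  simp [pderiv]

/-! ### Interior estimates for smooth functions -/

theorem norm_pderiv_le_norm_grad {d : ℕ} (η : Pt d → ℂ) (i : Fin d) (x : Pt d) :
    ‖pderiv i η x‖ ≤ ‖grad η x‖ :=
  PiLp.norm_apply_le (grad η x) i

theorem continuous_grad {d : ℕ} {η : Pt d → ℂ} (h : ContDiff ℝ ∞ η) : Continuous (grad η) :=
  (PiLp.continuous_toLp 2 _).comp (continuous_pi fun i => continuous_pderiv h i)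

/-- A bound for the entries of a matrix. -/
theorem exists_norm_matVec_le {d : ℕ} (A : Matrix (Fin d) (Fin d) ℝ) :
    ∃ K : ℝ, 0 ≤ K ∧ ∀ ξ : CVec d, ‖matVec A ξ‖ ≤ K * ‖ξ‖ := by
  have h0 : ∀ i j, |A i j| ≤ ∑ i, ∑ j, |A i j| := fun i j =>
    (Finset.single_le_sum (f := fun j => |A i j|) (fun _ _ => abs_nonneg _)
      (Finset.mem_univ j)).trans (Finset.single_le_sum (f := fun i => ∑ j, |A i j|)
        (fun _ _ => Finset.sum_nonneg fun _ _ => abs_nonneg _) (Finset.mem_univ i))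
  have h1 : 0 ≤ ∑ i, ∑ j, |A i j| :=
    Finset.sum_nonneg fun _ _ => Finset.sum_nonneg fun _ _ => abs_nonneg _
  exact ⟨_, by positivity, fun ξ => norm_matVec_le h1 h0 ξ⟩

theorem norm_dotConj_le {d : ℕ} (ξ η : CVec d) : ‖dotConj ξ η‖ ≤ ‖ξ‖ * ‖η‖ := by
  rw [dotConj_eq_inner, mul_comm]
  exact norm_inner_le_norm _ _

/-- A smooth cutoff function with values in `[0, 1]`, equal to `1` near the smaller ball. -/
theorem exists_cutoff {d : ℕ} (z : Pt d) {r R : ℝ} (hr : 0 < r) (hrR : r < R) :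
    ∃ χ : Pt d → ℂ, ContDiff ℝ ∞ χ ∧ tsupport χ ⊆ Metric.closedBall z R ∧
      (∀ x ∈ Metric.closedBall z r, χ x = 1) ∧ (∀ x, ‖χ x‖ ≤ 1) ∧ ∀ x, conj (χ x) = χ x := by
  let b : ContDiffBump z := ⟨r, R, hr, hrR⟩
  refine ⟨fun x => (b x : ℂ), Complex.ofRealCLM.contDiff.comp b.contDiff, ?_, fun x hx => ?_,
    fun x => ?_, fun x => Complex.conj_ofReal _⟩
  · rw [← b.tsupport_eq]
    refine closure_mono fun x hx => ?_
    simpa using hx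
  · simp [b.one_of_mem_closedBall hx]
  · rw [Complex.norm_real, Real.norm_of_nonneg b.nonneg]
    exact b.le_one

theorem hasCompactSupport_of_tsupport_subset_closedBall {d : ℕ} {χ : Pt d → ℂ} {z : Pt d} {R : ℝ}
    (h : tsupport χ ⊆ Metric.closedBall z R) : HasCompactSupport χ :=
  HasCompactSupport.of_support_subset_isCompact (isCompact_closedBall z R)
    ((subset_tsupport _).trans h)

/-- Scalar form of the absorption argument: `s` stands for $|\zeta|$, `P` for $|\nabla V|$, `Q` for
$|\nabla\zeta|$, `v` for $|V|$ and `h` for the modulus of `ellOp A k V`. The terms `t1`, `t2`, `t3`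
are the energy density, the cross term produced by the cutoff, and the term containing the equation.
-/
theorem caccioppoli_pointwise {a K L s k : ℝ} {P v h Q : ℝ} {t1 t2 t3 : ℂ} (ha : 0 < a)
    (hk : 0 ≤ k) (hs1 : s ≤ 1) (hs0 : 0 ≤ s) (hP : 0 ≤ P) (hv : 0 ≤ v) (hh : 0 ≤ h) (hK : 0 ≤ K)
    (hQ : Q ≤ L)
    (h1 : a * P ^ 2 ≤ t1.re) (h2 : ‖t2‖ ≤ v * (K * P * Q)) (h3 : k * v ^ 2 - v * h ≤ t3.re) :
    a / 2 * (s ^ 2 * P ^ 2) ≤ ((s : ℂ) ^ 2 * t1 + 2 * s * t2 + (s : ℂ) ^ 2 * t3).re +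
      (2 * K ^ 2 * L ^ 2 / a + 1) * (v ^ 2 + h ^ 2) := by
  have e1 : ((s : ℂ) ^ 2 * t1 + 2 * s * t2 + (s : ℂ) ^ 2 * t3).re =
      s ^ 2 * t1.re + 2 * s * t2.re + s ^ 2 * t3.re := by
    simp [← Complex.ofReal_pow, Complex.add_re, Complex.mul_re]
  have e2 : -(v * (K * P * L)) ≤ t2.re := by
    have := (abs_le.1 (Complex.abs_re_le_norm t2)).1
    have h4 : v * (K * P * Q) ≤ v * (K * P * L) := by gcongr
    linarith
  -- Young's inequality, weighted so that the cross term uses up only half of the ellipticity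
  -- constant.
  have e3 : 2 * s * (v * (K * P * L)) ≤ a / 2 * (s ^ 2 * P ^ 2) + 2 * K ^ 2 * L ^ 2 / a * v ^ 2 := by
    have : a / 2 * (s ^ 2 * P ^ 2) + 2 * K ^ 2 * L ^ 2 / a * v ^ 2 - 2 * s * (v * (K * P * L)) =
        (a * s * P - 2 * K * L * v) ^ 2 / (2 * a) := by
      field_simp
      ring
    have h5 : 0 ≤ (a * s * P - 2 * K * L * v) ^ 2 / (2 * a) := by positivity
    linarith
  have e4 : -(v ^ 2 + h ^ 2) ≤ s ^ 2 * t3.re := by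
    have h6 : s ^ 2 * (k * v ^ 2 - v * h) ≤ s ^ 2 * t3.re := by gcongr
    have h7 : s ^ 2 * (v * h) ≤ v * h := mul_le_of_le_one_left (by positivity) (by nlinarith)
    have h8 : 0 ≤ s ^ 2 * (k * v ^ 2) := by positivity
    nlinarith [sq_nonneg (v - h), sq_nonneg (v + h)]
  have e5 : s ^ 2 * (a * P ^ 2) ≤ s ^ 2 * t1.re := by gcongr
  have e6 : 2 * s * -(v * (K * P * L)) ≤ 2 * s * t2.re := by gcongr
  have e7 : 0 ≤ 2 * K ^ 2 * L ^ 2 / a * h ^ 2 := by positivity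
  rw [e1]
  nlinarith

/-- The field $\zeta^2\,\overline V A\nabla V$ is smooth with compact support, so its divergence has
integral zero. Expanding the divergence bounds the weighted energy of `V` by the $L^2$ norms of `V`
and `ellOp A k V` after absorption of the cross term. -/
theorem caccioppoli {d : ℕ} (A : Matrix (Fin d) (Fin d) ℝ) {k a : ℝ} (hk : 0 ≤ k) (ha : 0 < a)
    (hA : ∀ ξ : CVec d, a * ‖ξ‖ ^ 2 ≤ (dotConj (matVec A ξ) ξ).re) {ζ : Pt d → ℂ} {z : Pt d}
    {R : ℝ} (hζ : ContDiff ℝ ∞ ζ) (hζs : tsupport ζ ⊆ Metric.closedBall z R)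
    (hζ1 : ∀ x, ‖ζ x‖ ≤ 1) (hζr : ∀ x, conj (ζ x) = ζ x) :
    ∃ C : ℝ, 0 ≤ C ∧ ∀ V : Pt d → ℂ, ContDiff ℝ ∞ V →
      ∫ x, ‖ζ x‖ ^ 2 * ‖grad V x‖ ^ 2 ≤
        C * ∫ x in Metric.closedBall z R, (‖V x‖ ^ 2 + ‖ellOp A k V x‖ ^ 2) := by
  obtain ⟨K, hK0, hK⟩ := exists_norm_matVec_le A
  have hζc := hasCompactSupport_of_tsupport_subset_closedBall hζs
  have hgc : HasCompactSupport (grad ζ) := by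
    refine HasCompactSupport.of_support_subset_isCompact hζc fun x hx => ?_
    by_contra h
    refine hx (PiLp.ext fun i => ?_)
    exact image_eq_zero_of_notMem_tsupport (f := pderiv i ζ)
      fun h' => h (tsupport_pderiv_subset i ζ h')
  obtain ⟨L, hL⟩ := hgc.exists_bound_of_continuous (continuous_grad hζ)
  set C0 := 2 * K ^ 2 * L ^ 2 / a + 1 with hC0
  have hC00 : 0 ≤ C0 := by positivity
  refine ⟨2 / a * C0, by positivity, fun V hV => ?_⟩
  have hVc : ContDiff ℝ ∞ fun x => conj (V x) := Complex.conjCLE.contDiff.comp hV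
  -- the field whose divergence is integrated
  let F : Fin d → Pt d → ℂ := fun i x =>
    ζ x * ζ x * (conj (V x) * ∑ j, (A i j : ℂ) * pderiv j V x)
  have hG : ∀ i, ContDiff ℝ ∞ fun x => ∑ j, (A i j : ℂ) * pderiv j V x := fun i =>
    ContDiff.sum fun j _ => contDiff_const.mul (contDiff_pderiv hV j)
  have hF : ∀ i, ContDiff ℝ ∞ (F i) := fun i => (hζ.mul hζ).mul (hVc.mul (hG i))
  have hFc : ∀ i, HasCompactSupport (F i) := fun i => (hζc.mul_left (f := ζ)).mul_right
  have hpG : ∀ i x, pderiv i (fun x => ∑ j, (A i j : ℂ) * pderiv j V x) x =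
      ∑ j, (A i j : ℂ) * pderiv i (pderiv j V) x := fun i x =>
    pderiv_sum_const_mul _ (fun j => contDiff_pderiv hV j) i x
  have hdiv : ∀ x, ∑ i, pderiv i (F i) x =
      ζ x ^ 2 * dotConj (matVec A (grad V x)) (grad V x) +
      2 * ζ x * (conj (V x) * dotConj (matVec A (grad V x)) (grad ζ x)) +
      ζ x ^ 2 * (conj (V x) * (k * V x - ellOp A k V x)) := by
    intro x
    have h1 : ∀ i, pderiv i (F i) x =
        ζ x ^ 2 * ((∑ j, (A i j : ℂ) * pderiv j V x) * conj (pderiv i V x)) +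
        2 * ζ x * (conj (V x) * ((∑ j, (A i j : ℂ) * pderiv j V x) * conj (pderiv i ζ x))) +
        ζ x ^ 2 * (conj (V x) * ∑ j, (A i j : ℂ) * pderiv i (pderiv j V) x) := by
      intro i
      have hr : conj (pderiv i ζ x) = pderiv i ζ x := by
        rw [← pderiv_conj hζ]
        simp only [hζr]
      rw [pderiv_mul (hζ.mul hζ) (hVc.mul (hG i)), pderiv_mul hζ hζ, pderiv_mul hVc (hG i),
        hpG, pderiv_conj hV, hr]
      ring
    simp only [h1, Finset.sum_add_distrib, ← Finset.mul_sum]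
    simp only [dotConj, matVec, grad, ellOp, sub_sub_cancel]
  have hpt : ∀ x, a / 2 * (‖ζ x‖ ^ 2 * ‖grad V x‖ ^ 2) ≤ (∑ i, pderiv i (F i) x).re +
      (Metric.closedBall z R).indicator
        (fun x => C0 * (‖V x‖ ^ 2 + ‖ellOp A k V x‖ ^ 2)) x := by
    intro x
    by_cases hx : x ∈ Metric.closedBall z R
    · rw [Set.indicator_of_mem hx, hdiv]
      obtain ⟨s, hs⟩ := Complex.conj_eq_iff_real.1 (hζr x)
      have hs2 : ζ x ^ 2 = ((|s| : ℝ) : ℂ) ^ 2 := by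
        rw [hs, ← Complex.ofReal_pow, ← Complex.ofReal_pow, sq_abs]
      have hns : ‖ζ x‖ = |s| := by rw [hs, Complex.norm_real, Real.norm_eq_abs]
      -- The scalar lemma needs a nonnegative weight; the sign of the real number `ζ x` goes into
      -- the cross term, where only the modulus matters.
      obtain ⟨σ, hσ, hσ1⟩ : ∃ σ : ℂ, ζ x = |s| * σ ∧ ‖σ‖ = 1 := by
        rcases le_total 0 s with h | h
        · exact ⟨1, by rw [hs, abs_of_nonneg h, mul_one], by simp⟩
        · exact ⟨-1, by rw [hs, abs_of_nonpos h]; simp, by simp⟩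
      have e : 2 * ζ x * (conj (V x) * dotConj (matVec A (grad V x)) (grad ζ x)) =
        2 * ((|s| : ℝ) : ℂ) * (σ * (conj (V x) * dotConj (matVec A (grad V x)) (grad ζ x))) := by
        rw [hσ]; ring
      rw [hs2, e, hns]
      refine caccioppoli_pointwise (k := k) (Q := ‖grad ζ x‖) ha hk (hns ▸ hζ1 x) (abs_nonneg _)
        (norm_nonneg _) (norm_nonneg _) (norm_nonneg _) hK0 (hL x)
        (hA _) ?_ ?_
      · rw [norm_mul, norm_mul, hσ1, one_mul, RCLike.norm_conj]
        gcongr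
        exact (norm_dotConj_le _ _).trans (by gcongr; exact hK _)
      · rw [mul_sub, Complex.sub_re]
        have h1 : (conj (V x) * (k * V x)).re = k * ‖V x‖ ^ 2 := by
          rw [mul_left_comm, Complex.conj_mul', ← Complex.ofReal_pow, ← Complex.ofReal_mul,
            Complex.ofReal_re]
        have h2 : (conj (V x) * ellOp A k V x).re ≤ ‖V x‖ * ‖ellOp A k V x‖ := by
          refine (Complex.re_le_norm _).trans ?_
          rw [norm_mul, RCLike.norm_conj]
        linarith
    · have h0 : ζ x = 0 := image_eq_zero_of_notMem_tsupport fun h => hx (hζs h)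
      rw [Set.indicator_of_notMem hx, hdiv, h0]
      simp
  have hint : Integrable fun x => ∑ i, pderiv i (F i) x :=
    integrable_finsetSum _ fun i _ => (contDiff_pderiv (hF i) i).continuous.integrable_of_hasCompactSupport
      (HasCompactSupport.of_support_subset_isCompact (hFc i)
        ((subset_tsupport _).trans (tsupport_pderiv_subset i _)))
  have hzero : ∫ x, (∑ i, pderiv i (F i) x).re = 0 := by
    have h1 := Complex.reCLM.integral_comp_comm hint
    simp only [Complex.reCLM_apply] at h1
    rw [h1, integral_finsetSum]
    · simp [integral_pderiv_eq_zero (hF _) (hFc _)]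
    · exact fun i _ => (contDiff_pderiv (hF i) i).continuous.integrable_of_hasCompactSupport
        (HasCompactSupport.of_support_subset_isCompact (hFc i)
          ((subset_tsupport _).trans (tsupport_pderiv_subset i _)))
  have hVi : IntegrableOn (fun x => C0 * (‖V x‖ ^ 2 + ‖ellOp A k V x‖ ^ 2))
      (Metric.closedBall z R) := by
    have h1 := hV.continuous
    have h2 := (contDiff_ellOp A k hV).continuous
    exact (by fun_prop : Continuous _).continuousOn.integrableOn_compact (isCompact_closedBall z R)
  have hmain : ∫ x, a / 2 * (‖ζ x‖ ^ 2 * ‖grad V x‖ ^ 2) ≤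
      C0 * ∫ x in Metric.closedBall z R, (‖V x‖ ^ 2 + ‖ellOp A k V x‖ ^ 2) := by
    have h1 : ∫ x, ((∑ i, pderiv i (F i) x).re + (Metric.closedBall z R).indicator
        (fun x => C0 * (‖V x‖ ^ 2 + ‖ellOp A k V x‖ ^ 2)) x) =
        C0 * ∫ x in Metric.closedBall z R, (‖V x‖ ^ 2 + ‖ellOp A k V x‖ ^ 2) := by
      have hre : Integrable fun x => (∑ i, pderiv i (F i) x).re := hint.re
      rw [integral_add hre (hVi.integrable_indicator Metric.isClosed_closedBall.measurableSet),
        hzero, zero_add, integral_indicator Metric.isClosed_closedBall.measurableSet,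
        integral_const_mul]
    rw [← h1]
    refine integral_mono_of_nonneg (Eventually.of_forall fun x => by positivity)
      (hint.re.add (hVi.integrable_indicator Metric.isClosed_closedBall.measurableSet))
      (Eventually.of_forall hpt)
  rw [integral_const_mul] at hmain
  rw [div_mul_eq_mul_div, div_mul_eq_mul_div, le_div_iff₀ ha]
  linarith

/-- The commutator with a cutoff contains only first derivatives of `V`, and only where `χ` varies.
This is why control of `∇V` by `caccioppoli` is enough to localize the Sobolev estimate. -/
theorem ellOp_mul {d : ℕ} (A : Matrix (Fin d) (Fin d) ℝ) (k : ℝ) {χ V : Pt d → ℂ}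
    (hχ : ContDiff ℝ ∞ χ) (hV : ContDiff ℝ ∞ V) (x : Pt d) :
    ellOp A k (fun y => χ y * V y) x = χ x * ellOp A k V x -
      (∑ i, ∑ j, (A i j : ℂ) * (pderiv i χ x * pderiv j V x + pderiv j χ x * pderiv i V x)) -
      (k * χ x - ellOp A k χ x) * V x := by
  have h1 : ∀ i j, pderiv i (pderiv j fun y => χ y * V y) x =
      pderiv i (pderiv j χ) x * V x + (pderiv i χ x * pderiv j V x + pderiv j χ x * pderiv i V x) +
        χ x * pderiv i (pderiv j V) x := by
    intro i j
    have h2 : (pderiv j fun y => χ y * V y) =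
        (fun y => pderiv j χ y * V y) + fun y => χ y * pderiv j V y :=
      funext fun y => pderiv_mul hχ hV j y
    have h3 : pderiv i ((fun y => pderiv j χ y * V y) + fun y => χ y * pderiv j V y) x =
        pderiv i (fun y => pderiv j χ y * V y) x + pderiv i (fun y => χ y * pderiv j V y) x := by
      have e1 := (((contDiff_pderiv hχ j).mul hV).differentiable (by simp)) x
      have e2 := ((hχ.mul (contDiff_pderiv hV j)).differentiable (by simp)) x
      simp only [pderiv] at e1 e2 ⊢
      rw [fderiv_add e1 e2]
      rfl
    rw [h2, h3, pderiv_mul (contDiff_pderiv hχ j) hV, pderiv_mul hχ (contDiff_pderiv hV j)]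
    ring
  simp only [ellOp, h1]
  simp only [mul_add, Finset.sum_add_distrib, sub_sub_cancel, Finset.sum_mul, mul_sub,
    Finset.mul_sum]
  have e1 : ∀ i j, χ x * ((A i j : ℂ) * pderiv i (pderiv j V) x) =
    (A i j : ℂ) * (χ x * pderiv i (pderiv j V) x) := fun i j => by ring
  simp only [e1, mul_assoc]
  ring

theorem hasCompactSupport_ellOp {d : ℕ} (A : Matrix (Fin d) (Fin d) ℝ) (k : ℝ) {χ : Pt d → ℂ}
    (hc : HasCompactSupport χ) : HasCompactSupport (ellOp A k χ) := by
  refine HasCompactSupport.of_support_subset_isCompact hc fun x hx => ?_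
  by_contra h
  refine hx ?_
  have h1 : χ x = 0 := image_eq_zero_of_notMem_tsupport h
  have h2 : ∀ i j, pderiv i (pderiv j χ) x = 0 := fun i j =>
    image_eq_zero_of_notMem_tsupport fun h' =>
      h (tsupport_pderiv_subset j χ (tsupport_pderiv_subset i _ h'))
  simp [ellOp, h1, h2]

/-- Interior supremum estimate for smooth functions. -/
theorem exists_norm_sq_le_on_ball {d : ℕ} (hd : d ≤ 3) (A : Matrix (Fin d) (Fin d) ℝ) {k a : ℝ}
    (hk : 0 < k) (ha : 0 < a) (hA : ∀ ξ : CVec d, a * ‖ξ‖ ^ 2 ≤ (dotConj (matVec A ξ) ξ).re)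
    (z : Pt d) {R : ℝ} (hR : 0 < R) :
    ∃ C : ℝ, 0 ≤ C ∧ ∀ V : Pt d → ℂ, ContDiff ℝ ∞ V → ∀ x ∈ Metric.closedBall z (R / 3),
      ‖V x‖ ^ 2 ≤ C * ∫ y in Metric.closedBall z R, (‖V y‖ ^ 2 + ‖ellOp A k V y‖ ^ 2) := by
  -- The Fourier symbol involves real frequencies only, so ellipticity is specialized to real
  -- vectors.
  have hA' : ∀ ξ : Pt d, a * ‖ξ‖ ^ 2 ≤ ∑ i, ∑ j, A i j * ξ i * ξ j := by
    intro ξ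
    have h := hA (WithLp.toLp 2 fun i => (ξ i : ℂ))
    have h1 : ‖(WithLp.toLp 2 fun i => (ξ i : ℂ) : CVec d)‖ ^ 2 = ‖ξ‖ ^ 2 := by
      simp [EuclideanSpace.norm_sq_eq]
    have h2 : (dotConj (matVec A (WithLp.toLp 2 fun i => (ξ i : ℂ)))
        (WithLp.toLp 2 fun i => (ξ i : ℂ))).re = ∑ i, ∑ j, A i j * ξ i * ξ j := by
      simp only [dotConj, matVec, Complex.conj_ofReal]
      rw [← Complex.ofReal_re (∑ i, ∑ j, A i j * ξ i * ξ j)]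
      push_cast
      refine congrArg _ (Finset.sum_congr rfl fun i _ => ?_)
      rw [Finset.sum_mul]
      exact Finset.sum_congr rfl fun j _ => by ring
    rwa [h1, h2] at h
  obtain ⟨C1, hC1, hS⟩ := exists_norm_le_ellOp hd A hk ha hA'
  -- Nested cutoffs: `χ` localizes the Sobolev estimate and is supported where `ζ = 1`, so the
  -- gradient of `V` in the commutator is controlled by the energy weighted with `ζ`.
  obtain ⟨χ, hχ, hχs, hχ1, hχn, -⟩ := exists_cutoff z (show 0 < R / 3 by positivity)
    (show R / 3 < R / 2 by linarith)
  obtain ⟨ζ, hζ, hζs, hζ1, hζn, hζr⟩ := exists_cutoff z (show 0 < R / 2 by positivity)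
    (show R / 2 < R by linarith)
  obtain ⟨C2, hC2, hCac⟩ := caccioppoli A hk.le ha hA hζ hζs hζn hζr
  have hχc := hasCompactSupport_of_tsupport_subset_closedBall hχs
  have hζc := hasCompactSupport_of_tsupport_subset_closedBall hζs
  obtain ⟨L, hL⟩ : ∃ L : ℝ, ∀ i x, ‖pderiv i χ x‖ ≤ L := by
    have h : ∀ i, ∃ L : ℝ, ∀ x, ‖pderiv i χ x‖ ≤ L := fun i =>
      HasCompactSupport.exists_bound_of_continuous (HasCompactSupport.of_support_subset_isCompact
        hχc ((subset_tsupport _).trans (tsupport_pderiv_subset i χ))) (continuous_pderiv hχ i)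
    choose L hL using h
    exact ⟨∑ i, L i, fun i x => (hL i x).trans (Finset.single_le_sum
      (fun j _ => (norm_nonneg _).trans (hL j x)) (Finset.mem_univ i))⟩
  obtain ⟨N, hN⟩ : ∃ N : ℝ, ∀ x, ‖k * χ x - ellOp A k χ x‖ ≤ N :=
    HasCompactSupport.exists_bound_of_continuous (f := fun x => k * χ x - ellOp A k χ x)
      ((hχc.mul_left (f := fun _ => (k : ℂ))).sub (hasCompactSupport_ellOp A k hχc))
      ((continuous_const.mul hχ.continuous).sub (contDiff_ellOp A k hχ).continuous)
  set S : ℝ := ∑ i, ∑ j, |A i j| * (2 * L) with hS'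
  -- The factor 3 comes from $(p+q+r)^2\le3(p^2+q^2+r^2)$ for the three terms of `ellOp_mul`; `S`
  -- and `N` bound the coefficients of `∇V` and `V` there, and `C2` replaces the gradient term.
  refine ⟨C1 * (3 * (1 + N ^ 2) + 3 * S ^ 2 * C2), by positivity, fun V hV x hx => ?_⟩
  have hcross : ∀ y, ‖∑ i, ∑ j, (A i j : ℂ) *
      (pderiv i χ y * pderiv j V y + pderiv j χ y * pderiv i V y)‖ ≤ S * ‖grad V y‖ := by
    intro y
    rw [hS', Finset.sum_mul]
    refine (norm_sum_le _ _).trans (Finset.sum_le_sum fun i _ => ?_)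
    rw [Finset.sum_mul]
    refine (norm_sum_le _ _).trans (Finset.sum_le_sum fun j _ => ?_)
    rw [norm_mul, Complex.norm_real, Real.norm_eq_abs, mul_assoc]
    refine mul_le_mul_of_nonneg_left ?_ (abs_nonneg _)
    refine (norm_add_le _ _).trans ?_
    rw [norm_mul, norm_mul]
    have hL0 : 0 ≤ L := (norm_nonneg _).trans (hL i y)
    have e1 : ‖pderiv i χ y‖ * ‖pderiv j V y‖ ≤ L * ‖grad V y‖ :=
      mul_le_mul (hL i y) (norm_pderiv_le_norm_grad V j y) (norm_nonneg _) hL0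
    have e2 : ‖pderiv j χ y‖ * ‖pderiv i V y‖ ≤ L * ‖grad V y‖ :=
      mul_le_mul (hL j y) (norm_pderiv_le_norm_grad V i y) (norm_nonneg _) hL0
    linarith
  have hU : ContDiff ℝ ∞ fun y => χ y * V y := hχ.mul hV
  have hUc : HasCompactSupport fun y => χ y * V y := hχc.mul_right
  have hpt : ∀ y, ‖ellOp A k (fun y => χ y * V y) y‖ ^ 2 ≤
      (Metric.closedBall z R).indicator
        (fun y => 3 * (1 + N ^ 2) * (‖V y‖ ^ 2 + ‖ellOp A k V y‖ ^ 2)) y +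
      3 * S ^ 2 * (‖ζ y‖ ^ 2 * ‖grad V y‖ ^ 2) := by
    intro y
    by_cases hy : y ∈ Metric.closedBall z (R / 2)
    · rw [Set.indicator_of_mem (Metric.closedBall_subset_closedBall (by linarith) hy), hζ1 y hy,
        ellOp_mul A k hχ hV]
      set p := ‖ellOp A k V y‖
      set q := ‖grad V y‖
      set v := ‖V y‖
      have h1 : ‖χ y * ellOp A k V y‖ ≤ p := by
        rw [norm_mul]
        exact mul_le_of_le_one_left (norm_nonneg _) (hχn y)
      have h2 : ‖(k * χ y - ellOp A k χ y) * V y‖ ≤ N * v := by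
        rw [norm_mul]
        exact mul_le_mul_of_nonneg_right (hN y) (norm_nonneg _)
      have h3 := (norm_sub_le _ _).trans (add_le_add ((norm_sub_le _ _).trans
        (add_le_add h1 (hcross y))) h2)
      refine (pow_le_pow_left₀ (norm_nonneg _) h3 2).trans ?_
      have hv : 0 ≤ v ^ 2 := sq_nonneg _
      have hp : 0 ≤ N ^ 2 * p ^ 2 := by positivity
      simp only [norm_one, one_pow, one_mul]
      nlinarith [sq_nonneg (p - S * q), sq_nonneg (p - N * v), sq_nonneg (S * q - N * v)]
    · have h0 : ellOp A k (fun y => χ y * V y) y = 0 := by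
        have hys : y ∉ tsupport fun y => χ y * V y := fun h =>
          hy (hχs (closure_mono (Function.support_mul_subset_left χ V) h))
        have h1 : χ y * V y = 0 :=
          image_eq_zero_of_notMem_tsupport (f := fun y => χ y * V y) hys
        have h2 : ∀ i j, pderiv i (pderiv j fun y => χ y * V y) y = 0 := fun i j =>
          image_eq_zero_of_notMem_tsupport fun h' =>
            hys (tsupport_pderiv_subset j _ (tsupport_pderiv_subset i _ h'))
        simp [ellOp, h1, h2]
      rw [h0, norm_zero, zero_pow two_ne_zero]
      refine add_nonneg (Set.indicator_nonneg (fun _ _ => by positivity) _) (by positivity)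
  have hVi : IntegrableOn (fun y => 3 * (1 + N ^ 2) * (‖V y‖ ^ 2 + ‖ellOp A k V y‖ ^ 2))
      (Metric.closedBall z R) := by
    have h1 := hV.continuous
    have h2 := (contDiff_ellOp A k hV).continuous
    exact (by fun_prop : Continuous _).continuousOn.integrableOn_compact (isCompact_closedBall z R)
  have hgi : Integrable fun y => 3 * S ^ 2 * (‖ζ y‖ ^ 2 * ‖grad V y‖ ^ 2) := by
    have h1 := hζ.continuous
    have h2 := continuous_grad hV
    refine (by fun_prop : Continuous _).integrable_of_hasCompactSupport ?_
    refine HasCompactSupport.of_support_subset_isCompact hζc fun y hy => ?_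
    by_contra h
    exact hy (by simp [image_eq_zero_of_notMem_tsupport h])
  have hmono : ∫ y, ‖ellOp A k (fun y => χ y * V y) y‖ ^ 2 ≤
      3 * (1 + N ^ 2) * (∫ y in Metric.closedBall z R, (‖V y‖ ^ 2 + ‖ellOp A k V y‖ ^ 2)) +
      3 * S ^ 2 * ∫ y, ‖ζ y‖ ^ 2 * ‖grad V y‖ ^ 2 := by
    refine (integral_mono_of_nonneg (Eventually.of_forall fun y => by positivity)
      ((hVi.integrable_indicator Metric.isClosed_closedBall.measurableSet).add hgi)
      (Eventually.of_forall hpt)).trans_eq ?_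
    simp only [Pi.add_apply]
    rw [integral_add (hVi.integrable_indicator Metric.isClosed_closedBall.measurableSet) hgi,
      integral_indicator Metric.isClosed_closedBall.measurableSet, integral_const_mul,
      integral_const_mul]
  have hx' : ‖V x‖ ^ 2 ≤ C1 * ∫ y, ‖ellOp A k (fun y => χ y * V y) y‖ ^ 2 := by
    have := hS _ hU hUc x
    rwa [hχ1 x hx, one_mul] at this
  have hCV := hCac V hV
  calc ‖V x‖ ^ 2 ≤ _ := hx'
    _ ≤ C1 * (3 * (1 + N ^ 2) *
          (∫ y in Metric.closedBall z R, (‖V y‖ ^ 2 + ‖ellOp A k V y‖ ^ 2)) +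
        3 * S ^ 2 * (C2 * ∫ y in Metric.closedBall z R,
          (‖V y‖ ^ 2 + ‖ellOp A k V y‖ ^ 2))) := by
        refine mul_le_mul_of_nonneg_left (hmono.trans ?_) hC1
        gcongr
    _ = _ := by ring

/-! ### Mollification and interior estimates for very weak solutions -/

/-- The convolution of `G` with the mollifier `ρ`. -/
def mollify {d : ℕ} (ρ G : Pt d → ℂ) (x : Pt d) : ℂ := ∫ t, G t * ρ (x - t)

theorem mollify_eq_convolution {d : ℕ} (ρ G : Pt d → ℂ) :
    mollify ρ G = convolution G ρ (ContinuousLinearMap.mul ℝ ℂ) volume := rfl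

theorem contDiff_mollify {d : ℕ} {ρ G : Pt d → ℂ} (hρ : ContDiff ℝ ∞ ρ)
    (hc : HasCompactSupport ρ) (hG : LocallyIntegrable G) : ContDiff ℝ ∞ (mollify ρ G) := by
  rw [mollify_eq_convolution]
  exact hc.contDiff_convolution_right _ hG hρ

theorem hasCompactSupport_pderiv {d : ℕ} {ρ : Pt d → ℂ} (hc : HasCompactSupport ρ) (i : Fin d) :
    HasCompactSupport (pderiv i ρ) :=
  HasCompactSupport.of_support_subset_isCompact hc
    ((subset_tsupport _).trans (tsupport_pderiv_subset i ρ))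

theorem pderiv_mollify {d : ℕ} {ρ G : Pt d → ℂ} (hρ : ContDiff ℝ ∞ ρ) (hc : HasCompactSupport ρ)
    (hG : LocallyIntegrable G) (i : Fin d) :
    pderiv i (mollify ρ G) = mollify (pderiv i ρ) G := by
  funext x
  have h := hc.hasFDerivAt_convolution_right (ContinuousLinearMap.mul ℝ ℂ) hG
    (hρ.of_le (by simp)) x
  rw [pderiv, mollify_eq_convolution, h.fderiv,
    convolution_precompR_apply _ hG (hc.fderiv (𝕜 := ℝ)) (hρ.continuous_fderiv (by simp))]
  rfl

theorem integrable_mollify_integrand {d : ℕ} {ρ G : Pt d → ℂ} (hρ : Continuous ρ)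
    (hc : HasCompactSupport ρ) (hG : LocallyIntegrable G) (x : Pt d) :
    Integrable fun t => G t * ρ (x - t) :=
  hc.convolutionExists_right (ContinuousLinearMap.mul ℝ ℂ) hG hρ x

/-- All derivatives fall on the mollifier, so `G` needs no regularity beyond local integrability.
The right-hand side is the very weak equation tested with a reflected translate of `ρ`. -/
theorem ellOp_mollify {d : ℕ} (A : Matrix (Fin d) (Fin d) ℝ) (k : ℝ) {ρ G : Pt d → ℂ}
    (hρ : ContDiff ℝ ∞ ρ) (hc : HasCompactSupport ρ) (hG : LocallyIntegrable G) (x : Pt d) :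
    ellOp A k (mollify ρ G) x = mollify (ellOp A k ρ) G x := by
  have h1 : ∀ i j, pderiv i (pderiv j (mollify ρ G)) x =
      mollify (pderiv i (pderiv j ρ)) G x := by
    intro i j
    rw [pderiv_mollify hρ hc hG, pderiv_mollify (contDiff_pderiv hρ j)
      (hasCompactSupport_pderiv hc j) hG]
  simp only [ellOp, h1]
  have hi : ∀ i j, Integrable fun t => G t * pderiv i (pderiv j ρ) (x - t) := fun i j =>
    integrable_mollify_integrand (contDiff_pderiv (contDiff_pderiv hρ j) i).continuous
      (hasCompactSupport_pderiv (hasCompactSupport_pderiv hc j) i) hG x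
  have h0 := integrable_mollify_integrand hρ.continuous hc hG x
  have hexp : ∀ t, G t * ((k : ℂ) * ρ (x - t) -
      ∑ i, ∑ j, (A i j : ℂ) * pderiv i (pderiv j ρ) (x - t)) =
      (k : ℂ) * (G t * ρ (x - t)) -
        ∑ i, ∑ j, (A i j : ℂ) * (G t * pderiv i (pderiv j ρ) (x - t)) := by
    intro t
    rw [mul_sub, Finset.mul_sum]
    congr 1
    · ring
    · refine Finset.sum_congr rfl fun i _ => ?_
      rw [Finset.mul_sum]
      exact Finset.sum_congr rfl fun j _ => by ring
  have hR : mollify (ellOp A k ρ) G x = ∫ t, ((k : ℂ) * (G t * ρ (x - t)) -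
      ∑ i, ∑ j, (A i j : ℂ) * (G t * pderiv i (pderiv j ρ) (x - t))) :=
    integral_congr_ae (Eventually.of_forall hexp)
  rw [hR]
  simp only [mollify]
  rw [integral_sub (h0.const_mul _) (integrable_finsetSum _ fun i _ => integrable_finsetSum _
      fun j _ => (hi i j).const_mul _), integral_const_mul,
    integral_finsetSum _ fun i _ => integrable_finsetSum _ fun j _ => (hi i j).const_mul _]
  congr 1
  refine Finset.sum_congr rfl fun i _ => ?_
  rw [integral_finsetSum _ fun j _ => (hi i j).const_mul _]
  exact Finset.sum_congr rfl fun j _ => (integral_const_mul _ _).symm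

theorem pderiv_comp_sub {d : ℕ} {ρ : Pt d → ℂ} (hρ : ContDiff ℝ ∞ ρ) (x : Pt d) (i : Fin d)
    (t : Pt d) : pderiv i (fun t => ρ (x - t)) t = - pderiv i ρ (x - t) := by
  have h := ((hρ.differentiable (by simp)) (x - t)).hasFDerivAt.comp t
    ((hasFDerivAt_id t).const_sub x)
  have h' : fderiv ℝ (fun t => ρ (x - t)) t = _ := h.fderiv
  simp [pderiv, h']

theorem ellOp_comp_sub {d : ℕ} (A : Matrix (Fin d) (Fin d) ℝ) (k : ℝ) {ρ : Pt d → ℂ}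
    (hρ : ContDiff ℝ ∞ ρ) (x t : Pt d) :
    ellOp A k (fun t => ρ (x - t)) t = ellOp A k ρ (x - t) := by
  have h1 : ∀ j, (pderiv j fun t => ρ (x - t)) = fun t => -pderiv j ρ (x - t) := fun j =>
    funext fun t => pderiv_comp_sub hρ x j t
  have h2 : ∀ i j, pderiv i (fun t => -pderiv j ρ (x - t)) t =
      pderiv i (pderiv j ρ) (x - t) := by
    intro i j
    have h3 : pderiv i (fun t => -pderiv j ρ (x - t)) t =
        -pderiv i (fun t => pderiv j ρ (x - t)) t := by
      simp only [pderiv]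
      rw [fderiv_fun_neg]
      rfl
    rw [h3, pderiv_comp_sub (contDiff_pderiv hρ j), neg_neg]
  simp only [ellOp, h1, h2]

/-- Mollification does not increase the `L²` norm. -/
theorem mollify_sq_integral_le {d : ℕ} {r : Pt d → ℝ} (hr : Continuous r) (hc : HasCompactSupport r)
    (h0 : ∀ x, 0 ≤ r x) (h1 : ∫ x, r x = 1) {G : Pt d → ℂ} (hG : MemLp G 2) :
    Integrable (fun x => ‖mollify (fun y => (r y : ℂ)) G x‖ ^ 2) ∧
      ∫ x, ‖mollify (fun y => (r y : ℂ)) G x‖ ^ 2 ≤ ∫ x, ‖G x‖ ^ 2 := by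
  have hG2 : Integrable fun x => ‖G x‖ ^ 2 := (memLp_two_iff_integrable_sq_norm hG.1).1 hG
  have hGl : LocallyIntegrable G := hG.locallyIntegrable (by norm_num)
  have hri : Integrable r := hr.integrable_of_hasCompactSupport hc
  have hconv : Integrable fun x => ∫ t, ‖G t‖ ^ 2 * r (x - t) :=
    hG2.integrable_convolution (ContinuousLinearMap.mul ℝ ℝ) hri
  have hconvI : ∫ x, ∫ t, ‖G t‖ ^ 2 * r (x - t) = ∫ x, ‖G x‖ ^ 2 := by
    have := integral_convolution (ContinuousLinearMap.mul ℝ ℝ) hG2 hri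
    rw [h1] at this
    simpa [convolution] using this
  have hcc : HasCompactSupport fun y => (r y : ℂ) := hc.comp_left (g := Complex.ofReal) rfl
  have hrc : Continuous fun y => (r y : ℂ) := Complex.continuous_ofReal.comp hr
  have hpt : ∀ x, ‖mollify (fun y => (r y : ℂ)) G x‖ ^ 2 ≤ ∫ t, ‖G t‖ ^ 2 * r (x - t) := by
    intro x
    have e0 : Integrable fun t => r (x - t) := hri.comp_sub_left x
    have e1 : ∫ t, r (x - t) = 1 := by rw [integral_sub_left_eq_self (fun t => r t), h1]
    have e2 : Integrable fun t => ‖G t‖ * r (x - t) := by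
      refine (integrable_mollify_integrand hrc hcc hGl x).norm.congr
        (Eventually.of_forall fun t => ?_)
      simp [abs_of_nonneg (h0 _)]
    have e3 : Integrable fun t => ‖G t‖ ^ 2 * r (x - t) :=
      hc.convolutionExists_right (ContinuousLinearMap.mul ℝ ℝ) hG2.locallyIntegrable hr x
    set s := ∫ t, ‖G t‖ * r (x - t) with hs
    have e4 : ‖mollify (fun y => (r y : ℂ)) G x‖ ≤ s := by
      refine (norm_integral_le_integral_norm _).trans_eq (integral_congr_ae
        (Eventually.of_forall fun t => ?_))
      simp [abs_of_nonneg (h0 _)]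
    -- Jensen's inequality for the probability density $t\mapsto r(x-t)$, obtained by integrating
    -- $(\|G(t)\|-s)^2\,r(x-t)\ge0$.
    have e5 : 2 * s * s ≤ (∫ t, ‖G t‖ ^ 2 * r (x - t)) + s ^ 2 * 1 := by
      rw [← e1, hs, ← integral_const_mul, ← integral_const_mul (s ^ 2),
        ← integral_add e3 (e0.const_mul _)]
      refine integral_mono (e2.const_mul _) (e3.add (e0.const_mul _)) fun t => ?_
      have := mul_nonneg (sq_nonneg (‖G t‖ - s)) (h0 (x - t))
      nlinarith
    have e6 := pow_le_pow_left₀ (norm_nonneg _) e4 2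
    nlinarith
  have hm : AEStronglyMeasurable (fun x => ‖mollify (fun y => (r y : ℂ)) G x‖ ^ 2) := by
    have : Continuous (mollify (fun y => (r y : ℂ)) G) :=
      hcc.continuous_convolution_right (ContinuousLinearMap.mul ℝ ℂ) hGl hrc
    exact (this.norm.pow 2).aestronglyMeasurable
  refine ⟨hconv.mono' hm (Eventually.of_forall fun x => ?_), ?_⟩
  · rw [Real.norm_of_nonneg (by positivity)]
    exact hpt x
  · rw [← hconvI]
    exact integral_mono_of_nonneg (Eventually.of_forall fun x => by positivity) hconv
      (Eventually.of_forall hpt)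

/-- Interior `L^∞` estimate for very weak solutions `G` of the equation `ellOp A k G = H`. -/
theorem exists_ae_norm_sq_le {d : ℕ} (hd : d ≤ 3) (A : Matrix (Fin d) (Fin d) ℝ) {k a : ℝ}
    (hk : 0 < k) (ha : 0 < a) (hA : ∀ ξ : CVec d, a * ‖ξ‖ ^ 2 ≤ (dotConj (matVec A ξ) ξ).re)
    (z : Pt d) {R : ℝ} (hR : 0 < R) :
    ∃ C : ℝ, 0 ≤ C ∧ ∀ G H : Pt d → ℂ, MemLp G 2 (leb (Metric.ball z R)) →
      MemLp H 2 (leb (Metric.ball z R)) →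
      (∀ η, IsTest (Metric.ball z R) η →
        ∫ x in Metric.ball z R, G x * ellOp A k η x = ∫ x in Metric.ball z R, H x * η x) →
      ∀ᵐ x, x ∈ Metric.ball z (R / 6) →
        ‖G x‖ ^ 2 ≤ C * ∫ x in Metric.ball z R, (‖G x‖ ^ 2 + ‖H x‖ ^ 2) := by
  obtain ⟨C, hC, hsup⟩ := exists_norm_sq_le_on_ball hd A hk ha hA z (R := R / 2) (by positivity)
  refine ⟨C, hC, fun G H hG hH hweak => ?_⟩
  have hBm : MeasurableSet (Metric.ball z R) := measurableSet_ball
  set G' := (Metric.ball z R).indicator G with hG'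
  set H' := (Metric.ball z R).indicator H with hH'
  have hGL : MemLp G' 2 := (memLp_indicator_iff_restrict hBm).2 hG
  have hHL : MemLp H' 2 := (memLp_indicator_iff_restrict hBm).2 hH
  have hGl : LocallyIntegrable G' := hGL.locallyIntegrable (by norm_num)
  have hHl : LocallyIntegrable H' := hHL.locallyIntegrable (by norm_num)
  -- The ratio of outer to inner radius is fixed at 2, as required for almost everywhere convergence
  -- of the mollifications of a locally integrable function.
  let φ : ℕ → ContDiffBump (0 : Pt d) := fun n =>
    ⟨1 / ((n : ℝ) + 1) / 2, 1 / ((n : ℝ) + 1), by positivity, by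
      have : (0 : ℝ) < 1 / ((n : ℝ) + 1) := by positivity
      linarith⟩
  have hφ0 : Tendsto (fun n => (φ n).rOut) atTop (𝓝 0) := tendsto_one_div_add_atTop_nhds_zero_nat
  let ρ : ℕ → Pt d → ℂ := fun n y => ((φ n).normed volume y : ℂ)
  have hρ : ∀ n, ContDiff ℝ ∞ (ρ n) := fun n =>
    Complex.ofRealCLM.contDiff.comp (φ n).contDiff_normed
  have hρc : ∀ n, HasCompactSupport (ρ n) := fun n =>
    (φ n).hasCompactSupport_normed.comp_left (g := Complex.ofReal) rfl
  have hae := ContDiffBump.ae_convolution_tendsto_right_of_locallyIntegrable (K := 2) hφ0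
    (Eventually.of_forall fun n => by simp only [φ]; linarith) hGl
  have hint : ∫ x in Metric.ball z R, (‖G x‖ ^ 2 + ‖H x‖ ^ 2) =
      (∫ x, ‖G' x‖ ^ 2) + ∫ x, ‖H' x‖ ^ 2 := by
    rw [integral_add ((memLp_two_iff_integrable_sq_norm hG.1).1 hG)
      ((memLp_two_iff_integrable_sq_norm hH.1).1 hH), ← integral_indicator hBm,
      ← integral_indicator hBm]
    congr 1 <;> refine integral_congr_ae (Eventually.of_forall fun x => ?_) <;>
      by_cases hx : x ∈ Metric.ball z R <;> simp [hx, G', H']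
  have hev : ∀ᶠ n in atTop, ∀ x ∈ Metric.ball z (R / 6), ‖mollify (ρ n) G' x‖ ^ 2 ≤
      C * ∫ x in Metric.ball z R, (‖G x‖ ^ 2 + ‖H x‖ ^ 2) := by
    filter_upwards [hφ0.eventually_lt_const (show (0 : ℝ) < R / 2 by positivity)] with n hn x hx
    have hell : ∀ y ∈ Metric.closedBall z (R / 2),
        ellOp A k (mollify (ρ n) G') y = mollify (ρ n) H' y := by
      intro y hy
      rw [ellOp_mollify A k (hρ n) (hρc n) hGl]
      -- With `y` within `R / 2` of `z` and mollification radius below `R / 2`, the translate stays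
      -- inside the ball and is admissible in the weak equation. Hence the mollified functions
      -- satisfy the equation classically on the half ball.
      have hT : IsTest (Metric.ball z R) fun t => ρ n (y - t) := by
        have hs : tsupport (fun t => ρ n (y - t)) ⊆ Metric.closedBall y (φ n).rOut := by
          refine closure_minimal (fun t ht => ?_) Metric.isClosed_closedBall
          have h1 : y - t ∈ Function.support ((φ n).normed volume) := by
            intro h
            exact ht (by simp [ρ, h])
          rw [(φ n).support_normed_eq, mem_ball_zero_iff] at h1
          rw [Metric.mem_closedBall, dist_comm, dist_eq_norm]
          exact h1.le
        refine ⟨(hρ n).comp (contDiff_const.sub contDiff_id),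
          hasCompactSupport_of_tsupport_subset_closedBall hs, hs.trans fun t ht => ?_⟩
        rw [Metric.mem_closedBall] at hy ht
        rw [Metric.mem_ball]
        linarith [dist_triangle t y z]
      have h := hweak _ hT
      simp only [ellOp_comp_sub A k (hρ n)] at h
      rw [← integral_indicator hBm, ← integral_indicator hBm] at h
      refine Eq.trans (integral_congr_ae (Eventually.of_forall fun t => ?_)) (h.trans
        (integral_congr_ae (Eventually.of_forall fun t => ?_))) <;>
      by_cases ht : t ∈ Metric.ball z R <;> simp [ht, G', H']
    -- Mollification contracts the $L^2$ norm, so the supremum bound for the smooth functions is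
    -- uniform in `n` and survives the almost everywhere limit.
    obtain ⟨hi1, hl1⟩ := mollify_sq_integral_le (φ n).continuous_normed
      (φ n).hasCompactSupport_normed (fun x => (φ n).nonneg_normed x)
      ((φ n).integral_normed (μ := volume)) hGL
    obtain ⟨hi2, hl2⟩ := mollify_sq_integral_le (φ n).continuous_normed
      (φ n).hasCompactSupport_normed (fun x => (φ n).nonneg_normed x)
      ((φ n).integral_normed (μ := volume)) hHL
    have hx' : x ∈ Metric.closedBall z (R / 2 / 3) := by
      rw [div_div]; norm_num
      exact (Metric.mem_ball.1 hx).le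
    refine (hsup _ (contDiff_mollify (hρ n) (hρc n) hGl) x hx').trans ?_
    refine mul_le_mul_of_nonneg_left ?_ hC
    rw [hint]
    calc _ = ∫ y in Metric.closedBall z (R / 2),
          (‖mollify (ρ n) G' y‖ ^ 2 + ‖mollify (ρ n) H' y‖ ^ 2) := by
          refine setIntegral_congr_fun Metric.isClosed_closedBall.measurableSet fun y hy => ?_
          simp only [hell y hy]
      _ ≤ ∫ y, (‖mollify (ρ n) G' y‖ ^ 2 + ‖mollify (ρ n) H' y‖ ^ 2) :=
          setIntegral_le_integral (hi1.add hi2) (Eventually.of_forall fun y => by positivity)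
      _ = (∫ y, ‖mollify (ρ n) G' y‖ ^ 2) + ∫ y, ‖mollify (ρ n) H' y‖ ^ 2 :=
          integral_add hi1 hi2
      _ ≤ _ := add_le_add hl1 hl2
  filter_upwards [hae] with x hx hxB
  have hGx : G' x = G x := by
    rw [hG', Set.indicator_of_mem (Metric.ball_subset_ball (by linarith) hxB)]
  have hconv : Tendsto (fun n => mollify (ρ n) G' x) atTop (𝓝 (G x)) := by
    rw [← hGx]
    refine hx.congr fun n => ?_
    rw [← convolution_flip]
    refine integral_congr_ae (Eventually.of_forall fun t => ?_)
    simp [ρ, mul_comm]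
  exact le_of_tendsto (hconv.norm.pow 2) (hev.mono fun n hn => hn x hxB)

/-! ### Interior regularity of weak solutions -/

theorem isWeakGrad_dw {d : ℕ} {D : Set (Pt d)} (f : X D) : IsWeakGrad D (X.w f) (X.dw f) :=
  (show XSub D from f).2.1

theorem IsTest.conj {d : ℕ} {D : Set (Pt d)} {η : Pt d → ℂ} (h : IsTest D η) :
    IsTest D fun x => conj (η x) := by
  have hs : tsupport (fun x => conj (η x)) ⊆ tsupport η :=
    closure_mono fun x hx h0 => hx (by simp [h0])
  exact ⟨Complex.conjCLE.contDiff.comp h.1, HasCompactSupport.of_support_subset_isCompact h.2.1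
    ((subset_tsupport _).trans hs), hs.trans h.2.2⟩

theorem IsTest.mono {d : ℕ} {D E : Set (Pt d)} {η : Pt d → ℂ} (h : IsTest D η) (hDE : D ⊆ E) :
    IsTest E η :=
  ⟨h.1, h.2.1, h.2.2.trans hDE⟩

theorem IsTest.eq_zero {d : ℕ} {D : Set (Pt d)} {η : Pt d → ℂ} (h : IsTest D η) {x : Pt d}
    (hx : x ∉ D) : η x = 0 :=
  image_eq_zero_of_notMem_tsupport fun h' => hx (h.2.2 h')

/-- The integral of a multiple of a test function does not depend on the set. -/
theorem IsTest.setIntegral_mul_eq {d : ℕ} {B D : Set (Pt d)} {η : Pt d → ℂ} (h : IsTest B η)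
    (hBD : B ⊆ D) (F : Pt d → ℂ) :
    ∫ x in D, F x * η x = ∫ x in B, F x * η x := by
  have h1 := setIntegral_eq_integral_of_forall_compl_eq_zero (μ := volume) (s := D)
    (f := fun x => F x * η x) fun x hx => by rw [(h.mono hBD).eq_zero hx, mul_zero]
  have h2 := setIntegral_eq_integral_of_forall_compl_eq_zero (μ := volume) (s := B)
    (f := fun x => F x * η x) fun x hx => by rw [h.eq_zero hx, mul_zero]
  rw [h1, h2]

theorem memLp_apply {d : ℕ} {D : Set (Pt d)} (g : Lp (CVec d) 2 (leb D)) (i : Fin d) :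
    MemLp (fun x => g x i) 2 (leb D) :=
  (Lp.memLp g).of_le_mul (c := 1)
    ((PiLp.continuous_apply 2 _ i).comp_aestronglyMeasurable (Lp.memLp g).1)
    (Eventually.of_forall fun x => by simpa using PiLp.norm_apply_le (g x) i)

theorem IsTest.integrable_mul {d : ℕ} {D : Set (Pt d)} {η F : Pt d → ℂ} (h : IsTest D η)
    (hF : MemLp F 2 (leb D)) : Integrable (fun x => F x * η x) (leb D) :=
  hF.integrable_mul h.memLp

/-- Third order weak derivatives commute. -/
theorem IsWeakGrad.integral_pderiv_pderiv {d : ℕ} {D : Set (Pt d)} {u : Lp ℂ 2 (leb D)}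
    {g : Lp (CVec d) 2 (leb D)} (h : IsWeakGrad D u g) {η : Pt d → ℂ} (hη : IsTest D η)
    (i j l : Fin d) :
    ∫ x in D, g x j * pderiv i (pderiv l η) x = ∫ x in D, g x l * pderiv i (pderiv j η) x := by
  have h1 := h _ ((hη.pderiv l).pderiv i) j
  have h2 := h _ ((hη.pderiv j).pderiv i) l
  have h3 : ∀ x, pderiv j (pderiv i (pderiv l η)) x = pderiv l (pderiv i (pderiv j η)) x := by
    intro x
    have e1 : pderiv i (pderiv l η) = pderiv l (pderiv i η) := funext (pderiv_comm hη.1 i l)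
    have e2 : pderiv i (pderiv j η) = pderiv j (pderiv i η) := funext (pderiv_comm hη.1 i j)
    rw [e1, e2, pderiv_comm (contDiff_pderiv hη.1 i)]
  simp only [h3] at h1
  rw [h1] at h2
  exact neg_injective h2

/-- Testing with a derivative differentiates the equation: the index `l` moves from the test
function to the weak gradient because both $\int g_j\,\partial_i\partial_l\eta$ and $\int
g_l\,\partial_i\partial_j\eta$ equal $-\int u$ times the same third derivative. Thus each component
of the gradient satisfies a very weak equation without any second weak derivative of `u`. -/
theorem integral_grad_eq_neg_ellOp {d : ℕ} {D : Set (Pt d)} {u : Lp ℂ 2 (leb D)}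
    {g : Lp (CVec d) 2 (leb D)} (h : IsWeakGrad D u g) (A : Matrix (Fin d) (Fin d) ℝ) (k : ℝ)
    {η : Pt d → ℂ} (hη : IsTest D η) (l : Fin d) :
    ∫ x in D, dotConj (matVec A (g x)) (grad (pderiv l fun y => conj (η y)) x) +
      k * u x * conj (pderiv l (fun y => conj (η y)) x) =
    - ∫ x in D, g x l * ellOp A k η x := by
  have hc1 : (pderiv l fun y => conj (η y)) = fun y => conj (pderiv l η y) :=
    funext (pderiv_conj hη.1 l)
  have hc2 : ∀ i x, pderiv i (fun y => conj (pderiv l η y)) x = conj (pderiv i (pderiv l η) x) :=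
    fun i x => pderiv_conj (contDiff_pderiv hη.1 l) i x
  have hgi : ∀ i j : Fin d, Integrable (fun x => g x j * pderiv i (pderiv l η) x) (leb D) :=
    fun i j => ((hη.pderiv l).pderiv i).integrable_mul (memLp_apply g j)
  have hgi' : ∀ i j : Fin d, Integrable (fun x => g x l * pderiv i (pderiv j η) x) (leb D) :=
    fun i j => ((hη.pderiv j).pderiv i).integrable_mul (memLp_apply g l)
  have hu : Integrable (fun x => u x * pderiv l η x) (leb D) :=
    (hη.pderiv l).integrable_mul (Lp.memLp u)
  have hg0 : Integrable (fun x => g x l * η x) (leb D) := hη.integrable_mul (memLp_apply g l)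
  have hL : ∀ x, dotConj (matVec A (g x)) (grad (pderiv l fun y => conj (η y)) x) +
      k * u x * conj (pderiv l (fun y => conj (η y)) x) =
      (∑ i, ∑ j, (A i j : ℂ) * (g x j * pderiv i (pderiv l η) x)) +
        k * (u x * pderiv l η x) := by
    intro x
    rw [hc1]
    simp only [dotConj, matVec, grad, hc2, Complex.conj_conj, Finset.sum_mul, mul_assoc]
  have hR : ∀ x, g x l * ellOp A k η x = k * (g x l * η x) -
      ∑ i, ∑ j, (A i j : ℂ) * (g x l * pderiv i (pderiv j η) x) := by
    intro x
    rw [ellOp, mul_sub, Finset.mul_sum]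
    congr 1
    · ring
    · refine Finset.sum_congr rfl fun i _ => ?_
      rw [Finset.mul_sum]
      exact Finset.sum_congr rfl fun j _ => by ring
  have sum1 : ∫ x in D, ∑ i, ∑ j, (A i j : ℂ) * (g x j * pderiv i (pderiv l η) x) =
      ∑ i, ∑ j, (A i j : ℂ) * ∫ x in D, g x j * pderiv i (pderiv l η) x := by
    rw [integral_finsetSum _ fun i _ => integrable_finsetSum _ fun j _ => (hgi i j).const_mul _]
    refine Finset.sum_congr rfl fun i _ => ?_
    rw [integral_finsetSum _ fun j _ => (hgi i j).const_mul _]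
    exact Finset.sum_congr rfl fun j _ => integral_const_mul _ _
  have sum2 : ∫ x in D, ∑ i, ∑ j, (A i j : ℂ) * (g x l * pderiv i (pderiv j η) x) =
      ∑ i, ∑ j, (A i j : ℂ) * ∫ x in D, g x l * pderiv i (pderiv j η) x := by
    rw [integral_finsetSum _ fun i _ => integrable_finsetSum _ fun j _ => (hgi' i j).const_mul _]
    refine Finset.sum_congr rfl fun i _ => ?_
    rw [integral_finsetSum _ fun j _ => (hgi' i j).const_mul _]
    exact Finset.sum_congr rfl fun j _ => integral_const_mul _ _
  simp only [hL, hR]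
  rw [integral_add (integrable_finsetSum _ fun i _ => integrable_finsetSum _
      fun j _ => (hgi i j).const_mul _) (hu.const_mul _),
    integral_sub (hg0.const_mul _) (integrable_finsetSum _ fun i _ => integrable_finsetSum _
      fun j _ => (hgi' i j).const_mul _), sum1, sum2, integral_const_mul, integral_const_mul,
    h η hη l]
  have hsw : ∑ i, ∑ j, (A i j : ℂ) * ∫ x in D, g x j * pderiv i (pderiv l η) x =
      ∑ i, ∑ j, (A i j : ℂ) * ∫ x in D, g x l * pderiv i (pderiv j η) x :=
    Finset.sum_congr rfl fun i _ => Finset.sum_congr rfl fun j _ => by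
      rw [h.integral_pderiv_pderiv hη]
  rw [hsw]
  ring

/-- Interior bound for the gradient of a weak solution of an elliptic equation whose right-hand
side has the weak derivatives `H l` in the ball. -/
theorem exists_ae_norm_grad_sq_le {d : ℕ} (hd : d ≤ 3) (A : Matrix (Fin d) (Fin d) ℝ) {k a : ℝ}
    (hk : 0 < k) (ha : 0 < a) (hA : ∀ ξ : CVec d, a * ‖ξ‖ ^ 2 ≤ (dotConj (matVec A ξ) ξ).re)
    {D : Set (Pt d)} {z : Pt d} {R : ℝ} (hR : 0 < R) (hzD : Metric.ball z R ⊆ D) :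
    ∃ C : ℝ, 0 ≤ C ∧ ∀ (u : Lp ℂ 2 (leb D)) (g : Lp (CVec d) 2 (leb D)) (H : Fin d → Pt d → ℂ),
      IsWeakGrad D u g → (∀ l, MemLp (H l) 2 (leb (Metric.ball z R))) →
      (∀ l η, IsTest (Metric.ball z R) η →
        ∫ x in D, dotConj (matVec A (g x)) (grad (pderiv l η) x) +
          k * u x * conj (pderiv l η x) = - ∫ x in Metric.ball z R, H l x * conj (η x)) →
      ∀ᵐ x, x ∈ Metric.ball z (R / 6) →
        ‖g x‖ ^ 2 ≤ C * (‖g‖ ^ 2 + ∑ l, ∫ x in Metric.ball z R, ‖H l x‖ ^ 2) := by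
  obtain ⟨C, hC, hreg⟩ := exists_ae_norm_sq_le hd A hk ha hA z hR
  refine ⟨C, hC, fun u g H hug hH hweak => ?_⟩
  have hmono : leb (Metric.ball z R) ≤ leb D := Measure.restrict_mono_set _ hzD
  have hgB : ∀ l, MemLp (fun x => g x l) 2 (leb (Metric.ball z R)) := fun l =>
    (memLp_apply g l).mono_measure hmono
  have hl : ∀ l, ∀ᵐ x, x ∈ Metric.ball z (R / 6) → ‖g x l‖ ^ 2 ≤
      C * ∫ x in Metric.ball z R, (‖g x l‖ ^ 2 + ‖H l x‖ ^ 2) := by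
    intro l
    refine hreg (fun x => g x l) (H l) (hgB l) (hH l) fun η hη => ?_
    have h1 := hweak l _ hη.conj
    rw [integral_grad_eq_neg_ellOp hug A k (hη.mono hzD) l] at h1
    simp only [Complex.conj_conj] at h1
    have h2 : ∫ x in D, g x l * ellOp A k η x = ∫ x in Metric.ball z R, g x l * ellOp A k η x := by
      have hz : ∀ x ∉ Metric.ball z R, ellOp A k η x = 0 := by
        intro x hx
        simp [ellOp, hη.eq_zero hx, fun i j => ((hη.pderiv j).pderiv i).eq_zero hx]
      rw [setIntegral_eq_integral_of_forall_compl_eq_zero fun x hx => by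
          rw [hz x fun h => hx (hzD h), mul_zero],
        setIntegral_eq_integral_of_forall_compl_eq_zero fun x hx => by rw [hz x hx, mul_zero]]
    rw [← h2]
    exact neg_injective h1
  have hgn : ∑ l, ∫ x in Metric.ball z R, ‖g x l‖ ^ 2 ≤ ‖g‖ ^ 2 := by
    have e1 : ∀ l, Integrable (fun x => ‖g x l‖ ^ 2) (leb D) := fun l =>
      (memLp_two_iff_integrable_sq_norm (memLp_apply g l).1).1 (memLp_apply g l)
    have e2 : ‖g‖ ^ 2 = ∑ l, ∫ x in D, ‖g x l‖ ^ 2 := by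
      rw [← integral_finsetSum _ fun l _ => e1 l]
      have := inner_self_eq_norm_sq (𝕜 := ℂ) g
      rw [← this, L2.inner_def]
      have h3 : ∀ x, inner ℂ (g x) (g x) = ((∑ l, ‖g x l‖ ^ 2 : ℝ) : ℂ) := by
        intro x
        rw [inner_self_eq_norm_sq_to_K, ← EuclideanSpace.norm_sq_eq]
        simp
      simp only [h3]
      rw [integral_complex_ofReal]
      simp
    rw [e2]
    exact Finset.sum_le_sum fun l _ => setIntegral_mono_set (e1 l)
      (Eventually.of_forall fun x => by positivity) hzD.eventuallyLE
  filter_upwards [ae_all_iff.2 hl] with x hx hxB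
  rw [EuclideanSpace.norm_sq_eq]
  refine (Finset.sum_le_sum fun l _ => hx l hxB).trans ?_
  rw [← Finset.mul_sum]
  refine mul_le_mul_of_nonneg_left ?_ hC
  have e3 : ∀ l, ∫ x in Metric.ball z R, (‖g x l‖ ^ 2 + ‖H l x‖ ^ 2) =
      (∫ x in Metric.ball z R, ‖g x l‖ ^ 2) + ∫ x in Metric.ball z R, ‖H l x‖ ^ 2 := fun l =>
    integral_add ((memLp_two_iff_integrable_sq_norm (hgB l).1).1 (hgB l))
      ((memLp_two_iff_integrable_sq_norm (hH l).1).1 (hH l))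
  simp only [e3, Finset.sum_add_distrib]
  gcongr

/-! ### Test functions as elements of `X(D)` -/

theorem IsTest.memLp_grad {d : ℕ} {D : Set (Pt d)} {η : Pt d → ℂ} (h : IsTest D η) :
    MemLp (grad η) 2 (leb D) := by
  refine ((continuous_grad h.1).memLp_of_hasCompactSupport ?_).restrict D
  refine HasCompactSupport.of_support_subset_isCompact h.2.1 fun x hx => ?_
  by_contra h'
  exact hx (PiLp.ext fun i => image_eq_zero_of_notMem_tsupport (f := TransmissionEig.pderiv i η)
    fun h'' => h' (tsupport_pderiv_subset i η h''))

theorem IsTest.isWeakGrad {d : ℕ} {D : Set (Pt d)} {η : Pt d → ℂ} (h : IsTest D η) :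
    IsWeakGrad D (h.memLp.toLp η) (h.memLp_grad.toLp (grad η)) := by
  intro θ hθ i
  have e1 : ∫ x in D, h.memLp.toLp η x * TransmissionEig.pderiv i θ x = ∫ x in D, η x * TransmissionEig.pderiv i θ x :=
    integral_congr_ae (by filter_upwards [h.memLp.coeFn_toLp] with x hx; rw [hx])
  have e2 : ∫ x in D, h.memLp_grad.toLp (grad η) x i * θ x = ∫ x in D, TransmissionEig.pderiv i η x * θ x :=
    integral_congr_ae (by filter_upwards [h.memLp_grad.coeFn_toLp] with x hx; rw [hx]; rfl)
  rw [e1, e2, setIntegral_eq_integral_of_forall_compl_eq_zero fun x hx => by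
      rw [(hθ.pderiv i).eq_zero hx, mul_zero],
    setIntegral_eq_integral_of_forall_compl_eq_zero fun x hx => by rw [hθ.eq_zero hx, mul_zero]]
  exact integral_mul_pderiv h.1 hθ.1 hθ.2.1 i

/-- The pair $(\eta,0)$ lies in $X(D)$ since its difference is a test function. Testing with it
isolates the equation for the first component, which is the only one containing the matrix field. -/
theorem IsTest.exists_X {d : ℕ} {D : Set (Pt d)} {η : Pt d → ℂ} (h : IsTest D η) :
    ∃ ψ : X D, X.w ψ =ᵐ[leb D] η ∧ X.dw ψ =ᵐ[leb D] grad η ∧ X.v ψ = 0 ∧ X.dv ψ = 0 := by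
  let p : L2Pair D := WithLp.toLp 2 (h.memLp.toLp η, h.memLp_grad.toLp (grad η))
  have hp : p ∈ H10 D := (testSubspace D).le_topologicalClosure
    (Submodule.subset_span ⟨η, h, h.memLp.coeFn_toLp, h.memLp_grad.coeFn_toLp⟩)
  refine ⟨(⟨WithLp.toLp 2 (p, 0), h.isWeakGrad, (H1 D).zero_mem, ?_⟩ : XSub D),
    h.memLp.coeFn_toLp, h.memLp_grad.coeFn_toLp, rfl, rfl⟩
  simpa using hp

/-! ### The inner product of `X(D)` and the equations satisfied by elements of `X(D)` -/

theorem X.inner_eq {d : ℕ} {D : Set (Pt d)} (ψ f : X D) :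
    inner ℂ ψ f = inner ℂ (X.w ψ) (X.w f) + inner ℂ (X.dw ψ) (X.dw f) +
      (inner ℂ (X.v ψ) (X.v f) + inner ℂ (X.dv ψ) (X.dv f)) := rfl

theorem X.norm_sq_eq {d : ℕ} {D : Set (Pt d)} (f : X D) :
    ‖f‖ ^ 2 = ‖X.w f‖ ^ 2 + ‖X.dw f‖ ^ 2 + (‖X.v f‖ ^ 2 + ‖X.dv f‖ ^ 2) := by
  have h := congrArg Complex.re (X.inner_eq f f)
  simp only [Complex.add_re] at h
  have e : ∀ {E : Type} [NormedAddCommGroup E] [InnerProductSpace ℂ E] (x : E),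
      (inner ℂ x x).re = ‖x‖ ^ 2 := fun x => inner_self_eq_norm_sq (𝕜 := ℂ) x
  simpa only [e] using h

theorem X.norm_dw_sq_le {d : ℕ} {D : Set (Pt d)} (f : X D) : ‖X.dw f‖ ^ 2 ≤ ‖f‖ ^ 2 := by
  rw [X.norm_sq_eq]
  nlinarith [sq_nonneg ‖X.w f‖, sq_nonneg ‖X.v f‖, sq_nonneg ‖X.dv f‖]

theorem coe_zero_ae {d : ℕ} {D : Set (Pt d)} {E : Type} [NormedAddCommGroup E]
    {f : Lp E 2 (leb D)} (h : f = 0) : f =ᵐ[leb D] fun _ => 0 := by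
  rw [h]
  exact Lp.coeFn_zero _ _ _

theorem formA_test {d : ℕ} {D : Set (Pt d)} (a : Pt d → Matrix (Fin d) (Fin d) ℝ) (κ : ℝ)
    (f ψ : X D) {η : Pt d → ℂ} (h1 : X.w ψ =ᵐ[leb D] η) (h2 : X.dw ψ =ᵐ[leb D] grad η)
    (h3 : X.v ψ = 0) (h4 : X.dv ψ = 0) :
    formA D a κ f ψ =
      ∫ x in D, dotConj (matVec (a x) (X.dw f x)) (grad η x) + κ * X.w f x * conj (η x) := by
  have e1 : ∫ x in D, dotConj (X.dv f x) (X.dv ψ x) + X.v f x * conj (X.v ψ x) = 0 := by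
    refine integral_eq_zero_of_ae ?_
    filter_upwards [coe_zero_ae h3, coe_zero_ae h4] with x hx3 hx4
    rw [hx3, hx4]
    simp [dotConj]
  rw [formA, e1, sub_zero]
  refine integral_congr_ae ?_
  filter_upwards [h1, h2] with x hx1 hx2
  rw [hx1, hx2]

theorem formL_test {d : ℕ} {D : Set (Pt d)} (m : ℝ) (f ψ : X D) {η : Pt d → ℂ}
    (h1 : X.w ψ =ᵐ[leb D] η) (h3 : X.v ψ = 0) :
    formL D m f ψ = m * ∫ x in D, X.w f x * conj (η x) := by
  rw [formL, ← integral_const_mul]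
  refine integral_congr_ae ?_
  filter_upwards [h1, coe_zero_ae h3] with x hx1 hx3
  rw [hx1, hx3]
  simp [mul_assoc]

theorem inner_test {d : ℕ} {D : Set (Pt d)} (f ψ : X D) {η : Pt d → ℂ}
    (h1 : X.w ψ =ᵐ[leb D] η) (h2 : X.dw ψ =ᵐ[leb D] grad η) (h3 : X.v ψ = 0) (h4 : X.dv ψ = 0) :
    inner ℂ ψ f = (∫ x in D, X.w f x * conj (η x)) + ∫ x in D, dotConj (X.dw f x) (grad η x) := by
  rw [X.inner_eq, h3, h4, inner_zero_left, inner_zero_left, add_zero, add_zero, inner_L2_eq,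
    inner_L2vec_eq]
  congr 1 <;> refine integral_congr_ae ?_
  · filter_upwards [h1] with x hx
    rw [hx]
  · filter_upwards [h2] with x hx
    rw [hx]

theorem inner_opA_const {d : ℕ} (D : Set (Pt d)) (A : Matrix (Fin d) (Fin d) ℝ) (κ : ℝ)
    (f φ : X D) :
    inner ℂ φ (opA D (fun _ => A) κ f) = formA D (fun _ => A) κ f φ := by
  have hK : ∀ i j, |A i j| ≤ ∑ i, ∑ j, |A i j| := fun i j =>
    (Finset.single_le_sum (f := fun j => |A i j|) (fun _ _ => abs_nonneg _)
      (Finset.mem_univ j)).trans (Finset.single_le_sum (f := fun i => ∑ j, |A i j|)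
        (fun _ _ => Finset.sum_nonneg fun _ _ => abs_nonneg _) (Finset.mem_univ i))
  refine inner_opA D (fun _ => A) κ (fun _ _ => measurable_const) (K := ∑ i, ∑ j, |A i j|) ?_ f φ
  intro _ i j
  exact hK i j

/-- Interior gradient bound for `f = 𝐀⁻¹ (𝐁₀ + c 𝐂) g`. -/
theorem exists_ae_norm_dw_sq_le {d : ℕ} (hd : d ≤ 3) (A : Matrix (Fin d) (Fin d) ℝ) {κ a : ℝ}
    (hκ : 0 < κ) (ha : 0 < a) (hA : ∀ ξ : CVec d, a * ‖ξ‖ ^ 2 ≤ (dotConj (matVec A ξ) ξ).re)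
    {D : Set (Pt d)} {z : Pt d} {R : ℝ} (hR : 0 < R) (hzD : Metric.ball z R ⊆ D) (n : ℝ) (c : ℂ) :
    ∃ C : ℝ, 0 ≤ C ∧ ∀ f g : X D, opA D (fun _ => A) κ f = opB D n g + c • opC D κ g →
      ∀ᵐ x, x ∈ Metric.ball z (R / 6) → ‖X.dw f x‖ ^ 2 ≤ C * (‖f‖ ^ 2 + ‖g‖ ^ 2) := by
  obtain ⟨C, hC, hreg⟩ := exists_ae_norm_grad_sq_le hd A hκ ha hA hR hzD
  -- On the first component, the form of $\mathbf B_0+c\,\mathbf C$ is multiplication by `s`; the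
  -- differentiated right-hand side is therefore $s\,\partial_l w_g$, and summing over `l` produces
  -- the factor `d`.
  set s : ℂ := n + c * κ with hs
  refine ⟨C * (1 + d * ‖s‖ ^ 2), by positivity, fun f g hfg => ?_⟩
  have hmono : leb (Metric.ball z R) ≤ leb D := Measure.restrict_mono_set _ hzD
  have hH : ∀ l, MemLp (fun x => s * X.dw g x l) 2 (leb D) := fun l =>
    (memLp_apply (X.dw g) l).const_mul s
  have h := hreg (X.w f) (X.dw f) (fun l x => s * X.dw g x l) (isWeakGrad_dw f)
    (fun l => (hH l).mono_measure hmono) fun l η hη => ?_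
  · filter_upwards [h] with x hx hxB
    refine (hx hxB).trans ?_
    rw [mul_assoc]
    refine mul_le_mul_of_nonneg_left ?_ hC
    have e1 : ∀ l : Fin d, ∫ x in Metric.ball z R, ‖s * X.dw g x l‖ ^ 2 ≤ ‖s‖ ^ 2 * ‖g‖ ^ 2 := by
      intro l
      have i1 : Integrable (fun x => ‖X.dw g x l‖ ^ 2) (leb D) :=
        (memLp_two_iff_integrable_sq_norm (memLp_apply _ l).1).1 (memLp_apply _ l)
      have i2 : Integrable (fun x => ‖X.dw g x‖ ^ 2) (leb D) :=
        (memLp_two_iff_integrable_sq_norm (Lp.memLp _).1).1 (Lp.memLp _)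
      simp only [norm_mul, mul_pow]
      rw [integral_const_mul]
      refine mul_le_mul_of_nonneg_left ?_ (by positivity)
      refine le_trans ?_ (X.norm_dw_sq_le g)
      calc _ ≤ ∫ x in D, ‖X.dw g x l‖ ^ 2 := setIntegral_mono_set i1
            (Eventually.of_forall fun x => by positivity) hzD.eventuallyLE
        _ ≤ ∫ x in D, ‖X.dw g x‖ ^ 2 := integral_mono i1 i2 fun x =>
            pow_le_pow_left₀ (norm_nonneg _) (PiLp.norm_apply_le (X.dw g x) l) 2
        _ = ‖X.dw g‖ ^ 2 := by
            rw [← inner_self_eq_norm_sq (𝕜 := ℂ) (X.dw g), L2.inner_def]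
            simp only [inner_self_eq_norm_sq_to_K]
            have : ∀ x, ((‖X.dw g x‖ : ℂ)) ^ 2 = ((‖X.dw g x‖ ^ 2 : ℝ) : ℂ) := fun x => by
              push_cast; rfl
            simp only [Complex.coe_algebraMap, this]
            rw [integral_complex_ofReal]
            simp
    have e2 := Finset.sum_le_sum fun l (_ : l ∈ Finset.univ) => e1 l
    simp only [Finset.sum_const, Finset.card_univ, Fintype.card_fin, nsmul_eq_mul] at e2
    have e3 := X.norm_dw_sq_le f
    have e4 : 0 ≤ d * ‖s‖ ^ 2 * ‖f‖ ^ 2 := by positivity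
    nlinarith [sq_nonneg ‖g‖]
  · have hηD := hη.mono hzD
    obtain ⟨ψ, h1, h2, h3, h4⟩ := (hηD.pderiv l).exists_X
    have e1 := congrArg (inner ℂ ψ) hfg
    rw [inner_opA_const, formA_test _ κ f ψ h1 h2 h3 h4, inner_add_right, inner_smul_right, opB,
      opC, inner_opL, inner_opL, formL_test n g ψ h1 h3, formL_test κ g ψ h1 h3] at e1
    have e2 : ∀ x, conj (pderiv l η x) = pderiv l (fun y => conj (η y)) x := fun x =>
      (pderiv_conj hη.1 l x).symm
    -- The derivative on the test function is moved onto `g`, which has a weak gradient in $L^2$.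
    have e3 := isWeakGrad_dw g _ hηD.conj l
    simp only [← e2] at e3
    rw [e1, e3, hη.conj.setIntegral_mul_eq hzD]
    simp only [mul_assoc]
    rw [integral_const_mul, hs]
    ring

theorem contDiff_cutoff_mul {d : ℕ} {D : Set (Pt d)} (hD : IsOpen D) {χ f : Pt d → ℂ}
    (hχ : ContDiff ℝ ∞ χ) (hs : tsupport χ ⊆ D) (hf : ContDiffOn ℝ ∞ f D) :
    ContDiff ℝ ∞ fun x => χ x * f x := by
  refine contDiff_iff_contDiffAt.2 fun x => ?_
  by_cases hx : x ∈ D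
  · exact hχ.contDiffAt.mul (hf.contDiffAt (hD.mem_nhds hx))
  · have h0 : (fun x => χ x * f x) =ᶠ[𝓝 x] fun _ => 0 := by
      filter_upwards [(isClosed_tsupport χ).isOpen_compl.mem_nhds fun h => hx (hs h)] with y hy
      rw [image_eq_zero_of_notMem_tsupport hy, zero_mul]
    exact contDiffAt_const.congr_of_eventuallyEq h0

/-- Interior gradient bound for `u = 𝐀⁻¹ φ` if the first component of `φ` is smooth. -/
theorem exists_ae_norm_dw_sq_le_of_smooth {d : ℕ} (hd : d ≤ 3) (A : Matrix (Fin d) (Fin d) ℝ)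
    {κ a : ℝ} (hκ : 0 < κ) (ha : 0 < a)
    (hA : ∀ ξ : CVec d, a * ‖ξ‖ ^ 2 ≤ (dotConj (matVec A ξ) ξ).re)
    {D : Set (Pt d)} (hD : IsOpen D) {z : Pt d} {R R' : ℝ} (hR : 0 < R) (hRR : R < R')
    (hzD : Metric.closedBall z R' ⊆ D) {u φ : X D} (hu : opA D (fun _ => A) κ u = φ)
    {f : Pt d → ℂ} (hf : ContDiffOn ℝ ∞ f D) (hwf : X.w φ =ᵐ[leb D] f) :
    ∃ C : ℝ, 0 ≤ C ∧ ∀ᵐ x, x ∈ Metric.ball z (R / 6) → ‖X.dw u x‖ ^ 2 ≤ C := by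
  have hBD : Metric.ball z R ⊆ D :=
    (Metric.ball_subset_closedBall.trans (Metric.closedBall_subset_closedBall hRR.le)).trans hzD
  obtain ⟨C, hC, hreg⟩ := exists_ae_norm_grad_sq_le hd A hκ ha hA hR hBD
  obtain ⟨χ, hχ, hχs, hχ1, -, -⟩ := exists_cutoff z hR hRR
  set F : Pt d → ℂ := fun x => χ x * f x with hF
  have hFs : ContDiff ℝ ∞ F := contDiff_cutoff_mul hD hχ (hχs.trans hzD) hf
  -- The Riesz identification uses the $H^1$ inner product, so tested with $(\eta,0)$ the element
  -- `φ` acts as $w-\Delta w$ in the weak sense. Its `l`-th derivative, computed from the smooth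
  -- function `F` that agrees with `f` on the ball, is the right-hand side.
  let H : Fin d → Pt d → ℂ := fun l x => pderiv l F x - ∑ i, pderiv l (pderiv i (pderiv i F)) x
  have hHc : ∀ l, Continuous (H l) := fun l =>
    (continuous_pderiv hFs l).sub (continuous_finsetSum _ fun i _ =>
      continuous_pderiv (contDiff_pderiv (contDiff_pderiv hFs i) i) l)
  have hHm : ∀ l, MemLp (H l) 2 (leb (Metric.ball z R)) := by
    intro l
    have hfin : IsFiniteMeasure (leb (Metric.ball z R)) :=
      ⟨by simpa using measure_ball_lt_top⟩
    obtain ⟨N, hN⟩ := (isCompact_closedBall z R).exists_bound_of_continuousOn (hHc l).continuousOn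
    refine MemLp.of_bound (hHc l).aestronglyMeasurable N ?_
    filter_upwards [ae_restrict_mem measurableSet_ball] with x hx
    exact hN x (Metric.ball_subset_closedBall hx)
  -- integrals of `w` against test functions supported in the ball
  have hwF : ∀ θ, IsTest (Metric.ball z R) θ → ∫ x in D, X.w φ x * θ x = ∫ x, F x * θ x := by
    intro θ hθ
    have e1 : ∫ x in D, X.w φ x * θ x = ∫ x in D, F x * θ x := by
      refine integral_congr_ae ?_
      filter_upwards [hwf] with x hx
      by_cases hxB : x ∈ Metric.ball z R
      · rw [hx, hF]
        simp [hχ1 x (Metric.ball_subset_closedBall hxB)]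
      · rw [hθ.eq_zero hxB, mul_zero, mul_zero]
    rw [e1, setIntegral_eq_integral_of_forall_compl_eq_zero fun x hx => by
      rw [(hθ.mono hBD).eq_zero hx, mul_zero]]
  have hint : ∀ (G : Pt d → ℂ), ContDiff ℝ ∞ G → ∀ θ, IsTest (Metric.ball z R) θ →
      Integrable fun x => G x * θ x := fun G hG θ hθ =>
    (hG.continuous.mul hθ.1.continuous).integrable_of_hasCompactSupport hθ.2.1.mul_left
  have h := hreg (X.w u) (X.dw u) H (isWeakGrad_dw u) hHm fun l η hη => ?_
  · exact ⟨_, mul_nonneg hC (add_nonneg (by positivity) (Finset.sum_nonneg fun l _ =>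
      integral_nonneg fun x => by positivity)), h⟩
  · have hηD := hη.mono hBD
    obtain ⟨ψ, h1, h2, h3, h4⟩ := (hηD.pderiv l).exists_X
    have e1 := congrArg (inner ℂ ψ) hu
    rw [inner_opA_const, formA_test _ κ u ψ h1 h2 h3 h4, inner_test φ ψ h1 h2 h3 h4] at e1
    rw [e1]
    set θ : Pt d → ℂ := fun y => conj (η y) with hθdef
    have hθ : IsTest (Metric.ball z R) θ := hη.conj
    have c1 : ∀ x, conj (pderiv l η x) = pderiv l θ x := fun x => (pderiv_conj hη.1 l x).symm
    have c2 : ∀ i x, conj (pderiv i (pderiv l η) x) = pderiv i (pderiv l θ) x := by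
      intro i x
      rw [← pderiv_conj (contDiff_pderiv hη.1 l)]
      simp only [c1]
    have e2 : ∫ x in D, dotConj (X.dw φ x) (grad (pderiv l η) x) =
        ∑ i, ∫ x in D, X.dw φ x i * pderiv i (pderiv l θ) x := by
      rw [← integral_finsetSum _ fun i _ =>
        (((hθ.mono hBD).pderiv l).pderiv i).integrable_mul (memLp_apply (X.dw φ) i)]
      simp only [dotConj, grad, c2]
    have e3 : ∀ i, ∫ x in D, X.dw φ x i * pderiv i (pderiv l θ) x =
        ∫ x, pderiv l (pderiv i (pderiv i F)) x * θ x := by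
      intro i
      have h5 := isWeakGrad_dw φ _ (((hθ.mono hBD).pderiv l).pderiv i) i
      rw [hwF _ (((hθ.pderiv l).pderiv i).pderiv i),
        integral_mul_pderiv hFs ((hθ.pderiv l).pderiv i).1 ((hθ.pderiv l).pderiv i).2.1,
        integral_mul_pderiv (contDiff_pderiv hFs i) (hθ.pderiv l).1 (hθ.pderiv l).2.1,
        integral_mul_pderiv (contDiff_pderiv (contDiff_pderiv hFs i) i) hθ.1 hθ.2.1, neg_neg] at h5
      exact (neg_injective h5).symm
    have e4 : ∫ x in Metric.ball z R, H l x * θ x = ∫ x, H l x * θ x :=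
      setIntegral_eq_integral_of_forall_compl_eq_zero fun x hx => by rw [hθ.eq_zero hx, mul_zero]
    have e5 : ∫ x, H l x * θ x = (∫ x, pderiv l F x * θ x) -
        ∑ i, ∫ x, pderiv l (pderiv i (pderiv i F)) x * θ x := by
      have i1 := fun i => hint _ (contDiff_pderiv (contDiff_pderiv (contDiff_pderiv hFs i) i) l) θ hθ
      rw [← integral_finsetSum _ fun i _ => i1 i,
        ← integral_sub (hint _ (contDiff_pderiv hFs l) θ hθ) (integrable_finsetSum _ fun i _ => i1 i)]
      simp only [H, sub_mul, Finset.sum_mul]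
    simp only [c1]
    rw [e2, e4, e5, hwF _ (hθ.pderiv l), integral_mul_pderiv hFs hθ.1 hθ.2.1]
    simp only [e3]
    ring

/-! ### Quadratic forms of symmetric matrices -/

theorem matVec_sub {d : ℕ} (M : Matrix (Fin d) (Fin d) ℝ) (ξ η : CVec d) :
    matVec M (ξ - η) = matVec M ξ - matVec M η := by
  ext i
  simp [matVec, mul_sub, Finset.sum_sub_distrib]

theorem matrix_sub_matVec {d : ℕ} (M N : Matrix (Fin d) (Fin d) ℝ) (ξ : CVec d) :
    matVec (M - N) ξ = matVec M ξ - matVec N ξ := by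
  ext i
  simp [matVec, sub_mul, Finset.sum_sub_distrib]

theorem dotConj_matVec_comm {d : ℕ} {M : Matrix (Fin d) (Fin d) ℝ} (hM : M.IsSymm)
    (ξ η : CVec d) : dotConj (matVec M ξ) η = conj (dotConj (matVec M η) ξ) := by
  simp only [dotConj, matVec, map_sum, map_mul, Complex.conj_conj, Complex.conj_ofReal,
    Finset.sum_mul]
  rw [Finset.sum_comm]
  refine Finset.sum_congr rfl fun i _ => Finset.sum_congr rfl fun j _ => ?_
  rw [hM.apply i j]
  ring

theorem dotConj_matVec_smul_self {d : ℕ} (M : Matrix (Fin d) (Fin d) ℝ) (t : ℝ) (ξ : CVec d) :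
    (dotConj (matVec M ((t : ℂ) • ξ)) ((t : ℂ) • ξ)).re =
      t ^ 2 * (dotConj (matVec M ξ) ξ).re := by
  rw [matVec_smul, dotConj_eq_inner, dotConj_eq_inner, inner_smul_left, inner_smul_right,
    Complex.conj_ofReal, ← mul_assoc, ← Complex.ofReal_mul, Complex.re_ofReal_mul, sq]

theorem abs_dotConj_matVec_le {d : ℕ} (M : Matrix (Fin d) (Fin d) ℝ) :
    ∃ K : ℝ, ∀ ξ : Metric.sphere (0 : CVec d) 1, |(dotConj (matVec M ξ) ξ).re| ≤ K := by
  obtain ⟨K, -, hK⟩ := exists_norm_matVec_le M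
  refine ⟨K, fun ξ => (Complex.abs_re_le_norm _).trans ((norm_dotConj_le _ _).trans ?_)⟩
  have h1 : ‖(ξ : CVec d)‖ = 1 := mem_sphere_zero_iff_norm.1 ξ.2
  simpa [h1] using hK ξ

theorem exists_unit_smul {d : ℕ} {ξ : CVec d} (hξ : ξ ≠ 0) :
    ∃ ζ : Metric.sphere (0 : CVec d) 1, ξ = ((‖ξ‖ : ℝ) : ℂ) • (ζ : CVec d) := by
  have h0 : (‖ξ‖ : ℂ) ≠ 0 := by simpa using hξ
  refine ⟨⟨((‖ξ‖ : ℝ) : ℂ)⁻¹ • ξ, ?_⟩, ?_⟩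
  · rw [mem_sphere_zero_iff_norm, norm_smul, norm_inv, Complex.norm_real, norm_norm,
      inv_mul_cancel₀ (norm_ne_zero_iff.2 hξ)]
  · rw [smul_smul, mul_inv_cancel₀ h0, one_smul]

theorem lowerBd_mul_le {d : ℕ} (M : Matrix (Fin d) (Fin d) ℝ) (ξ : CVec d) :
    lowerBd M * ‖ξ‖ ^ 2 ≤ (dotConj (matVec M ξ) ξ).re := by
  rcases eq_or_ne ξ 0 with rfl | hξ
  · simp [dotConj]
  obtain ⟨ζ, hζ⟩ := exists_unit_smul hξ
  obtain ⟨K, hK⟩ := abs_dotConj_matVec_le M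
  -- The infimum is a lower bound only because the values on the sphere are bounded below, which
  -- `hK` supplies.
  have hb : lowerBd M ≤ (dotConj (matVec M ζ) ζ).re :=
    ciInf_le ⟨-K, by rintro _ ⟨ξ, rfl⟩; exact (abs_le.1 (hK ξ)).1⟩ ζ
  have h : (dotConj (matVec M ξ) ξ).re = ‖ξ‖ ^ 2 * (dotConj (matVec M ζ) ζ).re := by
    conv_lhs => rw [hζ, dotConj_matVec_smul_self]
  rw [h, mul_comm]
  exact mul_le_mul_of_nonneg_left hb (by positivity)

theorem le_upperBd_mul {d : ℕ} (M : Matrix (Fin d) (Fin d) ℝ) (ξ : CVec d) :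
    (dotConj (matVec M ξ) ξ).re ≤ upperBd M * ‖ξ‖ ^ 2 := by
  rcases eq_or_ne ξ 0 with rfl | hξ
  · simp [dotConj]
  obtain ⟨ζ, hζ⟩ := exists_unit_smul hξ
  obtain ⟨K, hK⟩ := abs_dotConj_matVec_le M
  have hb : (dotConj (matVec M ζ) ζ).re ≤ upperBd M :=
    le_ciSup (f := fun ξ : Metric.sphere (0 : CVec d) 1 => (dotConj (matVec M ξ) ξ).re)
      ⟨K, by rintro _ ⟨ξ, rfl⟩; exact (abs_le.1 (hK ξ)).2⟩ ζ
  have h : (dotConj (matVec M ξ) ξ).re = ‖ξ‖ ^ 2 * (dotConj (matVec M ζ) ζ).re := by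
    conv_lhs => rw [hζ, dotConj_matVec_smul_self]
  rw [h, mul_comm (upperBd M)]
  exact mul_le_mul_of_nonneg_left hb (by positivity)

theorem lowerBd_le_upperBd {d : ℕ} (hd : 0 < d) (M : Matrix (Fin d) (Fin d) ℝ) :
    lowerBd M ≤ upperBd M := by
  have h1 := lowerBd_mul_le M (EuclideanSpace.single ⟨0, hd⟩ 1)
  have h2 := le_upperBd_mul M (EuclideanSpace.single ⟨0, hd⟩ 1)
  simp only [PiLp.norm_single, norm_one, one_pow, mul_one] at h1 h2
  exact h1.trans h2

/-! ### Symmetry and coercivity of `𝐀` -/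

/-- A bounded measurable field of symmetric matrices. -/
def IsCoeffField {d : ℕ} (a : Pt d → Matrix (Fin d) (Fin d) ℝ) : Prop :=
  (∀ i j, Measurable fun x => a x i j) ∧ (∃ K : ℝ, ∀ x i j, |a x i j| ≤ K) ∧ ∀ x, (a x).IsSymm

theorem IsCoeffField.inner_opA {d : ℕ} {a : Pt d → Matrix (Fin d) (Fin d) ℝ}
    (ha : IsCoeffField a) (D : Set (Pt d)) (κ : ℝ) (f φ : X D) :
    inner ℂ φ (opA D a κ f) = formA D a κ f φ := by
  obtain ⟨h1, ⟨K, hK⟩, -⟩ := ha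
  exact TransmissionEig.inner_opA D a κ h1 hK f φ

theorem IsCoeffField.integrable {d : ℕ} {a : Pt d → Matrix (Fin d) (Fin d) ℝ}
    (ha : IsCoeffField a) {D : Set (Pt d)} (g p : Lp (CVec d) 2 (leb D)) :
    Integrable (fun x => dotConj (matVec (a x) (g x)) (p x)) (leb D) := by
  obtain ⟨h1, ⟨K, hK⟩, -⟩ := ha
  obtain ⟨N, hN⟩ := exists_mulField D a h1 hK
  refine (integrable_L2vec (N g) p).congr ?_
  filter_upwards [hN g] with x hx
  rw [hx]

/-- The form is Hermitian, although indefinite, because the matrices are real and symmetric and `κ`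
is real. -/
theorem IsCoeffField.inner_opA_comm {d : ℕ} {a : Pt d → Matrix (Fin d) (Fin d) ℝ}
    (ha : IsCoeffField a) (D : Set (Pt d)) (κ : ℝ) (f φ : X D) :
    inner ℂ φ (opA D a κ f) = inner ℂ (opA D a κ φ) f := by
  rw [← inner_conj_symm (opA D a κ φ) f, ha.inner_opA, ha.inner_opA, formA, formA, map_sub,
    ← integral_conj, ← integral_conj]
  congr 1 <;> refine integral_congr_ae (Eventually.of_forall fun x => ?_)
  · simp only [map_add, map_mul, Complex.conj_conj, Complex.conj_ofReal]
    rw [dotConj_matVec_comm (ha.2.2 x)]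
    ring
  · simp only [map_add, map_mul, Complex.conj_conj]
    rw [dotConj_eq_inner, dotConj_eq_inner, inner_conj_symm]
    ring

/-- The lower bound gives injectivity and closed range. A vector `y` orthogonal to the range
satisfies $\|Ty\|^2=\langle y,T(Ty)\rangle=0$ by symmetry, hence vanishes, so the range is
everything. No sign of the form is needed. -/
theorem isInvertible_of_symmetric_of_bound {E : Type*} [NormedAddCommGroup E]
    [InnerProductSpace ℂ E] [CompleteSpace E] {T : E →L[ℂ] E}
    (hs : ∀ f g, inner ℂ g (T f) = inner ℂ (T g) f) {c : ℝ} (hb : ∀ f, ‖f‖ ≤ c * ‖T f‖) :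
    T.IsInvertible := by
  have hb' : ∀ f, ‖f‖ ≤ (c.toNNReal : ℝ) * ‖T f‖ := fun f => (hb f).trans
    (mul_le_mul_of_nonneg_right (Real.le_coe_toNNReal c) (norm_nonneg _))
  have hal : AntilipschitzWith c.toNNReal T := T.antilipschitz_of_bound hb'
  have hcl : IsClosed (T.range : Set E) := by
    have h := hal.isClosed_range T.uniformContinuous
    exact h
  have hcomp : CompleteSpace T.range := hcl.completeSpace_coe
  have htop : T.range = ⊤ := by
    rw [← Submodule.orthogonal_eq_bot_iff, Submodule.eq_bot_iff]
    intro y hy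
    have h0 : T y = 0 := by
      refine inner_self_eq_zero (𝕜 := ℂ) |>.1 ?_
      rw [← hs]
      exact (Submodule.mem_orthogonal' _ _).1 hy _ ⟨T y, rfl⟩
    have := hb y
    rw [h0, norm_zero, mul_zero] at this
    exact norm_le_zero_iff.1 this
  exact ⟨ContinuousLinearEquiv.ofBijective T (LinearMap.ker_eq_bot.2 hal.injective) htop,
    ContinuousLinearEquiv.coe_ofBijective _ _ _⟩

theorem integrable_norm_sq {d : ℕ} {D : Set (Pt d)} {E : Type} [NormedAddCommGroup E]
    (u : Lp E 2 (leb D)) : Integrable (fun x => ‖u x‖ ^ 2) (leb D) :=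
  (memLp_two_iff_integrable_sq_norm (Lp.memLp u).1).1 (Lp.memLp u)

theorem norm_sq_eq_integral {d : ℕ} {D : Set (Pt d)} {E : Type} [NormedAddCommGroup E]
    [InnerProductSpace ℂ E] (u : Lp E 2 (leb D)) : ‖u‖ ^ 2 = ∫ x in D, ‖u x‖ ^ 2 := by
  rw [← inner_self_eq_norm_sq (𝕜 := ℂ) u, L2.inner_def]
  have : ∀ x, inner ℂ (u x) (u x) = ((‖u x‖ ^ 2 : ℝ) : ℂ) := fun x => by
    rw [inner_self_eq_norm_sq_to_K]
    simp
  simp only [this]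
  rw [integral_complex_ofReal]
  simp

/-- A pointwise lower bound for the integrand of `𝒜(f; f')` with a suitable `f'` gives a lower
bound for `𝐀`. -/
theorem norm_le_of_pointwise_coercive {d : ℕ} {D : Set (Pt d)}
    {a : Pt d → Matrix (Fin d) (Fin d) ℝ} (ha : IsCoeffField a) {κ c K : ℝ} (hc : 0 < c)
    (hK : 0 ≤ K) {f f' : X D} (hf' : ‖f'‖ ≤ K * ‖f‖)
    (hpt : ∀ᵐ x ∂(leb D), c * (‖X.w f x‖ ^ 2 + ‖X.dw f x‖ ^ 2 + (‖X.v f x‖ ^ 2 + ‖X.dv f x‖ ^ 2)) ≤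
      ((dotConj (matVec (a x) (X.dw f x)) (X.dw f' x) + κ * X.w f x * conj (X.w f' x)) -
        (dotConj (X.dv f x) (X.dv f' x) + X.v f x * conj (X.v f' x))).re) :
    ‖f‖ ≤ K / c * ‖opA D a κ f‖ := by
  have i1 : Integrable (fun x => dotConj (matVec (a x) (X.dw f x)) (X.dw f' x) +
      κ * X.w f x * conj (X.w f' x)) (leb D) := by
    simp only [mul_assoc]
    exact (ha.integrable _ _).add ((integrable_L2 _ _).const_mul _)
  have i2 : Integrable (fun x => dotConj (X.dv f x) (X.dv f' x) +
      X.v f x * conj (X.v f' x)) (leb D) := (integrable_L2vec _ _).add (integrable_L2 _ _)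
  have h1 : c * ‖f‖ ^ 2 ≤ (formA D a κ f f').re := by
    have e1 : ‖f‖ ^ 2 = ∫ x in D,
        (‖X.w f x‖ ^ 2 + ‖X.dw f x‖ ^ 2 + (‖X.v f x‖ ^ 2 + ‖X.dv f x‖ ^ 2)) := by
      have j1 := (integrable_norm_sq (X.w f)).add (integrable_norm_sq (X.dw f))
      have j2 := (integrable_norm_sq (X.v f)).add (integrable_norm_sq (X.dv f))
      simp only [Pi.add_def] at j1 j2
      rw [integral_add j1 j2, integral_add (integrable_norm_sq _) (integrable_norm_sq _),
        integral_add (integrable_norm_sq _) (integrable_norm_sq _), X.norm_sq_eq]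
      simp only [norm_sq_eq_integral]
    have e2 : (formA D a κ f f').re = ∫ x in D,
        ((dotConj (matVec (a x) (X.dw f x)) (X.dw f' x) + κ * X.w f x * conj (X.w f' x)) -
        (dotConj (X.dv f x) (X.dv f' x) + X.v f x * conj (X.v f' x))).re := by
      rw [formA, ← integral_sub i1 i2]
      exact (Complex.reCLM.integral_comp_comm (i1.sub i2)).symm
    rw [e1, e2, ← integral_const_mul]
    refine integral_mono_ae (Integrable.const_mul (((integrable_norm_sq _).add
      (integrable_norm_sq _)).add ((integrable_norm_sq _).add (integrable_norm_sq _))) c)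
      (i1.sub i2).re hpt
  -- The form at `(f, f')` is the inner product of `f'` with the image of `f`; together with `h1`
  -- one factor `‖f‖` cancels.
  have h2 : (formA D a κ f f').re ≤ K * ‖f‖ * ‖opA D a κ f‖ := by
    rw [← ha.inner_opA]
    refine (Complex.re_le_norm _).trans ((norm_inner_le_norm _ _).trans ?_)
    gcongr
  rcases eq_or_lt_of_le (norm_nonneg f) with h0 | h0
  · rw [← h0]
    positivity
  · have h3 : c * ‖f‖ ≤ K * ‖opA D a κ f‖ := by
      have : (c * ‖f‖) * ‖f‖ ≤ (K * ‖opA D a κ f‖) * ‖f‖ := by nlinarith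
      exact le_of_mul_le_mul_right this h0
    rw [div_mul_eq_mul_div, le_div_iff₀ hc]
    linarith

/-- The maps `(w, v) ↦ (α w + β v, γ w + δ v)` with `α + β = γ + δ` preserve `X(D)`. -/
theorem X.exists_linear {d : ℕ} {D : Set (Pt d)} (f : X D) (α β γ δ : ℝ)
    (h : α + β = γ + δ) (hα : |α| ≤ 2) (hβ : |β| ≤ 2) (hγ : |γ| ≤ 2) (hδ : |δ| ≤ 2) :
    ∃ f' : X D, X.w f' = (α : ℂ) • X.w f + (β : ℂ) • X.v f ∧
      X.dw f' = (α : ℂ) • X.dw f + (β : ℂ) • X.dv f ∧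
      X.v f' = (γ : ℂ) • X.w f + (δ : ℂ) • X.v f ∧
      X.dv f' = (γ : ℂ) • X.dw f + (δ : ℂ) • X.dv f ∧ ‖f'‖ ≤ 4 * ‖f‖ := by
  let p : XSub D := f
  have hp := p.2
  let q : WithLp 2 (L2Pair D × L2Pair D) := WithLp.toLp 2
    ((α : ℂ) • p.1.fst + (β : ℂ) • p.1.snd, (γ : ℂ) • p.1.fst + (δ : ℂ) • p.1.snd)
  have hq : q ∈ XSub D := by
    refine ⟨(H1 D).add_mem ((H1 D).smul_mem _ hp.1) ((H1 D).smul_mem _ hp.2.1),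
      (H1 D).add_mem ((H1 D).smul_mem _ hp.1) ((H1 D).smul_mem _ hp.2.1), ?_⟩
    -- The condition `α + β = γ + δ` makes the difference of the new components a multiple of $w-v$,
    -- so it stays in $H^1_0(D)$.
    have e : q.fst - q.snd = ((α - γ : ℝ) : ℂ) • (p.1.fst - p.1.snd) := by
      have e1 : (β : ℂ) = γ + δ - α := by
        rw [← Complex.ofReal_add, ← h]
        push_cast
        ring
      change ((α : ℂ) • p.1.fst + (β : ℂ) • p.1.snd) - ((γ : ℂ) • p.1.fst + (δ : ℂ) • p.1.snd) = _
      rw [e1]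
      push_cast
      module
    rw [e]
    exact (H10 D).smul_mem _ hp.2.2
  have hn : ∀ {E : Type} [NormedAddCommGroup E] [NormedSpace ℂ E] (x y : E) {s t : ℝ},
      |s| ≤ 2 → |t| ≤ 2 → ‖(s : ℂ) • x + (t : ℂ) • y‖ ^ 2 ≤ 8 * (‖x‖ ^ 2 + ‖y‖ ^ 2) := by
    intro E _ _ x y s t hs ht
    have h1 : ‖(s : ℂ) • x + (t : ℂ) • y‖ ≤ 2 * ‖x‖ + 2 * ‖y‖ := by
      refine (norm_add_le _ _).trans ?_
      rw [norm_smul, norm_smul, Complex.norm_real, Complex.norm_real]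
      exact add_le_add (mul_le_mul_of_nonneg_right hs (norm_nonneg _))
        (mul_le_mul_of_nonneg_right ht (norm_nonneg _))
    have h2 := pow_le_pow_left₀ (norm_nonneg _) h1 2
    nlinarith [sq_nonneg (‖x‖ - ‖y‖)]
  let f' : X D := (⟨q, hq⟩ : XSub D)
  have w1 : X.w f' = (α : ℂ) • X.w f + (β : ℂ) • X.v f := rfl
  have w2 : X.dw f' = (α : ℂ) • X.dw f + (β : ℂ) • X.dv f := rfl
  have w3 : X.v f' = (γ : ℂ) • X.w f + (δ : ℂ) • X.v f := rfl
  have w4 : X.dv f' = (γ : ℂ) • X.dw f + (δ : ℂ) • X.dv f := rfl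
  refine ⟨f', w1, w2, w3, w4, ?_⟩
  refine le_of_sq_le_sq ?_ (by positivity)
  rw [mul_pow, X.norm_sq_eq f', X.norm_sq_eq f, w1, w2, w3, w4]
  linarith [hn (X.w f) (X.v f) hα hβ, hn (X.dw f) (X.dv f) hα hβ, hn (X.w f) (X.v f) hγ hδ,
    hn (X.dw f) (X.dv f) hγ hδ]

theorem re_inner_self {E : Type*} [NormedAddCommGroup E] [InnerProductSpace ℂ E] (x : E) :
    (inner ℂ x x).re = ‖x‖ ^ 2 := inner_self_eq_norm_sq (𝕜 := ℂ) x

/-- Coercivity in the case of coefficients larger than one. -/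
theorem exists_norm_le_opA_of_one_lt {d : ℕ} {D : Set (Pt d)} {b κ : ℝ} (hb : 1 < b)
    (hκ : b ≤ κ) :
    ∃ C : ℝ, 0 ≤ C ∧ ∀ a : Pt d → Matrix (Fin d) (Fin d) ℝ, IsCoeffField a →
      (∀ x ξ, b * ‖ξ‖ ^ 2 ≤ (dotConj (matVec (a x) ξ) ξ).re) →
      ∀ f : X D, ‖f‖ ≤ C * ‖opA D a κ f‖ := by
  -- Chosen so that the quadratic form $(b-c)s^2-2st+(1-c)t^2$ has determinant $c^2>0$; this is what
  -- `hc1` records.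
  set c : ℝ := (b - 1) / (b + 1) with hc
  have hc0 : 0 < c := div_pos (by linarith) (by linarith)
  have hc1 : (b - c) * (1 - c) = 1 + c ^ 2 := by
    have : c * (b + 1) = b - 1 := div_mul_cancel₀ _ (by linarith)
    linear_combination -this
  have hc2 : c < 1 := by
    rw [hc, div_lt_one (by linarith)]
    linarith
  have hkey : ∀ s t : ℝ, c * (s ^ 2 + t ^ 2) ≤ b * s ^ 2 + t ^ 2 - 2 * (s * t) := by
    intro s t
    have h1 : 0 ≤ (1 - c) * (b * s ^ 2 + t ^ 2 - 2 * (s * t) - c * (s ^ 2 + t ^ 2)) := by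
      have : (1 - c) * (b * s ^ 2 + t ^ 2 - 2 * (s * t) - c * (s ^ 2 + t ^ 2)) =
          (s - (1 - c) * t) ^ 2 + c ^ 2 * s ^ 2 := by
        linear_combination s ^ 2 * hc1
      rw [this]
      positivity
    have := nonneg_of_mul_nonneg_right h1 (by linarith)
    linarith
  refine ⟨4 / c, by positivity, fun a ha hell f => ?_⟩
  -- The test pair $(w,2w-v)$ reverses the sign of the $v$-part; the mixed term
  -- $-2\operatorname{Re}(\nabla v\cdot\nabla\overline w)$ is dominated because the coefficient of
  -- $|\nabla w|^2$ exceeds one.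
  obtain ⟨f', w1, w2, w3, w4, hn⟩ := X.exists_linear f 1 0 2 (-1) (by norm_num) (by norm_num)
    (by norm_num) (by norm_num) (by norm_num)
  simp only [Complex.ofReal_one, one_smul, Complex.ofReal_zero, zero_smul, add_zero] at w1 w2
  refine norm_le_of_pointwise_coercive ha hc0 (by norm_num) hn ?_
  rw [w1, w2, w3, w4]
  filter_upwards [Lp.coeFn_add (((2 : ℝ) : ℂ) • X.dw f) (((-1 : ℝ) : ℂ) • X.dv f),
    Lp.coeFn_add (((2 : ℝ) : ℂ) • X.w f) (((-1 : ℝ) : ℂ) • X.v f),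
    Lp.coeFn_smul ((2 : ℝ) : ℂ) (X.dw f), Lp.coeFn_smul ((-1 : ℝ) : ℂ) (X.dv f),
    Lp.coeFn_smul ((2 : ℝ) : ℂ) (X.w f), Lp.coeFn_smul ((-1 : ℝ) : ℂ) (X.v f)]
    with x h2 h3 h4 h5 h6 h7
  rw [h2, h3, Pi.add_apply, Pi.add_apply, h4, h5, h6, h7]
  simp only [Pi.smul_apply, smul_eq_mul]
  generalize X.dw f x = ξ
  generalize X.dv f x = ζ
  generalize X.w f x = w
  generalize X.v f x = v
  have e1 : (dotConj ζ (((2 : ℝ) : ℂ) • ξ + ((-1 : ℝ) : ℂ) • ζ)).re ≤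
      2 * (‖ξ‖ * ‖ζ‖) - ‖ζ‖ ^ 2 := by
    rw [dotConj_eq_inner, inner_add_left, inner_smul_left, inner_smul_left, Complex.conj_ofReal,
      Complex.conj_ofReal, Complex.add_re, Complex.re_ofReal_mul, Complex.re_ofReal_mul,
      re_inner_self]
    have := (Complex.re_le_norm (inner ℂ ξ ζ)).trans (norm_inner_le_norm ξ ζ)
    linarith
  have e2 : (v * conj (((2 : ℝ) : ℂ) * w + ((-1 : ℝ) : ℂ) * v)).re ≤
      2 * (‖w‖ * ‖v‖) - ‖v‖ ^ 2 := by
    have e3 : v * conj (((2 : ℝ) : ℂ) * w + ((-1 : ℝ) : ℂ) * v) =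
        ((2 : ℝ) : ℂ) * (v * conj w) - ((‖v‖ ^ 2 : ℝ) : ℂ) := by
      rw [Complex.ofReal_pow, ← Complex.mul_conj']
      simp only [map_add, map_mul, Complex.conj_ofReal]
      push_cast
      ring
    rw [e3, Complex.sub_re, Complex.re_ofReal_mul, Complex.ofReal_re]
    have := Complex.re_le_norm (v * conj w)
    rw [norm_mul, RCLike.norm_conj] at this
    linarith
  have e4 : (κ * w * conj w : ℂ).re = κ * ‖w‖ ^ 2 := by
    rw [mul_assoc, Complex.mul_conj', ← Complex.ofReal_pow, ← Complex.ofReal_mul,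
      Complex.ofReal_re]
  rw [Complex.sub_re, Complex.add_re, Complex.add_re, e4]
  have e5 : b * ‖w‖ ^ 2 ≤ κ * ‖w‖ ^ 2 := by gcongr
  linarith [hell x ξ, hkey ‖ξ‖ ‖ζ‖, hkey ‖w‖ ‖v‖]

/-- Coercivity in the case of coefficients smaller than one. -/
theorem exists_norm_le_opA_of_lt_one {d : ℕ} {D : Set (Pt d)} {b b' κ : ℝ} (hb0 : 0 < b')
    (hb : b < 1) (hκ0 : b' ≤ κ) (hκ : κ ≤ b) :
    ∃ C : ℝ, 0 ≤ C ∧ ∀ a : Pt d → Matrix (Fin d) (Fin d) ℝ, IsCoeffField a →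
      (∀ x ξ, b' * ‖ξ‖ ^ 2 ≤ (dotConj (matVec (a x) ξ) ξ).re) →
      (∀ x ξ, (dotConj (matVec (a x) ξ) ξ).re ≤ b * ‖ξ‖ ^ 2) →
      ∀ f : X D, ‖f‖ ≤ C * ‖opA D a κ f‖ := by
  have hbpos : 0 < b := hb0.trans_le (hκ0.trans hκ)
  -- A Young weight with $t>1$ and $tb<1$, which exists because $b<1$: then $2m\le Q/t+tZ$ leaves
  -- positive parts of both `Q` and $r^2$.
  set t : ℝ := 2 / (1 + b) with ht
  have ht0 : 0 < t := by positivity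
  have ht1 : 1 < t := by rw [ht, lt_div_iff₀ (by linarith)]; linarith
  have htb : t * b < 1 := by
    rw [ht, div_mul_eq_mul_div, div_lt_one (by linarith)]
    linarith
  set c : ℝ := min (b' * (1 - 1 / t)) (1 - t * b) with hc
  have ht2 : 0 < 1 - 1 / t := by
    rw [sub_pos, div_lt_one ht0]
    exact ht1
  have hc0 : 0 < c := lt_min (mul_pos hb0 ht2) (by linarith)
  -- `Q`, `Z` are values of a quadratic form, `m` is the real part of the mixed term
  have hkey : ∀ Q Z m s r : ℝ, b' * s ^ 2 ≤ Q → Z ≤ b * r ^ 2 → 0 ≤ Q - 2 * t * m + t ^ 2 * Z →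
      c * (s ^ 2 + r ^ 2) ≤ Q - 2 * m + r ^ 2 := by
    intro Q Z m s r h1 h2 h3
    have h4 : 2 * m ≤ Q / t + t * Z := by
      have : Q / t + t * Z - 2 * m = (Q - 2 * t * m + t ^ 2 * Z) / t := by
        field_simp
        ring
      have h5 : 0 ≤ (Q - 2 * t * m + t ^ 2 * Z) / t := div_nonneg h3 ht0.le
      linarith
    have h6 : t * Z ≤ t * b * r ^ 2 := by nlinarith
    have h7 : c * s ^ 2 ≤ (1 - 1 / t) * Q := by
      calc c * s ^ 2 ≤ b' * (1 - 1 / t) * s ^ 2 := by gcongr; exact min_le_left _ _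
        _ = (1 - 1 / t) * (b' * s ^ 2) := by ring
        _ ≤ _ := by gcongr
    have h8 : c * r ^ 2 ≤ (1 - t * b) * r ^ 2 := by gcongr; exact min_le_right _ _
    have h9 : (1 - 1 / t) * Q = Q - Q / t := by ring
    linarith
  refine ⟨4 / c, by positivity, fun a ha hlo hup f => ?_⟩
  -- The test pair $(w-2v,-v)$ puts the mixed term under the matrix `a x`, where Cauchy–Schwarz for
  -- the positive form of `a x` applies and `a x` on the $v$-side costs at most `b < 1`.
  obtain ⟨f', w1, w2, w3, w4, hn⟩ := X.exists_linear f 1 (-2) 0 (-1) (by norm_num) (by norm_num)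
    (by norm_num) (by norm_num) (by norm_num)
  simp only [Complex.ofReal_one, one_smul, Complex.ofReal_zero, zero_smul, zero_add] at w1 w2 w3 w4
  refine norm_le_of_pointwise_coercive ha hc0 (by norm_num) hn ?_
  rw [w1, w2, w3, w4]
  filter_upwards [Lp.coeFn_add (X.dw f) (((-2 : ℝ) : ℂ) • X.dv f),
    Lp.coeFn_add (X.w f) (((-2 : ℝ) : ℂ) • X.v f),
    Lp.coeFn_smul ((-2 : ℝ) : ℂ) (X.dv f), Lp.coeFn_smul ((-2 : ℝ) : ℂ) (X.v f),
    Lp.coeFn_smul ((-1 : ℝ) : ℂ) (X.dv f), Lp.coeFn_smul ((-1 : ℝ) : ℂ) (X.v f)]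
    with x h2 h3 h4 h5 h6 h7
  rw [h2, h3, Pi.add_apply, Pi.add_apply, h4, h5, h6, h7]
  simp only [Pi.smul_apply, smul_eq_mul]
  generalize X.dw f x = ξ
  generalize X.dv f x = ζ
  generalize X.w f x = w
  generalize X.v f x = v
  have e1 : (dotConj (matVec (a x) ξ) (ξ + ((-2 : ℝ) : ℂ) • ζ)).re =
      (dotConj (matVec (a x) ξ) ξ).re - 2 * (dotConj (matVec (a x) ξ) ζ).re := by
    simp only [dotConj_eq_inner]
    rw [inner_add_left, inner_smul_left, Complex.conj_ofReal, Complex.add_re,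
      Complex.re_ofReal_mul]
    ring
  have e2 : (dotConj ζ (((-1 : ℝ) : ℂ) • ζ)).re = -‖ζ‖ ^ 2 := by
    rw [dotConj_eq_inner, inner_smul_left, Complex.conj_ofReal, Complex.re_ofReal_mul,
      re_inner_self]
    ring
  have e3 : (κ * w * conj (w + ((-2 : ℝ) : ℂ) * v)).re =
      κ * ‖w‖ ^ 2 - 2 * (κ * (w * conj v).re) := by
    have : (κ * w * conj (w + ((-2 : ℝ) : ℂ) * v)) =
        ((κ * ‖w‖ ^ 2 : ℝ) : ℂ) - ((2 * κ : ℝ) : ℂ) * (w * conj v) := by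
      rw [Complex.ofReal_mul, Complex.ofReal_pow, ← Complex.mul_conj']
      simp only [map_add, map_mul, Complex.conj_ofReal]
      push_cast
      ring
    rw [this, Complex.sub_re, Complex.re_ofReal_mul, Complex.ofReal_re]
    ring
  have e4 : (v * conj (((-1 : ℝ) : ℂ) * v)).re = -‖v‖ ^ 2 := by
    have : v * conj (((-1 : ℝ) : ℂ) * v) = ((-‖v‖ ^ 2 : ℝ) : ℂ) := by
      have h8 : ((-‖v‖ ^ 2 : ℝ) : ℂ) = -(‖v‖ : ℂ) ^ 2 := by push_cast; ring
      rw [h8, ← Complex.mul_conj']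
      simp
    rw [this, Complex.ofReal_re]
  have e5 : 0 ≤ (dotConj (matVec (a x) ξ) ξ).re - 2 * t * (dotConj (matVec (a x) ξ) ζ).re +
      t ^ 2 * (dotConj (matVec (a x) ζ) ζ).re := by
    have h8 := (by positivity : 0 ≤ b' * ‖ξ - (t : ℂ) • ζ‖ ^ 2).trans (hlo x (ξ - (t : ℂ) • ζ))
    have h9 : (dotConj (matVec (a x) ζ) ξ).re = (dotConj (matVec (a x) ξ) ζ).re := by
      rw [dotConj_matVec_comm (ha.2.2 x), Complex.conj_re]
    rw [matVec_sub, matVec_smul] at h8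
    simp only [dotConj_eq_inner] at h8 h9 ⊢
    rw [inner_sub_left, inner_sub_right, inner_sub_right, inner_smul_left, inner_smul_right,
      inner_smul_left, inner_smul_right, Complex.conj_ofReal] at h8
    simp only [Complex.sub_re, Complex.re_ofReal_mul] at h8
    rw [h9] at h8
    linarith
  have e6 : 0 ≤ κ * ‖w‖ ^ 2 - 2 * t * (κ * (w * conj v).re) + t ^ 2 * (κ * ‖v‖ ^ 2) := by
    have h8 : (w * conj v).re ≤ ‖w‖ * ‖v‖ := by
      have := Complex.re_le_norm (w * conj v)
      rwa [norm_mul, RCLike.norm_conj] at this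
    have h9 : 0 ≤ κ * (‖w‖ - t * ‖v‖) ^ 2 := mul_nonneg (hb0.le.trans hκ0) (sq_nonneg _)
    have h10 : 2 * t * (κ * (w * conj v).re) ≤ 2 * t * (κ * (‖w‖ * ‖v‖)) := by
      have := hb0.le.trans hκ0
      gcongr
    linarith
  have k1 := hkey _ _ _ ‖ξ‖ ‖ζ‖ (hlo x ξ) (hup x ζ) e5
  have k2 := hkey _ _ _ ‖w‖ ‖v‖ (mul_le_mul_of_nonneg_right hκ0 (sq_nonneg _))
    (mul_le_mul_of_nonneg_right hκ (sq_nonneg _)) e6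
  rw [Complex.sub_re, Complex.add_re, Complex.add_re, e1, e2, e3, e4]
  linarith

/-! ### The perturbed operator -/

/-- Only the left factor depends on the coefficient field, which brings the operator to the form
$A^{-1}S$ with fixed $S$ used for the adjoint estimate. -/
theorem opT_eq {d : ℕ} (D : Set (Pt d)) (a : Pt d → Matrix (Fin d) (Fin d) ℝ) (κ n : ℝ) (τ : ℂ) :
    opT D a κ n τ = (opA D a κ).inverse ∘L (opB D n + (1 / τ) • opC D κ) := by
  ext f
  simp [opT]

/-- The energy `∫_{D ∩ Ω} |∇w|²`. -/
def energyOn {d : ℕ} {D : Set (Pt d)} (Ω : Set (Pt d)) (f : X D) : ℝ :=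
  ∫ x in D ∩ Ω, ‖X.dw f x‖ ^ 2

theorem energyOn_nonneg {d : ℕ} {D : Set (Pt d)} (Ω : Set (Pt d)) (f : X D) :
    0 ≤ energyOn Ω f :=
  integral_nonneg fun _ => by positivity

theorem memLp_dw_inter {d : ℕ} {D : Set (Pt d)} (Ω : Set (Pt d)) (f : X D) :
    MemLp (X.dw f) 2 (volume.restrict (D ∩ Ω)) :=
  (Lp.memLp (X.dw f)).mono_measure (Measure.restrict_mono_set _ Set.inter_subset_left)

theorem integrable_dw_inter {d : ℕ} {D : Set (Pt d)} (Ω : Set (Pt d)) (f : X D) :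
    Integrable (fun x => ‖X.dw f x‖ ^ 2) (volume.restrict (D ∩ Ω)) :=
  (memLp_two_iff_integrable_sq_norm (memLp_dw_inter Ω f).1).1 (memLp_dw_inter Ω f)

theorem energyOn_le {d : ℕ} {D : Set (Pt d)} (Ω : Set (Pt d)) (f : X D) :
    energyOn Ω f ≤ ‖f‖ ^ 2 := by
  refine le_trans ?_ (X.norm_dw_sq_le f)
  rw [norm_sq_eq_integral]
  exact setIntegral_mono_set (integrable_norm_sq _) (Eventually.of_forall fun x => by positivity)
    Set.inter_subset_left.eventuallyLE

theorem energyOn_add_le {d : ℕ} {D : Set (Pt d)} (Ω : Set (Pt d)) (f g : X D) :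
    energyOn Ω (f + g) ≤ 2 * energyOn Ω f + 2 * energyOn Ω g := by
  rw [energyOn, energyOn, energyOn, ← integral_const_mul, ← integral_const_mul,
    ← integral_add ((integrable_dw_inter Ω f).const_mul _) ((integrable_dw_inter Ω g).const_mul _)]
  refine integral_mono_ae (integrable_dw_inter Ω _) (((integrable_dw_inter Ω f).const_mul _).add
    ((integrable_dw_inter Ω g).const_mul _)) ?_
  have h : X.dw (f + g) =ᵐ[leb D] X.dw f + X.dw g := by
    rw [map_add]
    exact Lp.coeFn_add _ _
  filter_upwards [(Measure.absolutelyContinuous_of_le (Measure.restrict_mono_set volume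
    (Set.inter_subset_left (s := D) (t := Ω)))).ae_le h] with x hx
  rw [hx, Pi.add_apply]
  have h1 := pow_le_pow_left₀ (norm_nonneg _) (norm_add_le (X.dw f x) (X.dw g x)) 2
  nlinarith [sq_nonneg (‖X.dw f x‖ - ‖X.dw g x‖)]

theorem energyOn_le_of_ae {d : ℕ} {D Ω : Set (Pt d)} (hD : MeasurableSet D)
    (hΩ : MeasurableSet Ω) (hfin : volume Ω ≠ ⊤) {f : X D} {C : ℝ} (hC : 0 ≤ C)
    (h : ∀ᵐ x, x ∈ Ω → ‖X.dw f x‖ ^ 2 ≤ C) : energyOn Ω f ≤ C * volume.real Ω := by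
  have hfin' : volume (D ∩ Ω) ≠ ⊤ := measure_ne_top_of_subset Set.inter_subset_right hfin
  have h1 : energyOn Ω f ≤ ∫ _ in D ∩ Ω, C := by
    refine setIntegral_mono_on_ae (integrable_dw_inter Ω f) (integrableOn_const hfin')
      (hD.inter hΩ) ?_
    filter_upwards [h] with x hx hxΩ
    exact hx hxΩ.2
  rw [setIntegral_const, smul_eq_mul, mul_comm] at h1
  exact h1.trans (mul_le_mul_of_nonneg_left
    (measureReal_mono Set.inter_subset_right hfin) hC)

/-- The difference of the operators for two coefficients that agree outside of `Ω`. -/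
theorem norm_inner_opA_sub_sq_le {d : ℕ} {D Ω : Set (Pt d)} (hD : MeasurableSet D)
    {a b : Pt d → Matrix (Fin d) (Fin d) ℝ} (ha : IsCoeffField a)
    (hb : IsCoeffField b) (hab : ∀ x ∉ Ω, b x = a x) {K : ℝ} (hK0 : 0 ≤ K)
    (hK : ∀ x ξ, ‖matVec (a x - b x) ξ‖ ≤ K * ‖ξ‖) (κ : ℝ) (f φ : X D) :
    ‖(inner ℂ φ (opA D a κ f - opA D b κ f) : ℂ)‖ ^ 2 ≤
      K ^ 2 * energyOn Ω f * energyOn Ω φ := by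
  have hw : Integrable (fun x => (κ : ℂ) * X.w f x * conj (X.w φ x)) (leb D) := by
    simp only [mul_assoc]
    exact (integrable_L2 _ _).const_mul _
  have hA := (ha.integrable (X.dw f) (X.dw φ)).add hw
  have hB := (hb.integrable (X.dw f) (X.dw φ)).add hw
  simp only [Pi.add_def] at hA hB
  -- The `κ` terms and the whole `v` part cancel, and the remaining integrand vanishes where the
  -- coefficients agree.
  have h1 : inner ℂ φ (opA D a κ f - opA D b κ f) =
      ∫ x in D ∩ Ω, dotConj (matVec (a x - b x) (X.dw f x)) (X.dw φ x) := by
    rw [inner_sub_right, ha.inner_opA, hb.inner_opA, formA, formA, sub_sub_sub_cancel_right,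
      ← integral_sub hA hB,
      setIntegral_eq_of_subset_of_forall_sdiff_eq_zero (s := D ∩ Ω) hD Set.inter_subset_left]
    · refine integral_congr_ae (Eventually.of_forall fun x => ?_)
      simp only [matrix_sub_matVec, dotConj_eq_inner, inner_sub_right]
      ring
    · intro x hx
      rw [hab x fun h => hx.2 ⟨hx.1, h⟩, sub_self]
  have h2 : ‖(inner ℂ φ (opA D a κ f - opA D b κ f) : ℂ)‖ ≤
      K * ∫ x in D ∩ Ω, ‖X.dw f x‖ * ‖X.dw φ x‖ := by
    rw [h1, ← integral_const_mul]
    refine (norm_integral_le_integral_norm _).trans (integral_mono_of_nonneg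
      (Eventually.of_forall fun x => norm_nonneg _)
      (((memLp_dw_inter Ω f).norm.integrable_mul (memLp_dw_inter Ω φ).norm).const_mul K)
      (Eventually.of_forall fun x => ?_))
    refine (norm_dotConj_le _ _).trans ?_
    change _ ≤ K * (‖X.dw f x‖ * ‖X.dw φ x‖)
    rw [← mul_assoc]
    exact mul_le_mul_of_nonneg_right (hK _ _) (norm_nonneg _)
  have hH : ∫ x in D ∩ Ω, ‖X.dw f x‖ * ‖X.dw φ x‖ ≤
      (∫ x in D ∩ Ω, ‖X.dw f x‖ ^ (2 : ℝ)) ^ (1 / (2 : ℝ)) *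
        (∫ x in D ∩ Ω, ‖X.dw φ x‖ ^ (2 : ℝ)) ^ (1 / (2 : ℝ)) := by
    refine integral_mul_le_Lp_mul_Lq_of_nonneg Real.HolderConjugate.two_two
      (Eventually.of_forall fun x => norm_nonneg _) (Eventually.of_forall fun x => norm_nonneg _)
      ?_ ?_ <;> simp only [ENNReal.ofReal_ofNat]
    · exact (memLp_dw_inter Ω f).norm
    · exact (memLp_dw_inter Ω φ).norm
  simp only [Real.rpow_ofNat, ← Real.sqrt_eq_rpow] at hH
  change _ ≤ √(energyOn Ω f) * √(energyOn Ω φ) at hH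
  have h3 := pow_le_pow_left₀ (norm_nonneg _)
    (h2.trans (mul_le_mul_of_nonneg_left hH hK0)) 2
  rwa [mul_pow, mul_pow, Real.sq_sqrt (energyOn_nonneg Ω f), Real.sq_sqrt (energyOn_nonneg Ω φ),
    ← mul_assoc] at h3

/-- The action of a perturbation of a symmetric operator on the adjoint of `T = A⁻¹ S`. -/
theorem norm_inner_adjoint_sub_sq_le {E : Type*} [NormedAddCommGroup E] [InnerProductSpace ℂ E]
    [CompleteSpace E] {A A' S : E →L[ℂ] E} (hA : ∀ f g, inner ℂ g (A f) = inner ℂ (A g) f)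
    (hAi : A.IsInvertible) (hAi' : A'.IsInvertible) {c K : ℝ}
    (hb : ∀ f, ‖f‖ ≤ c * ‖A' f‖) {N : E → ℝ} (hN0 : ∀ f, 0 ≤ N f)
    (hN : ∀ f, N f ≤ ‖f‖ ^ 2) (hNadd : ∀ f g, N (f + g) ≤ 2 * N f + 2 * N g)
    (hK : ∀ f φ, ‖(inner ℂ φ (A f - A' f) : ℂ)‖ ^ 2 ≤ K ^ 2 * N f * N φ) (g φ : E) :
    ‖(inner ℂ g ((A'.inverse ∘L S).adjoint φ - (A.inverse ∘L S).adjoint φ) : ℂ)‖ ^ 2 ≤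
      K ^ 2 * (2 + 2 * (c ^ 2 * K ^ 2)) * N (A.inverse (S g)) * N (A.inverse φ) := by
  set h := A.inverse (S g) with hh
  set h' := A'.inverse (S g) with hh'
  set u := A.inverse φ with hu
  have e1 : A h = S g := hAi.self_apply_inverse _
  have e2 : A' h' = S g := hAi'.self_apply_inverse _
  have e3 : A u = φ := hAi.self_apply_inverse _
  have e4 : A' (h' - h) = A h - A' h := by rw [map_sub, e2, e1]
  -- Duality: the hypothesis on the difference is tested with the vector $(A-A')h$ itself, whose
  -- local energy is at most its squared norm.
  have e5 : ‖A h - A' h‖ ^ 2 ≤ K ^ 2 * N h := by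
    rcases eq_or_ne (A h - A' h) 0 with h0 | h0
    · rw [h0, norm_zero, zero_pow two_ne_zero]
      exact mul_nonneg (sq_nonneg _) (hN0 _)
    · have h1 := hK h (A h - A' h)
      rw [inner_self_eq_norm_sq_to_K, norm_pow, RCLike.norm_ofReal, abs_norm] at h1
      have h2 : K ^ 2 * N h * N (A h - A' h) ≤ K ^ 2 * N h * ‖A h - A' h‖ ^ 2 :=
        mul_le_mul_of_nonneg_left (hN _) (mul_nonneg (sq_nonneg _) (hN0 _))
      have h3 : 0 < ‖A h - A' h‖ ^ 2 := by positivity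
      refine le_of_mul_le_mul_right ?_ h3
      linarith
  have e6 : ‖h' - h‖ ^ 2 ≤ c ^ 2 * K ^ 2 * N h := by
    have h1 := pow_le_pow_left₀ (norm_nonneg _) (hb (h' - h)) 2
    rw [e4, mul_pow] at h1
    rw [mul_assoc]
    exact h1.trans (mul_le_mul_of_nonneg_left e5 (sq_nonneg _))
  -- The perturbed solution need not have a bounded gradient near the defects; its local energy is
  -- compared with that of the unperturbed `h` through the global norm of `h' - h`.
  have e7 : N h' ≤ (2 + 2 * (c ^ 2 * K ^ 2)) * N h := by
    have h1 := hNadd h (h' - h)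
    rw [add_sub_cancel] at h1
    linarith [hN (h' - h)]
  -- Writing $\varphi=Au$ and moving $A$ across gives $\langle A(h'-h),u\rangle$, and $Ah=Sg=A'h'$
  -- turns this into $\langle (A-A')h',u\rangle$.
  have e8 : inner ℂ g ((A'.inverse ∘L S).adjoint φ - (A.inverse ∘L S).adjoint φ) =
      conj (inner ℂ u (A h' - A' h')) := by
    rw [inner_sub_right, ContinuousLinearMap.adjoint_inner_right,
      ContinuousLinearMap.adjoint_inner_right, ← inner_sub_left, inner_conj_symm]
    change inner ℂ (h' - h) φ = _
    rw [← e3, hA, map_sub, e1, e2]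
  rw [e8, RCLike.norm_conj]
  refine (hK h' u).trans ?_
  refine mul_le_mul_of_nonneg_right ?_ (hN0 _)
  rw [mul_assoc]
  exact mul_le_mul_of_nonneg_left e7 (sq_nonneg _)

/-! ### The coefficient of the perturbed medium -/

theorem isCoeffField_const {d : ℕ} {A : Matrix (Fin d) (Fin d) ℝ} (hA : A.IsSymm) :
    IsCoeffField fun _ : Pt d => A := by
  refine ⟨fun _ _ => measurable_const, ⟨∑ i, ∑ j, |A i j|, fun _ i j => ?_⟩, fun _ => hA⟩
  exact (Finset.single_le_sum (f := fun j => |A i j|) (fun _ _ => abs_nonneg _)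
      (Finset.mem_univ j)).trans (Finset.single_le_sum (f := fun i => ∑ j, |A i j|)
        (fun _ _ => Finset.sum_nonneg fun _ _ => abs_nonneg _) (Finset.mem_univ i))

theorem isCoeffField_coeff {d M : ℕ} {A : Matrix (Fin d) (Fin d) ℝ} (hA : A.IsSymm)
    {Am : Fin M → Matrix (Fin d) (Fin d) ℝ} (hAm : ∀ m, (Am m).IsSymm) (z : Fin M → Pt d)
    {B : Fin M → Set (Pt d)} (hB : ∀ m, IsSmoothBall (B m)) (ε : ℝ) :
    IsCoeffField (coeff A Am z B ε) := by
  have hval : ∀ x i j, coeff A Am z B ε x i j =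
      A i j + ∑ m, (defect (z m) (B m) ε).indicator (fun _ => Am m i j - A i j) x := by
    intro x i j
    simp only [coeff, Matrix.add_apply, Matrix.sum_apply]
    congr 1
    refine Finset.sum_congr rfl fun m _ => ?_
    by_cases hx : x ∈ defect (z m) (B m) ε <;> simp [hx]
  refine ⟨fun i j => ?_, ⟨∑ i, ∑ j, (|A i j| + ∑ m, |Am m i j - A i j|), fun x i j => ?_⟩,
    fun x => ?_⟩
  · simp_rw [hval]
    exact measurable_const.add (Finset.measurable_sum _ fun m _ =>
      measurable_const.indicator (measurableSet_defect (z m) (hB m) ε))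
  · have hpos : ∀ i j, 0 ≤ |A i j| + ∑ m, |Am m i j - A i j| := fun i j =>
      add_nonneg (abs_nonneg _) (Finset.sum_nonneg fun m _ => abs_nonneg _)
    refine le_trans ?_ (Finset.single_le_sum (fun i _ => Finset.sum_nonneg fun j _ => hpos i j)
      (Finset.mem_univ i))
    refine le_trans ?_ (Finset.single_le_sum (fun j _ => hpos i j) (Finset.mem_univ j))
    rw [hval]
    refine (abs_add_le _ _).trans (add_le_add_right ?_ _)
    refine (Finset.abs_sum_le_sum_abs _ _).trans (Finset.sum_le_sum fun m _ => ?_)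
    by_cases hx : x ∈ defect (z m) (B m) ε <;> simp [hx]
  · refine Matrix.IsSymm.ext fun i j => ?_
    simp only [hval, hA.apply, fun m => (hAm m).apply]

theorem IsSmoothBall.exists_subset_closedBall {d : ℕ} {B : Set (Pt d)} (hB : IsSmoothBall B) :
    ∃ ρ : ℝ, 0 ≤ ρ ∧ B ⊆ Metric.closedBall 0 ρ := by
  obtain ⟨Φ, r, -, -, -, rfl⟩ := hB
  have h : Bornology.IsBounded (Φ '' Metric.closedBall 0 r) :=
    ((isCompact_closedBall 0 r).image Φ.continuous).isBounded
  obtain ⟨ρ, hρ⟩ := h.subset_closedBall 0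
  exact ⟨max ρ 0, le_max_right _ _, ((Set.image_mono Metric.ball_subset_closedBall).trans hρ).trans
    (Metric.closedBall_subset_closedBall (le_max_left _ _))⟩

theorem defect_subset_closedBall {d : ℕ} (z : Pt d) {B : Set (Pt d)} {ρ ε : ℝ}
    (hB : B ⊆ Metric.closedBall 0 ρ) (hε : 0 ≤ ε) :
    defect z B ε ⊆ Metric.closedBall z (ε * ρ) := by
  rintro _ ⟨y, hy, rfl⟩
  have h := mem_closedBall_zero_iff.1 (hB hy)
  rw [Metric.mem_closedBall, dist_eq_norm]
  simp only [add_sub_cancel_left, norm_smul, Real.norm_of_nonneg hε]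
  gcongr

theorem coeff_eq_of_notMem {d M : ℕ} (A : Matrix (Fin d) (Fin d) ℝ)
    (Am : Fin M → Matrix (Fin d) (Fin d) ℝ) (z : Fin M → Pt d) (B : Fin M → Set (Pt d)) (ε : ℝ)
    {x : Pt d} (hx : ∀ m, x ∉ defect (z m) (B m) ε) : coeff A Am z B ε x = A := by
  simp [coeff, hx]

theorem coeff_eq_of_mem {d M : ℕ} (A : Matrix (Fin d) (Fin d) ℝ)
    (Am : Fin M → Matrix (Fin d) (Fin d) ℝ) (z : Fin M → Pt d) (B : Fin M → Set (Pt d)) (ε : ℝ)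
    {x : Pt d} {m : Fin M} (hx : x ∈ defect (z m) (B m) ε)
    (hx' : ∀ m' ≠ m, x ∉ defect (z m') (B m') ε) : coeff A Am z B ε x = Am m := by
  rw [coeff, Finset.sum_eq_single m (fun m' _ h => Set.indicator_of_notMem (hx' m' h) _)
    (fun h => absurd (Finset.mem_univ m) h), Set.indicator_of_mem hx, add_sub_cancel]

/-- For small `ε` the coefficient takes the values `A` and `A_m` only. -/
theorem coeff_eq_or {d M : ℕ} (A : Matrix (Fin d) (Fin d) ℝ)
    (Am : Fin M → Matrix (Fin d) (Fin d) ℝ) {z : Fin M → Pt d} {B : Fin M → Set (Pt d)}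
    {c₀ ρ ε : ℝ} (hz : ∀ i j, i ≠ j → c₀ ≤ dist (z i) (z j))
    (hρ : ∀ m, B m ⊆ Metric.closedBall 0 ρ) (hε : 0 ≤ ε) (hε' : 2 * (ε * ρ) < c₀) (x : Pt d) :
    coeff A Am z B ε x = A ∨ ∃ m, coeff A Am z B ε x = Am m := by
  by_cases h : ∃ m, x ∈ defect (z m) (B m) ε
  · obtain ⟨m, hm⟩ := h
    refine Or.inr ⟨m, coeff_eq_of_mem A Am z B ε hm fun m' hne hm' => ?_⟩
    have h1 := defect_subset_closedBall (z m) (hρ m) hε hm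
    have h2 := defect_subset_closedBall (z m') (hρ m') hε hm'
    rw [Metric.mem_closedBall] at h1 h2
    have h3 := hz m' m hne
    have h4 := dist_triangle (z m') x (z m)
    rw [dist_comm (z m') x] at h4
    linarith
  · push Not at h
    exact Or.inl (coeff_eq_of_notMem A Am z B ε h)

/-- The minimum is taken over `Option (Fin M)`, so the value `x` is included and the case `M = 0`
needs no separate treatment. -/
theorem exists_lt_le_forall {M : ℕ} (f : Fin M → ℝ) {x y : ℝ} (hx : y < x) (hf : ∀ m, y < f m) :
    ∃ b, y < b ∧ b ≤ x ∧ ∀ m, b ≤ f m := by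
  obtain ⟨o, -, ho⟩ := Finset.exists_min_image (Finset.univ : Finset (Option (Fin M)))
    (fun o => o.elim x f) ⟨none, Finset.mem_univ _⟩
  refine ⟨o.elim x f, ?_, ho none (Finset.mem_univ _), fun m => ho (some m) (Finset.mem_univ _)⟩
  cases o with
  | none => exact hx
  | some m => exact hf m

/-- The operators `𝐀` are bounded below, uniformly in the coefficient fields with values `A` and
`A_m`. -/
theorem exists_uniform_norm_le_opA {d M : ℕ} {D : Set (Pt d)}
    {A : Matrix (Fin d) (Fin d) ℝ} (hA0 : 0 < lowerBd A) (hlu : lowerBd A ≤ upperBd A)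
    {Am : Fin M → Matrix (Fin d) (Fin d) ℝ} (hAm0 : ∀ m, 0 < lowerBd (Am m)) {κ : ℝ}
    (hκ : (1 < lowerBd A ∧ (∀ m, 1 < lowerBd (Am m)) ∧ κ = lowerBd A) ∨
      (upperBd A < 1 ∧ (∀ m, upperBd (Am m) < 1) ∧ κ = upperBd A)) :
    ∃ C : ℝ, 0 ≤ C ∧ ∀ a : Pt d → Matrix (Fin d) (Fin d) ℝ, IsCoeffField a →
      (∀ x, a x = A ∨ ∃ m, a x = Am m) → ∀ f : X D, ‖f‖ ≤ C * ‖opA D a κ f‖ := by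
  obtain ⟨b', hb'0, hb'A, hb'm⟩ := exists_lt_le_forall (fun m => lowerBd (Am m)) hA0 hAm0
  have hlow : ∀ {b : ℝ}, b ≤ lowerBd A → (∀ m, b ≤ lowerBd (Am m)) →
      ∀ {a : Pt d → Matrix (Fin d) (Fin d) ℝ}, (∀ x, a x = A ∨ ∃ m, a x = Am m) →
      ∀ x ξ, b * ‖ξ‖ ^ 2 ≤ (dotConj (matVec (a x) ξ) ξ).re := by
    intro b h1 h2 a ha x ξ
    rcases ha x with h | ⟨m, h⟩ <;> rw [h]
    · exact (mul_le_mul_of_nonneg_right h1 (sq_nonneg _)).trans (lowerBd_mul_le A ξ)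
    · exact (mul_le_mul_of_nonneg_right (h2 m) (sq_nonneg _)).trans (lowerBd_mul_le (Am m) ξ)
  rcases hκ with ⟨h1, h2, rfl⟩ | ⟨h1, h2, rfl⟩
  · obtain ⟨b, hb1, hbA, hbm⟩ := exists_lt_le_forall (fun m => lowerBd (Am m)) h1 h2
    obtain ⟨C, hC, h⟩ := exists_norm_le_opA_of_one_lt (D := D) hb1 hbA
    exact ⟨C, hC, fun a ha hval f => h a ha (hlow hbA hbm hval) f⟩
  -- A common upper bound below one is a common lower bound of the negated values. The positive
  -- bound `b'` is needed as well, since the constant in this case degenerates with the ellipticity.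
  · obtain ⟨b, hb1, hbA, hbm⟩ := exists_lt_le_forall (fun m => -upperBd (Am m))
      (neg_lt_neg h1) (fun m => neg_lt_neg (h2 m))
    obtain ⟨C, hC, h⟩ := exists_norm_le_opA_of_lt_one (D := D) (b := -b) hb'0 (by linarith)
      (hb'A.trans hlu) (by linarith)
    refine ⟨C, hC, fun a ha hval f => h a ha (hlow hb'A hb'm hval) (fun x ξ => ?_) f⟩
    rcases hval x with e | ⟨m, e⟩ <;> rw [e]
    · exact (le_upperBd_mul A ξ).trans (mul_le_mul_of_nonneg_right (by linarith) (sq_nonneg _))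
    · exact (le_upperBd_mul (Am m) ξ).trans
        (mul_le_mul_of_nonneg_right (by linarith [hbm m]) (sq_nonneg _))

/-! ### Volume of the defects and constants uniform in the centers -/

theorem volume_iUnion_closedBall_le {d M : ℕ} (z : Fin M → Pt d) {s : ℝ} (hs : 0 ≤ s) :
    volume.real (⋃ m, Metric.closedBall (z m) s) ≤
      M * volume.real (Metric.ball (0 : Pt d) 1) * s ^ d := by
  refine (measureReal_iUnion_fintype_le _).trans ?_
  have h : ∀ m, volume.real (Metric.closedBall (z m) s) =
      volume.real (Metric.ball (0 : Pt d) 1) * s ^ d := by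
    intro m
    rw [measureReal_def, Measure.addHaar_closedBall _ _ hs, ENNReal.toReal_mul,
      ENNReal.toReal_ofReal (by positivity), finrank_euclideanSpace_fin, mul_comm]
    rfl
  simp only [h, Finset.sum_const, Finset.card_univ, Fintype.card_fin, nsmul_eq_mul, mul_assoc]
  exact le_rfl

/-- A pointwise bound near each point `z m`, with one constant for all `m`. -/
theorem exists_uniform_bound {d M : ℕ} {ι : Type*} {F : ι → Pt d → ℝ} {W : ι → ℝ}
    (hW : ∀ i, 0 ≤ W i) {z : Fin M → Pt d} {r : Fin M → ℝ} (P : ι → Prop)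
    (h : ∀ m, ∃ C : ℝ, 0 ≤ C ∧ ∀ i, P i → ∀ᵐ x, x ∈ Metric.ball (z m) (r m) → F i x ≤ C * W i) :
    ∃ C : ℝ, 0 ≤ C ∧ ∀ i, P i → ∀ᵐ x, ∀ m, x ∈ Metric.ball (z m) (r m) → F i x ≤ C * W i := by
  choose C hC hF using h
  refine ⟨∑ m, C m, Finset.sum_nonneg fun m _ => hC m, fun i hi => ?_⟩
  filter_upwards [ae_all_iff.2 fun m => hF m i hi] with x hx m hxm
  exact (hx m hxm).trans (mul_le_mul_of_nonneg_right
    (Finset.single_le_sum (fun m _ => hC m) (Finset.mem_univ m)) (hW i))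

end TransmissionEig

end

/-! ### The estimate for the adjoints at the eigenfunction -/

open TransmissionEig in
theorem mainTheorem10
    {d : ℕ} (hd : d = 2 ∨ d = 3)
    -- the bounded domain `D`
    {D : Set (Pt d)} (hDo : IsOpen D) (hDc : IsConnected D) (hDb : Bornology.IsBounded D)
    -- the constant coefficients of the unperturbed medium
    (A : Matrix (Fin d) (Fin d) ℝ) (hA : A.IsSymm) (hA0 : 0 < lowerBd A)
    (n : ℝ) (hn : 0 < n)
    -- the small defects `z_m + ε B_m` with constant coefficients `A_m`
    {M : ℕ} (Am : Fin M → Matrix (Fin d) (Fin d) ℝ)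
    (hAm : ∀ m, (Am m).IsSymm) (hAm0 : ∀ m, 0 < lowerBd (Am m))
    (z : Fin M → Pt d) (B : Fin M → Set (Pt d)) (hB : ∀ m, IsSmoothBall (B m))
    (c₀ : ℝ) (hc₀ : 0 < c₀) (hzD : ∀ m, z m ∈ D)
    (hz : ∀ i j, i ≠ j → c₀ ≤ dist (z i) (z j))
    (hzb : ∀ m, c₀ ≤ Metric.infDist (z m) (frontier D))
    -- either `A_min, a_min > 1` and `κ = A_min`, or `A_max, a_max < 1` and `κ = A_max`
    (κ : ℝ)
    (hκ : (1 < lowerBd A ∧ (∀ m, 1 < lowerBd (Am m)) ∧ κ = lowerBd A) ∨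
      (upperBd A < 1 ∧ (∀ m, upperBd (Am m) < 1) ∧ κ = upperBd A))
    -- the eigenvalue `τ` and the smooth eigenfunction `φ = (w_τ, v_τ)`
    (τ : ℂ) (hτ : τ ≠ 0) (φ : X D) (hφ0 : φ ≠ 0)
    (hφ : τ • opT D (fun _ => A) κ n τ φ = φ)
    (hw : ∃ f : Pt d → ℂ, ContDiffOn ℝ ∞ f D ∧ X.w φ =ᵐ[leb D] f)
    (hv : ∃ f : Pt d → ℂ, ContDiffOn ℝ ∞ f D ∧ X.v φ =ᵐ[leb D] f) :
    (opA D (fun _ => A) κ).IsInvertible ∧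
    (∀ᶠ ε in 𝓝[>] (0 : ℝ), (opA D (coeff A Am z B ε) κ).IsInvertible) ∧
    (fun ε : ℝ => ‖(opT D (coeff A Am z B ε) κ n τ).adjoint φ -
        (opT D (fun _ => A) κ n τ).adjoint φ‖)
      =O[𝓝[>] (0 : ℝ)] fun ε : ℝ => ε ^ ((d : ℝ) / 2 + 1) := by
  have hd3 : d ≤ 3 := by omega
  have hd0 : 0 < d := by omega
  have hlu := lowerBd_le_upperBd hd0 A
  have hκ0 : 0 < κ := by
    rcases hκ with ⟨-, -, rfl⟩ | ⟨-, -, rfl⟩ <;> linarith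
  obtain ⟨f, hf, hwf⟩ := hw
  -- uniform invertibility
  obtain ⟨c, hc, hb⟩ := exists_uniform_norm_le_opA (D := D) hA0 hlu hAm0 hκ
  have hconst := isCoeffField_const (d := d) hA
  have hcoeff := fun ε => isCoeffField_coeff hA hAm z hB ε
  have hinv : ∀ a : Pt d → Matrix (Fin d) (Fin d) ℝ, IsCoeffField a →
      (∀ x, a x = A ∨ ∃ m, a x = Am m) → (opA D a κ).IsInvertible := fun a ha hval =>
    isInvertible_of_symmetric_of_bound (fun f g => ha.inner_opA_comm D κ f g) (hb a ha hval)
  have hinv0 : (opA D (fun _ => A) κ).IsInvertible := hinv _ hconst fun _ => Or.inl rfl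
  -- the radii of the defects
  obtain ⟨ρ, hρ0, hρ⟩ : ∃ ρ : ℝ, 0 ≤ ρ ∧ ∀ m, B m ⊆ Metric.closedBall 0 ρ := by
    choose ρ hρ0 hρ using fun m => (hB m).exists_subset_closedBall
    exact ⟨∑ m, ρ m, Finset.sum_nonneg fun m _ => hρ0 m, fun m => (hρ m).trans
      (Metric.closedBall_subset_closedBall
        (Finset.single_le_sum (fun m _ => hρ0 m) (Finset.mem_univ m)))⟩
  choose R hR0 hRD using fun m => Metric.nhds_basis_closedBall.mem_iff.1 (hDo.mem_nhds (hzD m))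
  have hR2 : ∀ m, 0 < R m / 2 := fun m => half_pos (hR0 m)
  have hR3 : ∀ m, Metric.ball (z m) (R m / 2) ⊆ D := fun m =>
    (Metric.ball_subset_closedBall.trans
      (Metric.closedBall_subset_closedBall (half_le_self (hR0 m).le))).trans (hRD m)
  have hev1 : ∀ᶠ ε in 𝓝[>] (0 : ℝ), 2 * (ε * ρ) < c₀ := by
    have h : Tendsto (fun ε : ℝ => 2 * (ε * ρ)) (𝓝[>] 0) (𝓝 (2 * (0 * ρ))) :=
      Tendsto.mono_left (Continuous.tendsto (by fun_prop) 0) nhdsWithin_le_nhds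
    exact h.eventually_lt_const (by simpa using hc₀)
  have hev2 : ∀ᶠ ε in 𝓝[>] (0 : ℝ), ∀ m, ε * ρ < R m / 2 / 6 := by
    have h : Tendsto (fun ε : ℝ => ε * ρ) (𝓝[>] 0) (𝓝 (0 * ρ)) :=
      Tendsto.mono_left (Continuous.tendsto (by fun_prop) 0) nhdsWithin_le_nhds
    rw [zero_mul] at h
    exact eventually_all.2 fun m => h.eventually_lt_const (by have := hR2 m; positivity)
  have hpos : ∀ᶠ ε in 𝓝[>] (0 : ℝ), 0 < ε := eventually_mem_nhdsWithin
  have hle1 : ∀ᶠ ε in 𝓝[>] (0 : ℝ), ε < 1 :=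
    nhdsWithin_le_nhds (Iio_mem_nhds zero_lt_one)
  have hval : ∀ ε : ℝ, 0 < ε → 2 * (ε * ρ) < c₀ → ∀ x, coeff A Am z B ε x = A ∨
      ∃ m, coeff A Am z B ε x = Am m := fun ε h1 h2 => coeff_eq_or A Am hz hρ h1.le h2
  refine ⟨hinv0, ?_, ?_⟩
  · filter_upwards [hpos, hev1] with ε h1 h2
    exact hinv _ (hcoeff ε) (hval ε h1 h2)
  -- interior regularity
  have hell := lowerBd_mul_le A
  set S : X D →L[ℂ] X D := opB D n + (1 / τ) • opC D κ with hS
  set A0 : X D →L[ℂ] X D := opA D (fun _ => A) κ with hA0def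
  -- The index runs over pairs of a solution and its datum, so that `C1` does not depend on the
  -- datum. This matters because the estimate is later applied to a datum that varies with `ε`.
  obtain ⟨C1, hC1, hreg1⟩ := exists_uniform_bound (d := d) (ι := X D × X D) (z := z)
    (r := fun m => R m / 2 / 6) (F := fun p x => ‖X.dw p.1 x‖ ^ 2)
    (W := fun p => ‖p.1‖ ^ 2 + ‖p.2‖ ^ 2) (fun p => by positivity)
    (fun p => A0 p.1 = opB D n p.2 + (1 / τ) • opC D κ p.2) (fun m => by
      obtain ⟨C, hC, h⟩ := exists_ae_norm_dw_sq_le hd3 A hκ0 hA0 hell (hR2 m) (hR3 m) n (1 / τ)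
      exact ⟨C, hC, fun p hp => h p.1 p.2 hp⟩)
  -- Here the solution is the fixed element $\mathbf A_0^{-1}\varphi$, so the index type is trivial
  -- and the constant may depend on `φ`.
  obtain ⟨C2, hC2, hreg2⟩ := exists_uniform_bound (d := d) (ι := Unit) (z := z)
    (r := fun m => R m / 2 / 6) (F := fun _ x => ‖X.dw (A0.inverse φ) x‖ ^ 2)
    (W := fun _ => 1) (fun _ => zero_le_one) (fun _ => True) (fun m => by
      obtain ⟨C, hC, h⟩ := exists_ae_norm_dw_sq_le_of_smooth hd3 A hκ0 hA0 hell hDo (hR2 m)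
        (half_lt_self (hR0 m)) (hRD m) (hinv0.self_apply_inverse φ) hf hwf
      exact ⟨C, hC, fun _ _ => by simpa using h⟩)
  -- bound for the difference of the matrices
  obtain ⟨K, hK0, hK⟩ : ∃ K : ℝ, 0 ≤ K ∧ ∀ m, ∀ ξ : CVec d,
      ‖matVec (A - Am m) ξ‖ ≤ K * ‖ξ‖ := by
    choose K hK0 hK using fun m => exists_norm_matVec_le (A - Am m)
    exact ⟨∑ m, K m, Finset.sum_nonneg fun m _ => hK0 m, fun m ξ => (hK m ξ).trans
      (mul_le_mul_of_nonneg_right (Finset.single_le_sum (fun m _ => hK0 m) (Finset.mem_univ m))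
        (norm_nonneg _))⟩
  set L : ℝ := K ^ 2 * (2 + 2 * (c ^ 2 * K ^ 2)) * (C1 * ((c * ‖S‖) ^ 2 + 1)) * C2 with hL
  have hL0 : 0 ≤ L := by positivity
  set v : ℝ := M * volume.real (Metric.ball (0 : Pt d) 1) * ρ ^ d with hv
  have hv0 : 0 ≤ v := by positivity
  refine IsBigO.of_bound (√L * v) ?_
  filter_upwards [hpos, hle1, hev1, hev2] with ε h0 h1 h2 h3
  set Ω : Set (Pt d) := ⋃ m, Metric.closedBall (z m) (ε * ρ) with hΩ
  have hΩm : MeasurableSet Ω :=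
    MeasurableSet.iUnion fun m => Metric.isClosed_closedBall.measurableSet
  have hΩfin : volume Ω ≠ ⊤ :=
    (isCompact_iUnion fun m => isCompact_closedBall (z m) (ε * ρ)).measure_ne_top
  have hΩv : volume.real Ω ≤ v * ε ^ d := by
    refine (volume_iUnion_closedBall_le z (by positivity)).trans_eq ?_
    rw [hv, mul_pow]
    ring
  have hΩB : ∀ x ∈ Ω, ∃ m, x ∈ Metric.ball (z m) (R m / 2 / 6) := by
    intro x hx
    obtain ⟨m, hm⟩ := Set.mem_iUnion.1 hx
    exact ⟨m, Metric.closedBall_subset_ball (h3 m) hm⟩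
  have hoff : ∀ x ∉ Ω, coeff A Am z B ε x = A := fun x hx =>
    coeff_eq_of_notMem A Am z B ε fun m hm =>
      hx (Set.mem_iUnion.2 ⟨m, defect_subset_closedBall (z m) (hρ m) h0.le hm⟩)
  have hKε : ∀ x ξ, ‖matVec (A - coeff A Am z B ε x) ξ‖ ≤ K * ‖ξ‖ := by
    intro x ξ
    rcases hval ε h0 h2 x with h | ⟨m, h⟩ <;> rw [h]
    · have : matVec (A - A) ξ = 0 := by rw [matrix_sub_matVec, sub_self]
      rw [this, norm_zero]
      positivity
    · exact hK m ξ
  have hDm : MeasurableSet D := hDo.measurableSet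
  rw [opT_eq, opT_eq, ← hS, ← hA0def]
  set y := ((opA D (coeff A Am z B ε) κ).inverse ∘L S).adjoint φ -
    (A0.inverse ∘L S).adjoint φ with hy
  -- The difference of adjoints is tested with `y`, which is that difference itself, so the left
  -- side becomes $\|y\|^4$.
  have hmain := norm_inner_adjoint_sub_sq_le (S := S) (N := energyOn Ω)
    (fun f g => hconst.inner_opA_comm D κ f g) hinv0
    (hinv _ (hcoeff ε) (hval ε h0 h2)) (hb _ (hcoeff ε) (hval ε h0 h2)) (energyOn_nonneg Ω)
    (energyOn_le Ω) (energyOn_add_le Ω)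
    (fun f φ => norm_inner_opA_sub_sq_le hDm hconst (hcoeff ε) hoff hK0 hKε κ f φ) y φ
  rw [← hA0def, ← hy, inner_self_eq_norm_sq_to_K, norm_pow, RCLike.norm_ofReal, abs_norm] at hmain
  have hh0 : ‖A0.inverse (S y)‖ ≤ c * ‖S‖ * ‖y‖ := by
    have e := hb _ hconst (fun _ => Or.inl rfl) (A0.inverse (S y))
    rw [← hA0def, hinv0.self_apply_inverse] at e
    rw [mul_assoc]
    exact e.trans (mul_le_mul_of_nonneg_left (S.le_opNorm y) hc)
  have hN1 : energyOn Ω (A0.inverse (S y)) ≤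
      C1 * ((c * ‖S‖) ^ 2 + 1) * ‖y‖ ^ 2 * volume.real Ω := by
    refine energyOn_le_of_ae hDm hΩm hΩfin (by positivity) ?_
    have e := hreg1 (A0.inverse (S y), y) (by rw [hinv0.self_apply_inverse]; rfl)
    filter_upwards [e] with x hx hxΩ
    obtain ⟨m, hm⟩ := hΩB x hxΩ
    refine (hx m hm).trans ?_
    rw [mul_assoc]
    refine mul_le_mul_of_nonneg_left ?_ hC1
    have e2 := pow_le_pow_left₀ (norm_nonneg _) hh0 2
    rw [mul_pow] at e2
    linarith
  have hN2 : energyOn Ω (A0.inverse φ) ≤ C2 * volume.real Ω := by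
    refine energyOn_le_of_ae hDm hΩm hΩfin hC2 ?_
    filter_upwards [hreg2 () trivial] with x hx hxΩ
    obtain ⟨m, hm⟩ := hΩB x hxΩ
    simpa using hx m hm
  have hfin : (‖y‖ ^ 2) ^ 2 ≤ L * (volume.real Ω) ^ 2 * ‖y‖ ^ 2 := by
    refine hmain.trans ?_
    calc _ ≤ K ^ 2 * (2 + 2 * (c ^ 2 * K ^ 2)) *
          (C1 * ((c * ‖S‖) ^ 2 + 1) * ‖y‖ ^ 2 * volume.real Ω) * (C2 * volume.real Ω) := by
          refine mul_le_mul (mul_le_mul_of_nonneg_left hN1 (by positivity)) hN2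
            (energyOn_nonneg _ _) (by positivity)
      _ = _ := by rw [hL]; ring
  have hyb : ‖y‖ ≤ √L * volume.real Ω := by
    -- One factor $\|y\|^2$ cancels against the bound for the energy of $\mathbf A_0^{-1}Sy$. Both
    -- local energies contribute a factor of the volume, so the norm is linear in the volume.
    rcases eq_or_lt_of_le (norm_nonneg y) with hy0 | hy0
    · rw [← hy0]
      positivity
    · refine le_of_sq_le_sq ?_ (by positivity)
      rw [mul_pow, Real.sq_sqrt hL0]
      refine le_of_mul_le_mul_right ?_ (pow_pos hy0 2)
      rw [← sq]
      exact hfin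
  -- For $d\ge2$ one has $d\ge d/2+1$, and $\varepsilon<1$; equality of the exponents holds for
  -- $d=2$.
  have hpow : ε ^ d ≤ ε ^ ((d : ℝ) / 2 + 1) := by
    rw [← Real.rpow_natCast]
    refine Real.rpow_le_rpow_of_exponent_ge h0 h1.le ?_
    have : (2 : ℝ) ≤ d := by exact_mod_cast (by omega : 2 ≤ d)
    linarith
  rw [norm_norm, Real.norm_of_nonneg (Real.rpow_nonneg h0.le _), mul_assoc]
  refine hyb.trans (mul_le_mul_of_nonneg_left (hΩv.trans ?_) (Real.sqrt_nonneg _))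
  exact mul_le_mul_of_nonneg_left hpow hv0
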